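/- Let $\mathbb K$ be a field of characteristic $0$ and $I$ a finite set. For $i,j\in I$ let $$\zeta_{ij}(x)=\frac{\alpha_{ij}\,x^{s_{ij}}}{(1-x)^{\delta_{ij}}}\prod_{e=1}^{\#_{ij}}(1-xq_e^{ij}),\qquad \alpha_{ij},q^{ij}_e\in\mathbb K^\times,\ s_{ij}\in\mathbb Z,\ \#_{ij}\ge 0 .$$ **Shuffle algebras.** For $\boldsymbol n=(n_i)_{i\in I}\in\mathbb N^I$ ($0\in\mathbb N$) put $\mathcal V_{\pm\boldsymbol n}=\mathbb K[z_{i1}^{\pm1},\dots,z_{in_i}^{\pm1}]_{i\in I}^{\mathrm{sym}}$ (Laurent polynomials symmetric in $z_{i1},\dots,z_{in_i}$ for each $i$ separately), and $\mathcal V^\pm=\bigoplus_{\boldsymbol n}\mathcal V_{\pm\boldsymbol n}$. On $\mathcal V^+$ one has the shuffle product: for $R$ of degree $\boldsymbol n$ and $R'$ of degree $\boldsymbol n'$, with $\boldsymbol n!=\prod_i n_i!$, $$R*R'=\mathrm{Sym}\Big[\frac{R(z_{ia})_{a\le n_i}\,R'(z_{ia})_{n_i<a\le n_i+n'_i}}{\boldsymbol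 n!\,\boldsymbol n'!}\prod_{i,j\in I}\ \prod_{a\le n_i,\ n_j<b\le n_j+n_j'}\zeta_{ij}\Big(\frac{z_{ia}}{z_{jb}}\Big)\Big],$$ where $\mathrm{Sym}$ is the sum over all permutations of $z_{i1},z_{i2},\dots$ for each $i$ separately; on $\mathcal V^-$ one replaces $\zeta_{ij}(z_{ia}/z_{jb})$ by $\zeta_{ji}(z_{jb}/z_{ia})$. Let $\mathbf F^+$ (resp. $\mathbf F^-$) be the free $\mathbb K$-algebra on symbols $e_{i,d}$ (resp. $f_{i,d}$), $i\in I$, $d\in\mathbb Z$, let $\Upsilon^\pm:\mathbf F^\pm\to\mathcal V^\pm$ be the algebra homomorphism sending $e_{i,d}$ (resp. $f_{i,d}$) to $z_{i1}^d$, and let $K^\pm=\operatorname{Ker}\Upsilon^\pm$. For $R\in\mathcal V_{-\boldsymbol n}$, resp. $R\in\mathcal V_{\boldsymbol n}$, define bilinear pairings by $$\langle e_{i_1,d_1}\cdots e_{i_n,d_n},R\rangle=\int_{|z_1|\gg\dots\gg|z_n|}\frac{z_1^{d_1}\cdots z_n^{d_n}R(z_1,\dots,z_n)}{\prod_{a<b}\zeta_{i_bi_a}(z_b/z_a)},\qquad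 \langle R,f_{i_1,d_1}\cdots f_{i_n,d_n}\rangle=\int_{|z_1|\ll\dots\ll|z_n|}\frac{z_1^{d_1}\cdots z_n^{d_n}R(z_1,\dots,z_n)}{\prod_{a<b}\zeta_{i_ai_b}(z_a/z_b)}$$ if $i\in I$ occurs exactly $n_i$ times among $i_1,\dots,i_n$ for every $i$, and $0$ otherwise. Here the integral denotes the constant term of the expansion in the indicated region (that is, in powers of $z_b/z_a$, resp. $z_a/z_b$, for $a<b$), and $z_a$ stands for $z_{i_ac}$ if $i_a$ is the $c$-th occurrence of that index among $i_1,\dots,i_n$. Let $\mathcal S^-=\{R\in\mathcal V^-:\langle K^+,R\rangle=0\}$, $\mathcal S^+=\{R\in\mathcal V^+:\langle R,K^-\rangle=0\}$ and $\mathcal S_{\pm\boldsymbol n}=\mathcal S^\pm\cap\mathcal V_{\pm\boldsymbol n}$. (Both $\Upsilon^\pm$ and the pairings factor through the quadratic quantum loop groups $\widetilde{\mathbf U}^\pm$, which are quotients of $\mathbf F^\pm$, so that $\mathcal S^\pm$ is equally the orthogonal complement of the kernel of $\widetilde{\mathbf U}^\mp\to\mathcal V^\mp$.) **Induced ideals.**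 For $\boldsymbol k\le\boldsymbol n$ (componentwise) and an ideal $\mathcal I\subseteq\mathbb K[z_{i1}^{\pm1},\dots,z_{ik_i}^{\pm1}]_{i\in I}$, let $\mathcal I^{(\boldsymbol n)}\subseteq\mathbb K[z_{i1}^{\pm1},\dots,z_{in_i}^{\pm1}]_{i\in I}$ be the intersection, over all families of injections $C_i:\{1,\dots,k_i\}\to\{1,\dots,n_i\}$ ($i\in I$), of the ideals generated by the image of $\mathcal I$ under $z_{ia}\mapsto z_{i\,C_i(a)}$. **Theorem.** There exist ideals $\mathcal I_{p,\boldsymbol k}\subseteq\mathbb K[z_{i1}^{\pm1},\dots,z_{ik_i}^{\pm1}]_{i\in I}$, one for every $\boldsymbol k\in\mathbb N^I$ and every $p=(p_{ia})\in(\mathbb K^\times)^k/\mathbb K^\times$ (where $k=\sum_i k_i$ and $\mathbb K^\times$ acts by simultaneous rescaling), such that each $\mathcal I_{p,\boldsymbol k}$ is homogeneous for the total degree; each $\mathcal I_{p,\boldsymbol k}$ is supported on the line $p\mathbb K^\times$, i.e. the support of the quotient ring by $\mathcal I_{p,\boldsymbol k}$ is contained in the closed subset defined by the equations $p_{jb}z_{ia}=p_{ia}z_{jb}$;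 and for every $\boldsymbol n\in\mathbb N^I$ and both signs $$\mathcal S_{\pm\boldsymbol n}=\mathcal V_{\pm\boldsymbol n}\ \cap\bigcap_{\boldsymbol 0\le\boldsymbol k\le\boldsymbol n}\ \bigcap_{p\in(\mathbb K^\times)^k/\mathbb K^\times}\mathcal I_{p,\boldsymbol k}^{(\boldsymbol n)} .$$ -/

import Mathlib

open scoped LaurentPolynomial DirectSum

namespace QuiverShuffle

noncomputable section

/-! ### Laurent polynomials and rational functions in several variables -/

/-- The ring `K[z_v^{±1}]_{v ∈ σ}` of Laurent polynomials in the variables `z_v`, `v ∈ σ`: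
the group algebra of the group of exponent vectors. -/
abbrev Laurent (K σ : Type*) [Field K] : Type _ := AddMonoidAlgebra K (σ →₀ ℤ)

/-- The field `K(z_v)_{v ∈ σ}` of rational functions. -/
abbrev Rational (K σ : Type*) [Field K] : Type _ := FractionRing (Laurent K σ)

/-- The variable `z_v`, as a unit of the Laurent polynomial ring. -/
def laurentVar (K : Type*) [Field K] {σ : Type*} (v : σ) : (Laurent K σ)ˣ :=
  (AddMonoidAlgebra.of K (σ →₀ ℤ)).toHomUnits (Multiplicative.ofAdd (Finsupp.single v 1))

/-- The variable `z_v`, as a non-zero rational function. -/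
def rationalVar (K : Type*) [Field K] {σ : Type*} (v : σ) : (Rational K σ)ˣ :=
  Units.map (algebraMap (Laurent K σ) (Rational K σ)).toMonoidHom (laurentVar K v)

/-- Evaluation of Laurent polynomials at a tuple of invertible elements, `z_v ↦ x v`. -/
def evalAt (K : Type*) [Field K] {σ F : Type*} [CommRing F] [Algebra K F] (x : σ → Fˣ) :
    Laurent K σ →ₐ[K] F :=
  AddMonoidAlgebra.lift K F (σ →₀ ℤ)
    { toFun := fun e => ((e.toAdd.prod fun v m => x v ^ m : Fˣ) : F)
      map_one' := by simp
      map_mul' := fun e f => by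
        rw [toAdd_mul, Finsupp.prod_add_index' (by simp) (by intros; rw [zpow_add]),
          Units.val_mul] }

/-- The ring homomorphism `z_v ↦ z_{c(v)}` between Laurent polynomial rings. -/
def rename (K : Type*) [Field K] {σ τ : Type*} (c : σ → τ) : Laurent K σ →ₐ[K] Laurent K τ :=
  AddMonoidAlgebra.mapDomainAlgHom K K (Finsupp.mapDomain.addMonoidHom c)

theorem rename_injective (K : Type*) [Field K] {σ τ : Type*} (c : σ ↪ τ) :
    Function.Injective (rename K c) :=
  AddMonoidAlgebra.mapDomain_injective (Finsupp.mapDomain_injective c.injective)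

/-- The field homomorphism `z_v ↦ z_{c(v)}` between fields of rational functions,
for an injective map `c` of index sets. -/
def renameRational (K : Type*) [Field K] {σ τ : Type*} (c : σ ↪ τ) :
    Rational K σ →ₐ[K] Rational K τ :=
  IsFractionRing.liftAlgHom
    (g := (IsScalarTower.toAlgHom K (Laurent K τ) (Rational K τ)).comp (rename K c))
    ((IsFractionRing.injective (Laurent K τ) (Rational K τ)).comp (rename_injective K c))

/-! ### The variables `z_{ia}` and symmetric Laurent polynomials -/

section Variables

variable {I : Type*}

/-- The index set `{(i,a) : i ∈ I, 1 ≤ a ≤ n_i}` (with `a` numbered from `0`). -/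
abbrev Var (n : I → ℕ) : Type _ := Σ i, Fin (n i)

/-- `(i,a) ↦ (i, c_i(a))` for a family of injections `c_i : {1,…,k_i} → {1,…,n_i}`. -/
def varMap {k n : I → ℕ} (c : ∀ i, Fin (k i) ↪ Fin (n i)) : Var k ↪ Var n :=
  Function.Embedding.sigmaMap (Function.Embedding.refl I) c

/-- `(i,a) ↦ (i,a)`, from the variables of degree `m` to those of degree `m + n`. -/
def varLeft (m n : I → ℕ) : Var m ↪ Var (m + n) :=
  varMap fun i => (Fin.castAddEmb (n i)).trans (Function.Embedding.refl (Fin ((m + n) i)))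

/-- `(i,b) ↦ (i, m_i + b)`, from the variables of degree `n` to those of degree `m + n`. -/
def varRight (m n : I → ℕ) : Var n ↪ Var (m + n) :=
  varMap fun i => (Fin.natAddEmb (m i)).trans (Function.Embedding.refl (Fin ((m + n) i)))

/-- The space `V_{±n} = K[z_{i1}^{±1}, …, z_{i n_i}^{±1}]_{i ∈ I}^{sym}` of Laurent polynomials
that are symmetric in `z_{i1}, …, z_{i n_i}` for each `i` separately. -/
def symLaurent (K : Type*) [Field K] (n : I → ℕ) : Submodule K (Laurent K (Var n)) where
  carrier := {f | ∀ s : ∀ i, Equiv.Perm (Fin (n i)),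
    rename K (varMap fun i => (s i).toEmbedding) f = f}
  add_mem' := fun hf hg s => by rw [map_add, hf s, hg s]
  zero_mem' := fun s => map_zero _
  smul_mem' := fun c f hf s => by rw [map_smul, hf s]

end Variables

/-! ### The functions `ζ_{ij}` and the shuffle product -/

/-- The two halves of the construction, indexed by the sign `±`. -/
inductive Half
  | plus
  | minus

/-- The opposite half. -/
def Half.opp : Half → Half
  | .plus => .minus
  | .minus => .plus

section Shuffle

variable {K : Type*} [Field K] {I : Type*} [DecidableEq I]

/-- The value at `x` of `ζ_{ij}(x) = ζ̃_{ij}(x) / (1 - x)^{δ_{ij}}`, where the numerators `ζ̃_{ij}`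
are given Laurent polynomials. It is used only at elements `x` transcendental over `K`. -/
def zetaEval (ζt : I → I → K[T;T⁻¹]) {F : Type*} [Field F] [Algebra K F] (i j : I) (x : Fˣ) : F :=
  LaurentPolynomial.eval₂ (algebraMap K F) x (ζt i j) / (if i = j then 1 - (x : F) else 1)

/-- The factor `ζ_{ij}(x/y)` in the `+` half, and `ζ_{ji}(y/x)` in the `-` half. -/
def cross (ζt : I → I → K[T;T⁻¹]) {F : Type*} [Field F] [Algebra K F] (ε : Half) (i j : I)
    (x y : Fˣ) : F :=
  match ε with
  | .plus => zetaEval ζt i j (x / y)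
  | .minus => zetaEval ζt j i (y / x)

variable [Fintype I]

/-- The symmetrization `Sym`: the sum over all permutations of `z_{i1}, …, z_{i n_i}`
for each `i` separately. -/
def symmetrize {n : I → ℕ} (f : Rational K (Var n)) : Rational K (Var n) :=
  ∑ s : ∀ i, Equiv.Perm (Fin (n i)), renameRational K (varMap fun i => (s i).toEmbedding) f

/-- The shuffle product
`R * R' = Sym [ R(z_{ia})_{a ≤ m_i} R'(z_{jb})_{b > m_j} / (m! n!) ∏ ζ_{ij}(z_{ia}/z_{jb}) ]`
of the `+` half, where the product is over `a ≤ m_i`, `m_j < b ≤ m_j + n_j`; in the `-` half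
`ζ_{ij}(z_{ia}/z_{jb})` is replaced by `ζ_{ji}(z_{jb}/z_{ia})`. The formula makes sense for all
rational functions; it maps symmetric Laurent polynomials to symmetric Laurent polynomials. -/
def shuffleMul (ζt : I → I → K[T;T⁻¹]) (ε : Half) {m n : I → ℕ}
    (f : Rational K (Var m)) (g : Rational K (Var n)) : Rational K (Var (m + n)) :=
  symmetrize
    (renameRational K (varLeft m n) f * renameRational K (varRight m n) g /
        (((∏ i, (m i).factorial) * (∏ i, (n i).factorial) : ℕ) : Rational K (Var (m + n))) *
      ∏ u : Var m, ∏ v : Var n,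
        cross ζt ε u.1 v.1 (rationalVar K (varLeft m n u)) (rationalVar K (varRight m n v)))

/-! ### The map `Υ̃` -/

/-- The degree `ς^{i_1} + ⋯ + ς^{i_n}` of a word in the letters `(i, d) ∈ I × ℤ`. -/
def wordDeg : List (I × ℤ) → (I → ℕ)
  | [] => 0
  | x :: w => Pi.single x.1 1 + wordDeg w

/-- The image `z_{i_1 1}^{d_1} * (z_{i_2 1}^{d_2} * ( ⋯ * 1))` in the shuffle algebra of the word
`(i_1,d_1) ⋯ (i_n,d_n)`. -/
def upsilonWord (ζt : I → I → K[T;T⁻¹]) (ε : Half) :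
    (w : List (I × ℤ)) → Rational K (Var (wordDeg w))
  | [] => 1
  | x :: w => shuffleMul ζt ε (m := Pi.single x.1 1)
      ((rationalVar K (⟨x.1, ⟨0, by simp⟩⟩ : Var (Pi.single x.1 1)) ^ x.2 :
        (Rational K (Var (Pi.single x.1 1)))ˣ) : Rational K (Var (Pi.single x.1 1)))
      (upsilonWord ζt ε w)

/-- The algebra homomorphism from the free algebra on the symbols `e_{i,d}` (`+` half), resp.
`f_{i,d}` (`-` half), `(i,d) ∈ I × ℤ`, to the big shuffle algebra, with `e_{i,d} ↦ z_{i1}^d`,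
resp. `f_{i,d} ↦ z_{i1}^d`. The big shuffle algebra is regarded inside `⨁_n K(z_{ia})`.

The quadratic quantum loop group is the quotient of this free algebra by an ideal contained in
the kernel of this map; so the kernel of this map is the preimage of `K^± = Ker Υ̃^±`. -/
def upsilon (ζt : I → I → K[T;T⁻¹]) (ε : Half) :
    FreeAlgebra K (I × ℤ) →ₗ[K] ⨁ n : I → ℕ, Rational K (Var n) :=
  (FreeAlgebra.basisFreeMonoid K (I × ℤ)).constr K fun w =>
    DirectSum.lof K (I → ℕ) (fun n => Rational K (Var n)) (wordDeg w.toList)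
      (upsilonWord ζt ε w.toList)

/-! ### The pairing -/

/-- The relabeling `z_{i_a •_a} ↔ z_a` of the variables in accordance with the letters
`i_1, …, i_n` of a word: it sends `(i, c)` to the position of the `c`-th letter `i` of the word. -/
def relabel : (w : List (I × ℤ)) → Var (wordDeg w) → Fin w.length
  | [], v => (Nat.not_lt_zero _ v.2.isLt).elim
  | x :: w, ⟨j, b⟩ =>
      Fin.addCases (m := (Pi.single x.1 1 : I → ℕ) j) (n := wordDeg w j)
        (motive := fun _ => Fin (w.length + 1))
        (fun _ => 0) (fun c => (relabel w ⟨j, c⟩).succ) b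

variable (K) in
/-- The field in which rational functions of `z_1, …, z_n` are expanded: Hahn series with
exponents in `ℤ^n`, ordered lexicographically. -/
abbrev Expansion (n : ℕ) : Type _ := HahnSeries (Lex (Fin n → ℤ)) K

variable (K) in
/-- The variable `z_a` in the field of expansions. In the `+` half it is the monomial with exponent
vector `-ε_a`, so that `z_b/z_a` has positive order for `a < b` and rational functions are expanded
in the region `|z_1| ≫ ⋯ ≫ |z_n|`. In the `-` half it is the monomial with exponent vector `ε_a`,
so that `z_a/z_b` has positive order for `a < b` and the region is `|z_1| ≪ ⋯ ≪ |z_n|`. -/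
def expansionVar (ε : Half) {n : ℕ} (a : Fin n) : (Expansion K n)ˣ :=
  Units.mk0
    (HahnSeries.single
      (toLex (Pi.single a (match ε with | .plus => -1 | .minus => 1) : Fin n → ℤ)) (1 : K))
    (by simp)

/-- The pairing of a word `(i_1,d_1) ⋯ (i_n,d_n)` of the `ε` half with a Laurent polynomial `R`
of the opposite half, of the same degree. For `ε = +` it is
`∫_{|z_1| ≫ ⋯ ≫ |z_n|} z_1^{d_1} ⋯ z_n^{d_n} R(z_1,…,z_n) / ∏_{a<b} ζ_{i_b i_a}(z_b/z_a)`,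
for `ε = -` it is
`∫_{|z_1| ≪ ⋯ ≪ |z_n|} z_1^{d_1} ⋯ z_n^{d_n} R(z_1,…,z_n) / ∏_{a<b} ζ_{i_a i_b}(z_a/z_b)`,
where the integral denotes the constant term of the expansion. -/
def pairWord (ζt : I → I → K[T;T⁻¹]) (ε : Half) (w : List (I × ℤ)) :
    symLaurent K (wordDeg w) →ₗ[K] K where
  toFun := fun R =>
    HahnSeries.coeff
      (((∏ a : Fin w.length, expansionVar K ε a ^ (w.get a).2 : (Expansion K w.length)ˣ) :
          Expansion K w.length) *
        evalAt K (fun v => expansionVar K ε (relabel w v)) (R : Laurent K (Var (wordDeg w))) /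
        ∏ a : Fin w.length, ∏ b ∈ Finset.Ioi a,
          cross ζt ε.opp (w.get a).1 (w.get b).1 (expansionVar K ε a) (expansionVar K ε b)) 0
  map_add' := fun R R' => by
    rw [Submodule.coe_add, map_add, mul_add, add_div, HahnSeries.coeff_add]
  map_smul' := fun c R => by
    rw [Submodule.coe_smul, map_smul, mul_smul_comm, smul_div_assoc, HahnSeries.coeff_smul,
      RingHom.id_apply]

/-- The pairing between the free algebra of the `ε` half and the big shuffle algebra
`V = ⨁_n V_n` of the opposite half; a word pairs to zero with `V_n` unless it has degree `n`.
It factors through the quadratic quantum loop group in the first argument. -/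
def pairing (ζt : I → I → K[T;T⁻¹]) (ε : Half) :
    FreeAlgebra K (I × ℤ) →ₗ[K] (⨁ n : I → ℕ, symLaurent K n) →ₗ[K] K :=
  (FreeAlgebra.basisFreeMonoid K (I × ℤ)).constr K fun w =>
    (pairWord ζt ε w.toList).comp
      (DirectSum.component K (I → ℕ) (fun n => symLaurent K n) (wordDeg w.toList))

/-! ### The shuffle algebra -/

/-- The shuffle algebra `S^±`: all elements of the big shuffle algebra `V^±` that pair to zero with
the kernel `K^∓` of the map `Υ̃^∓` of the opposite half. -/
def shuffleAlgebra (ζt : I → I → K[T;T⁻¹]) (ε : Half) :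
    Submodule K (⨁ n : I → ℕ, symLaurent K n) :=
  ⨅ x ∈ LinearMap.ker (upsilon ζt ε.opp), LinearMap.ker (pairing ζt ε.opp x)

/-- The graded piece `S_{±n} = S^± ∩ V_{±n}`, as a subspace of the Laurent polynomials. -/
def shuffleDegree (ζt : I → I → K[T;T⁻¹]) (ε : Half) (n : I → ℕ) :
    Submodule K (Laurent K (Var n)) :=
  ((shuffleAlgebra ζt ε).comap
    (DirectSum.lof K (I → ℕ) (fun n => symLaurent K n) n)).map (symLaurent K n).subtype

end Shuffle

/-! ### Points and ideals -/

section Points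

variable {I : Type*}

/-- The set `(K^×)^k / K^×` of tuples `(p_{ia})` up to simultaneous rescaling. -/
abbrev PointClass (K : Type*) [Field K] (k : I → ℕ) : Type _ :=
  MulAction.orbitRel.Quotient Kˣ (Var k → Kˣ)

/-- The class of a tuple. -/
def pointClass {K : Type*} [Field K] {k : I → ℕ} (p : Var k → Kˣ) : PointClass K k :=
  Quotient.mk (MulAction.orbitRel Kˣ (Var k → Kˣ)) p

/-- The ideal `(p_w z_v - p_v z_w)_{v,w}` of the line `pK^×`. -/
def lineIdeal {K : Type*} [Field K] {k : I → ℕ} (p : Var k → Kˣ) : Ideal (Laurent K (Var k)) :=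
  Ideal.span {f | ∃ v w : Var k,
    f = (p w : K) • (laurentVar K v : Laurent K (Var k)) -
      (p v : K) • (laurentVar K w : Laurent K (Var k))}

/-- An ideal is supported on the line `pK^×` if the quotient by it is a module whose support is
contained in the line. -/
def IsSupportedOnLine {K : Type*} [Field K] {k : I → ℕ} (p : Var k → Kˣ)
    (J : Ideal (Laurent K (Var k))) : Prop :=
  Module.support (Laurent K (Var k)) (Laurent K (Var k) ⧸ J) ⊆
    PrimeSpectrum.zeroLocus (lineIdeal p : Set (Laurent K (Var k)))

/-- Homogeneity with respect to the total degree, in which all variables `z_v` have degree `1`. -/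
def IsHomogeneousIdeal {K : Type*} [Field K] {σ : Type*} (J : Ideal (Laurent K σ)) : Prop :=
  J.IsHomogeneous
    (AddMonoidAlgebra.gradeBy K (Finsupp.degree : (σ →₀ ℤ) →+ ℤ) : ℤ → Submodule K (Laurent K σ))

/-- The induced ideal `J^{(n)}`: the intersection, over all families of injections
`C_i : {1,…,k_i} → {1,…,n_i}`, of the ideals generated by the images of `J` under
`z_{ia} ↦ z_{i C_i(a)}`. -/
def inducedIdeal {K : Type*} [Field K] {k : I → ℕ} (J : Ideal (Laurent K (Var k)))
    (n : I → ℕ) : Ideal (Laurent K (Var n)) :=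
  ⨅ C : ∀ i, Fin (k i) ↪ Fin (n i), J.map (rename K (varMap C))

end Points

end

end QuiverShuffle

/-!
Fix a finite set of variables `z_u` with colours in `I` and call an injection `h` of the set of
variables into `ℕ` a height function; it prescribes the region in which `z_u/z_v` is small whenever
`h u < h v`. Put `E_h = ∏ 1/ζ(z_u/z_v)`, the product over all pairs with `h u < h v` (`kernelFun`),
and let `CT_h` be the constant term of the expansion in the region of `h` (`constTerm`). The
*relation ideal* `J` (`relIdeal`) consists of all Laurent polynomials `R` such that every linear
relation `∑_h φ_h E_h = 0` with Laurent polynomials `φ_h` implies `∑_h CT_h(φ_h R E_h) = 0`. It is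
an ideal, it is homogeneous because all `E_h` have degree zero, and it does not refer to a sign.
Write `J_n` for the relation ideal in the variables `z_{ia}`, `a ≤ n_i`.

*The shuffle algebra is `V_n ∩ J_n`* (`shuffleDegree_eq`). The image of a word under `Υ` is the
symmetrization of `z^d ∏ ζ` (`upsilonWord_eq_symmetrize`), and this function is the product of a
function `∏_{u ≠ v} ζ(z_u/z_v)`, common to all words and invariant under permutations, with
`z^d E_h`, where `h` is the order of the letters (`wordFun_eq`). The pairing of the word with a
symmetric `R` is `CT_h(z^d R E_h)`, since the coefficients of the expansion of `E_h` depend only on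
which ratios of variables are small (`pairWord_eq`, `sameCoeff_expand_kernelFun`). All pairs of a
monomial and an order come from words (`exists_word`), so that elements of the kernel of `Υ` amount
to relations among the `E_h`; symmetrizing relations costs only a factorial.

*Restriction* (`relIdeal_le_map`). For a subset `X` of the variables, `J` is contained in the ideal
generated by the relation ideal `J_X` in the variables from `X`: up to factors `1 - z_u/z_v` with
`u` or `v` outside of `X`, which are non-zero-divisors modulo the extension of `J_X`, a relation
among the functions `E_h` of the variables from `X` is a relation among functions `E_h` of all
variables.

*Gluing* (`mixedNum_mul_mem`). For a partition of the variables into parts `X`, `Y`, the product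
`g_{XY}` of the numerators of all `ζ(z_u/z_v)` with `u`, `v` in different parts multiplies the
intersection of the extensions of `J_X` and `J_Y` into `J`. Indeed `g_{XY} E_h` is a Laurent
polynomial times a function of the variables from `X` times a function of the variables from `Y`, so
that the constant terms factor. Moreover, for fixed `r` in `J_X` the constant terms `CT_h(f r E_h)`
depend only on the function `f E_h` (`exists_form`), and likewise for `Y`; hence, for `R` in both
extensions, `∑_h CT_h(φ_h g_{XY} R E_h)` depends only on `∑_h φ_h g_{XY} E_h`.

*Lines* (`exists_line_of_prime`). A prime ideal containing all `g_{XY}` contains the ideal `P_p` of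
a line `p K^×`: being proportional modulo the prime ideal is an equivalence relation on the
variables, and if it had more than one class, then a class and its complement would contradict that
`g_{XY}` is in the prime ideal.

Now let `𝓘_{p,k} = J_k + P_p^N`, with `N` so large that the `N`-th power of the radical of each
primary component of `J_k` lies in that component (`pointIdeal`, `exists_pow_bound`). By restriction
`J_n` is contained in all induced ideals. Conversely, let `x` lie in all induced ideals. By
induction on the number of variables, `x` lies in the extension of the relation ideal of every
proper subset of the variables, so `g_{XY} x ∈ J_n` for all partitions. A primary component of `J_n`
whose radical misses some `g_{XY}` therefore contains `x`; the radical of any other one contains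
some `P_p`, and then the component contains `J_n + P_p^N`, which contains `x`
(`mem_relIdealVar_of_forall`).
-/

open scoped TensorProduct

namespace QuiverShuffle

noncomputable section

/-! ### Laurent polynomials -/

section Laurent

variable {K : Type*} [Field K] {σ τ υ : Type*}

theorem rename_single (a : σ → τ) (m : σ →₀ ℤ) (r : K) :
    rename K a (AddMonoidAlgebra.single m r) = AddMonoidAlgebra.single (m.mapDomain a) r := by
  simp [rename]

theorem laurentVar_val (v : σ) :
    (laurentVar K v : Laurent K σ) = AddMonoidAlgebra.single (Finsupp.single v 1) 1 := rfl

theorem rename_laurentVar (a : σ → τ) (v : σ) :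
    rename K a (laurentVar K v : Laurent K σ) = (laurentVar K (a v) : Laurent K τ) := by
  rw [laurentVar_val, rename_single, Finsupp.mapDomain_single, laurentVar_val]

/-- A monomial is the product of the powers of the variables. -/
theorem single_eq_prod_laurentVar (m : σ →₀ ℤ) :
    AddMonoidAlgebra.single m (1 : K) =
      ((m.prod fun v e => laurentVar K v ^ e : (Laurent K σ)ˣ) : Laurent K σ) := by
  have h : ∀ f : Multiplicative (σ →₀ ℤ) →* (Laurent K σ)ˣ,
      ∀ m : σ →₀ ℤ, f (Multiplicative.ofAdd m) =
        m.prod fun v e => f (Multiplicative.ofAdd (Finsupp.single v 1)) ^ e := by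
    intro f m
    induction m using Finsupp.induction_linear with
    | zero => simp
    | add p q hp hq =>
      rw [ofAdd_add, map_mul, hp, hq,
        Finsupp.prod_add_index' (by simp) (by intros; rw [zpow_add])]
    | single v e =>
      rw [Finsupp.prod_single_index (by simp), ← map_zpow, ← ofAdd_zsmul]
      simp
  have := h (AddMonoidAlgebra.of K (σ →₀ ℤ)).toHomUnits m
  exact congrArg Units.val this

theorem laurent_algHom_ext {F : Type*} [CommRing F] [Algebra K F] {f g : Laurent K σ →ₐ[K] F}
    (h : ∀ v : σ, f (laurentVar K v : Laurent K σ) = g (laurentVar K v : Laurent K σ)) : f = g := by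
  refine AddMonoidAlgebra.algHom_ext (fun m => ?_) (Subsingleton.elim _ _)
  have key : ∀ v : σ, Units.map (f : Laurent K σ →* F) (laurentVar K v) =
      Units.map (g : Laurent K σ →* F) (laurentVar K v) := fun v => Units.ext (h v)
  rw [single_eq_prod_laurentVar]
  have : Units.map (f : Laurent K σ →* F) (m.prod fun v e => laurentVar K v ^ e) =
      Units.map (g : Laurent K σ →* F) (m.prod fun v e => laurentVar K v ^ e) := by
    simp only [map_finsuppProd, map_zpow, key]
  exact congrArg Units.val this

theorem rename_comp (a : σ → τ) (b : τ → υ) :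
    (rename K b).comp (rename K a) = rename K (b ∘ a) := by
  apply laurent_algHom_ext
  intro v
  simp [rename_laurentVar]

theorem rename_id (f : Laurent K σ) : rename K (id : σ → σ) f = f := by
  have : rename K (id : σ → σ) = AlgHom.id K _ := by
    apply laurent_algHom_ext
    intro v
    simp [rename_laurentVar]
  rw [this]; rfl

theorem evalAt_laurentVar {F : Type*} [CommRing F] [Algebra K F] (x : σ → Fˣ) (v : σ) :
    evalAt K x (laurentVar K v : Laurent K σ) = (x v : F) := by
  rw [laurentVar_val, evalAt, AddMonoidAlgebra.lift_single, one_smul]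
  change (((Finsupp.single v (1 : ℤ)).prod fun v m => x v ^ m : Fˣ) : F) = _
  rw [Finsupp.prod_single_index (zpow_zero _), zpow_one]

/-! ### Coefficients with respect to a subset of the variables -/

/-- For `a : σ ↪ τ` and a Laurent polynomial `x` in the variables `z_t`, `t ∈ τ`, the Laurent
polynomial in the variables `z_v`, `v ∈ σ`, whose coefficient at `m` is the coefficient of `x` at
`a(m) + e`. When `e` runs over the exponents supported outside of the image of `a`, these are the
coefficients of `x` viewed as a Laurent polynomial in the other variables. -/
def coeffAlong (a : σ ↪ τ) (e : τ →₀ ℤ) : Laurent K τ →ₗ[K] Laurent K σ where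
  toFun x := .ofCoeff (x.coeff.comapDomain (fun m => m.mapDomain a + e)
    (fun _ _ _ _ h => Finsupp.mapDomain_injective a.injective (add_right_cancel h)))
  map_add' x y := by ext; rfl
  map_smul' c x := by ext; rfl

theorem coeffAlong_coeff (a : σ ↪ τ) (e : τ →₀ ℤ) (x : Laurent K τ) (m : σ →₀ ℤ) :
    (coeffAlong a e x).coeff m = x.coeff (m.mapDomain a + e) := rfl

theorem coeffAlong_rename_mul (a : σ ↪ τ) (e : τ →₀ ℤ) (f : Laurent K σ) (x : Laurent K τ) :
    coeffAlong a e (rename K a f * x) = f * coeffAlong a e x := by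
  induction f using AddMonoidAlgebra.induction_linear with
  | zero => simp
  | add f g hf hg => rw [map_add, add_mul, map_add, hf, hg, add_mul]
  | single m r =>
    rw [rename_single]
    ext k
    rw [coeffAlong_coeff, AddMonoidAlgebra.coeff_single_mul_apply,
      AddMonoidAlgebra.coeff_single_mul_apply,
      coeffAlong_coeff]
    congr 2
    rw [Finsupp.mapDomain_add, ← Finsupp.mapDomain.addMonoidHom_apply (v := -m), map_neg]
    simp [add_assoc]

theorem coeffAlong_mem_of_mem_map {a : σ ↪ τ} {J : Ideal (Laurent K σ)} {x : Laurent K τ}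
    (hx : x ∈ J.map (rename K a)) (e : τ →₀ ℤ) : coeffAlong a e x ∈ J := by
  suffices ∀ c, coeffAlong a e (c * x) ∈ J by simpa using this 1
  induction hx using Submodule.span_induction with
  | mem x h =>
    obtain ⟨f, hf, rfl⟩ := h
    intro c
    rw [mul_comm]
    exact (coeffAlong_rename_mul a e f c) ▸ J.mul_mem_right _ hf
  | zero => simp
  | add x y _ _ hx hy => intro c; rw [mul_add, map_add]; exact J.add_mem (hx c) (hy c)
  | smul d x hx ih => intro c; rw [smul_eq_mul, ← mul_assoc]; exact ih _

/-- Laurent polynomials in all variables are a free module over those in the variables `z_v`,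
`v ∈ σ`, and an extended ideal consists of the elements with coefficients in the ideal. -/
theorem mem_map_of_forall_coeffAlong_mem {a : σ ↪ τ} {J : Ideal (Laurent K σ)} {x : Laurent K τ}
    (hx : ∀ e, coeffAlong a e x ∈ J) : x ∈ J.map (rename K a) := by
  -- Remove from `x` all terms whose exponents lie in one coset of the exponents of the `z_v`.
  induction hn : x.coeff.support.card using Nat.strong_induction_on generalizing x with
  | _ n ih =>
    by_cases h0 : x = 0
    · rw [h0]; exact Ideal.zero_mem _
    obtain ⟨k, hk⟩ : ∃ k, x.coeff k ≠ 0 := by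
      by_contra! h
      exact h0 (by ext k; simpa using h k)
    set t : Laurent K τ := rename K a (coeffAlong a k x) * AddMonoidAlgebra.single k 1 with ht
    have htm : t ∈ J.map (rename K a) :=
      Ideal.mul_mem_right _ _ (Ideal.mem_map_of_mem _ (hx k))
    have htc : ∀ m, t.coeff m = 0 ∨ t.coeff m = x.coeff m := by
      intro m
      rw [ht, rename, AddMonoidAlgebra.coeff_mul_single_apply, mul_one]
      by_cases hm : m + -k ∈ Set.range (Finsupp.mapDomain (M := ℤ) a)
      · obtain ⟨p, hp⟩ := hm
        right
        rw [← hp]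
        have : (AddMonoidAlgebra.mapDomain (Finsupp.mapDomain a) (coeffAlong a k x)).coeff
            (p.mapDomain a) = (coeffAlong a k x).coeff p :=
          Finsupp.mapDomain_apply (Finsupp.mapDomain_injective a.injective) _ _
        refine this.trans ?_
        rw [coeffAlong_coeff, hp]
        simp
      · left
        exact Finsupp.mapDomain_of_notMem_range _ _ hm
    have htk : t.coeff k = x.coeff k := by
      rw [ht, rename, AddMonoidAlgebra.coeff_mul_single_apply, mul_one]
      have : (AddMonoidAlgebra.mapDomain (Finsupp.mapDomain a) (coeffAlong a k x)).coeff
            ((0 : σ →₀ ℤ).mapDomain a) = (coeffAlong a k x).coeff 0 :=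
          Finsupp.mapDomain_apply (Finsupp.mapDomain_injective a.injective) _ _
      rw [Finsupp.mapDomain_zero] at this
      rw [add_neg_cancel]
      refine this.trans ?_
      simp [coeffAlong_coeff]
    have hsub : (x - t).coeff.support ⊂ x.coeff.support := by
      rw [Finset.ssubset_iff_of_subset]
      · refine ⟨k, by simpa using hk, by simp [htk]⟩
      · intro m hm
        rcases htc m with h | h
        · simpa [h] using hm
        · simp [h] at hm
    have := ih _ (hn ▸ Finset.card_lt_card hsub) (x := x - t)
      (fun e => by
        rw [map_sub]
        exact J.sub_mem (hx e) (coeffAlong_mem_of_mem_map htm e)) rfl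
    simpa using Ideal.add_mem _ this htm

theorem mem_map_rename_iff {a : σ ↪ τ} {J : Ideal (Laurent K σ)} {x : Laurent K τ} :
    x ∈ J.map (rename K a) ↔ ∀ e, coeffAlong a e x ∈ J :=
  ⟨coeffAlong_mem_of_mem_map, mem_map_of_forall_coeffAlong_mem⟩

/-- The factor `1 - c z^m` is a non-zero-divisor modulo an ideal extended from the variables `z_v`,
`v ∈ σ`, if the monomial `z^m` involves another variable. -/
theorem mem_map_of_mul_mem {a : σ ↪ τ} {J : Ideal (Laurent K σ)} {x : Laurent K τ} {t : τ}
    (ht : t ∉ Set.range a) {m : τ →₀ ℤ} (hm : m t ≠ 0) (c : K)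
    (hx : (1 - AddMonoidAlgebra.single m c) * x ∈ J.map (rename K a)) :
    x ∈ J.map (rename K a) := by
  rw [mem_map_rename_iff] at hx ⊢
  have hshift : ∀ e, coeffAlong a e (AddMonoidAlgebra.single m c * x) =
      c • coeffAlong a (e - m) x := by
    intro e
    ext k
    rw [coeffAlong_coeff, AddMonoidAlgebra.coeff_single_mul_apply, AddMonoidAlgebra.coeff_smul,
      Finsupp.smul_apply, coeffAlong_coeff, smul_eq_mul]
    congr 2
    abel
  have hstep : ∀ e, coeffAlong a (e - m) x ∈ J → coeffAlong a e x ∈ J := by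
    intro e he
    have := hx e
    rw [sub_mul, one_mul, map_sub, hshift] at this
    have h2 := J.add_mem this (J.smul_of_tower_mem c he)
    simpa using h2
  -- Far along the direction `m` the coefficients vanish.
  have hfar : ∀ e, ∃ n : ℕ, coeffAlong a (e - n • m) x = 0 := by
    intro e
    set B := ∑ k ∈ x.coeff.support, |k t| with hB
    have hBk : ∀ k ∈ x.coeff.support, |k t| ≤ B := fun k hk =>
      Finset.single_le_sum (f := fun k => |k t|) (fun _ _ => abs_nonneg _) hk
    refine ⟨(B + |e t| + 1).toNat, ?_⟩
    ext k
    rw [coeffAlong_coeff, AddMonoidAlgebra.coeff_zero, Finsupp.zero_apply]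
    by_contra h
    have h1 := hBk _ (Finsupp.mem_support_iff.mpr h)
    rw [Finsupp.add_apply, Finsupp.mapDomain_of_notMem_range _ _ ht, Finsupp.sub_apply,
      Finsupp.smul_apply, zero_add, nsmul_eq_mul] at h1
    have hBn : 0 ≤ B := Finset.sum_nonneg fun _ _ => abs_nonneg _
    have h2 : (((B + |e t| + 1).toNat : ℕ) : ℤ) = B + |e t| + 1 :=
      Int.toNat_of_nonneg (by positivity)
    rw [h2] at h1
    have h3 : B + |e t| + 1 ≤ |(B + |e t| + 1) * m t| := by
      rw [abs_mul, abs_of_nonneg (by positivity : 0 ≤ B + |e t| + 1)]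
      exact le_mul_of_one_le_right (by positivity) (Int.one_le_abs hm)
    have h4 := abs_sub_abs_le_abs_sub ((B + |e t| + 1) * m t) (e t)
    rw [abs_sub_comm] at h4
    omega
  intro e
  obtain ⟨n, hn⟩ := hfar e
  induction n generalizing e with
  | zero => simp at hn; rw [hn]; exact J.zero_mem
  | succ n ih =>
    apply hstep
    apply ih
    rw [← hn]
    congr 2
    rw [succ_nsmul]; abel

end Laurent

/-! ### Expansions of rational functions -/

section Expand

variable {K : Type*} [Field K] {σ τ : Type*}
variable {Γ : Type*} [AddCommGroup Γ] [LinearOrder Γ] [IsOrderedAddMonoid Γ]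
variable {Γ' : Type*} [AddCommGroup Γ'] [LinearOrder Γ'] [IsOrderedAddMonoid Γ']

variable (K) in
/-- The expansion `z^m ↦ t^{ρ(m)}` of Laurent polynomials in a field of Hahn series. -/
def expandLaurent (ρ : (σ →₀ ℤ) →+ Γ) : Laurent K σ →ₐ[K] HahnSeries Γ K :=
  AddMonoidAlgebra.lift K (HahnSeries Γ K) (σ →₀ ℤ)
    { toFun := fun m => HahnSeries.single (ρ m.toAdd) 1
      map_one' := by simp
      map_mul' := fun m m' => by simp [HahnSeries.single_mul_single] }

theorem expandLaurent_single (ρ : (σ →₀ ℤ) →+ Γ) (m : σ →₀ ℤ) (r : K) :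
    expandLaurent K ρ (AddMonoidAlgebra.single m r) = HahnSeries.single (ρ m) r := by
  rw [expandLaurent, AddMonoidAlgebra.lift_single]
  change r • HahnSeries.single (ρ m) (1 : K) = _
  ext k
  by_cases h : k = ρ m <;> simp [h]

theorem coeff_expandLaurent {ρ : (σ →₀ ℤ) →+ Γ} (hρ : Function.Injective ρ) (f : Laurent K σ)
    (m : σ →₀ ℤ) : (expandLaurent K ρ f).coeff (ρ m) = f.coeff m := by
  induction f using AddMonoidAlgebra.induction_linear with
  | zero => simp
  | add f g hf hg => simp [hf, hg]
  | single k r =>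
    rw [expandLaurent_single]
    by_cases h : m = k
    · simp [h]
    · rw [HahnSeries.coeff_single_of_ne (fun h' => h (hρ h'))]
      simp [Ne.symm h]

theorem expandLaurent_injective {ρ : (σ →₀ ℤ) →+ Γ} (hρ : Function.Injective ρ) :
    Function.Injective (expandLaurent K ρ) := by
  intro f g h
  ext m
  rw [← coeff_expandLaurent hρ, h, coeff_expandLaurent hρ]

variable (K) in
/-- The expansion of rational functions in a field of Hahn series determined by an embedding `ρ` of
the group of exponents into an ordered group. -/
def expand {ρ : (σ →₀ ℤ) →+ Γ} (hρ : Function.Injective ρ) : Rational K σ →ₐ[K] HahnSeries Γ K :=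
  IsFractionRing.liftAlgHom (expandLaurent_injective (K := K) hρ)

theorem expand_algebraMap {ρ : (σ →₀ ℤ) →+ Γ} (hρ : Function.Injective ρ) (f : Laurent K σ) :
    expand K hρ (algebraMap _ _ f) = expandLaurent K ρ f := by
  simp [expand, IsFractionRing.liftAlgHom_apply]

theorem renameRational_algebraMap (a : σ ↪ τ) (f : Laurent K σ) :
    renameRational K a (algebraMap _ _ f) = algebraMap _ _ (rename K a f) := by
  have h : Function.Injective ((IsScalarTower.toAlgHom K (Laurent K τ) (Rational K τ)).comp
      (rename K a)) := fun x y h =>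
    rename_injective K a (IsFractionRing.injective (Laurent K τ) (Rational K τ) h)
  exact IsFractionRing.lift_algebraMap (g := ((IsScalarTower.toAlgHom K (Laurent K τ)
    (Rational K τ)).comp (rename K a)).toRingHom) h f

theorem rational_algHom_ext {F : Type*} [Field F] [Algebra K F] {f g : Rational K σ →ₐ[K] F}
    (h : ∀ v : σ, f (rationalVar K v : Rational K σ) = g (rationalVar K v : Rational K σ)) :
    f = g := by
  have h2 : f.comp (IsScalarTower.toAlgHom K (Laurent K σ) (Rational K σ)) =
      g.comp (IsScalarTower.toAlgHom K (Laurent K σ) (Rational K σ)) :=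
    laurent_algHom_ext h
  refine AlgHom.coe_ringHom_injective (IsFractionRing.ringHom_ext (A := Laurent K σ) fun x => ?_)
  exact DFunLike.congr_fun h2 x

theorem rationalVar_val (v : σ) :
    (rationalVar K v : Rational K σ) = algebraMap _ _ (laurentVar K v : Laurent K σ) := rfl

theorem renameRational_rationalVar (a : σ ↪ τ) (v : σ) :
    renameRational K a (rationalVar K v : Rational K σ) = (rationalVar K (a v) : Rational K τ) := by
  rw [rationalVar_val, renameRational_algebraMap, rename_laurentVar, rationalVar_val]

theorem expand_rationalVar {ρ : (σ →₀ ℤ) →+ Γ} (hρ : Function.Injective ρ) (v : σ) :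
    expand K hρ (rationalVar K v : Rational K σ) =
      HahnSeries.single (ρ (Finsupp.single v 1)) 1 := by
  rw [rationalVar_val, expand_algebraMap, laurentVar_val, expandLaurent_single]

theorem renameRational_comp {υ : Type*} (a : σ ↪ τ) (b : τ ↪ υ) :
    (renameRational K b).comp (renameRational K a) = renameRational K (a.trans b) := by
  apply rational_algHom_ext
  intro v
  simp [renameRational_rationalVar]

theorem renameRational_renameRational {υ : Type*} (a : σ ↪ τ) (b : τ ↪ υ) (f : Rational K σ) :
    renameRational K b (renameRational K a f) = renameRational K (a.trans b) f := by
  rw [← renameRational_comp]; rfl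

theorem expand_renameRational (a : σ ↪ τ) {ρ : (τ →₀ ℤ) →+ Γ} (hρ : Function.Injective ρ)
    {ρ' : (σ →₀ ℤ) →+ Γ} (hρ' : Function.Injective ρ')
    (h : ∀ m, ρ' m = ρ (m.mapDomain a)) (f : Rational K σ) :
    expand K hρ (renameRational K a f) = expand K hρ' f := by
  have : (expand K hρ).comp (renameRational K a) = expand K hρ' := by
    apply rational_algHom_ext
    intro v
    simp [renameRational_rationalVar, expand_rationalVar, h]
  rw [← this]; rfl

/-! ### Supports of expansions -/

variable (K) in
/-- The field of Hahn series with exponents in a subgroup. -/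
def supportSubfield (H : AddSubgroup Γ) : Subfield (HahnSeries Γ K) :=
  (HahnSeries.embDomainRingHom (R := K) H.subtype H.subtype_injective
    (fun _ _ => Iff.rfl)).fieldRange

theorem support_subset_of_mem_supportSubfield {H : AddSubgroup Γ} {x : HahnSeries Γ K}
    (hx : x ∈ supportSubfield K H) : x.support ⊆ H := by
  obtain ⟨y, rfl⟩ := hx
  intro g hg
  by_contra hgH
  apply hg
  apply HahnSeries.embDomain_of_notMem_range
  rintro ⟨h, rfl⟩
  exact hgH h.2

theorem single_mem_supportSubfield {H : AddSubgroup Γ} {g : Γ} (hg : g ∈ H) (r : K) :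
    HahnSeries.single g r ∈ supportSubfield K H :=
  ⟨HahnSeries.single (⟨g, hg⟩ : H) r, HahnSeries.embDomain_single⟩

theorem expandLaurent_mem_supportSubfield {ρ : (σ →₀ ℤ) →+ Γ} (f : Laurent K σ)
    {H : AddSubgroup Γ} (h : ∀ m ∈ f.coeff.support, ρ m ∈ H) :
    expandLaurent K ρ f ∈ supportSubfield K H := by
  have : f = f.coeff.sum AddMonoidAlgebra.single := by
    ext; simp
  rw [this, map_finsuppSum]
  refine sum_mem fun m hm => ?_
  beta_reduce
  rw [expandLaurent_single]
  exact single_mem_supportSubfield (h m hm) _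

theorem expand_mem_supportSubfield {ρ : (σ →₀ ℤ) →+ Γ} (hρ : Function.Injective ρ)
    (f : Rational K σ) {H : AddSubgroup Γ} (h : ∀ m, ρ m ∈ H) :
    expand K hρ f ∈ supportSubfield K H := by
  obtain ⟨a, b, -, rfl⟩ := IsFractionRing.div_surjective (A := Laurent K σ) f
  rw [map_div₀, expand_algebraMap, expand_algebraMap]
  exact div_mem (expandLaurent_mem_supportSubfield a fun m _ => h m)
    (expandLaurent_mem_supportSubfield b fun m _ => h m)

/-- The constant term of a product is the product of the constant terms if the exponents of the
factors lie in subgroups with trivial intersection. -/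
theorem coeff_zero_mul_of_disjoint {H₁ H₂ : AddSubgroup Γ} (hH : ∀ g ∈ H₁, g ∈ H₂ → g = 0)
    {x y : HahnSeries Γ K} (hx : x ∈ supportSubfield K H₁) (hy : y ∈ supportSubfield K H₂) :
    (x * y).coeff 0 = x.coeff 0 * y.coeff 0 := by
  have hx := support_subset_of_mem_supportSubfield hx
  have hy := support_subset_of_mem_supportSubfield hy
  rw [HahnSeries.coeff_mul, Finset.sum_eq_single (0, 0)]
  · rintro ⟨i, j⟩ hij hne
    rw [Finset.mem_antidiagonal] at hij
    obtain ⟨hi, hj, hs⟩ := hij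
    exfalso
    apply hne
    have hji : j = -i := (neg_eq_of_add_eq_zero_right hs).symm
    have hi0 : i = 0 := hH i (hx hi) (by simpa [hji] using hy hj)
    simp [hji, hi0]
  · intro h
    by_contra hne
    apply h
    rw [Finset.mem_antidiagonal]
    exact ⟨left_ne_zero_of_mul hne, right_ne_zero_of_mul hne, add_zero _⟩

/-- A series whose exponents lie in a subgroup has no constant term after a shift by an element
outside of that subgroup. -/
theorem coeff_zero_single_mul_of_notMem {H : AddSubgroup Γ} {x : HahnSeries Γ K} {g : Γ}
    (hx : x ∈ supportSubfield K H) (hg : g ∉ H) (r : K) :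
    (HahnSeries.single g r * x).coeff 0 = 0 := by
  rw [HahnSeries.coeff_single_mul]
  have : x.coeff (0 - g) = 0 := by
    by_contra h
    exact hg (by simpa using support_subset_of_mem_supportSubfield hx h)
  rw [this, mul_zero]

/-! ### Comparison of expansions -/

/-- Two series in different fields of Hahn series are expansions with the same coefficients. -/
def SameCoeff (ρ : (σ →₀ ℤ) →+ Γ) (ρ' : (σ →₀ ℤ) →+ Γ') (x : HahnSeries Γ K)
    (y : HahnSeries Γ' K) : Prop :=
  ∀ m, x.coeff (ρ m) = y.coeff (ρ' m)

theorem SameCoeff.single_mul {ρ : (σ →₀ ℤ) →+ Γ} {ρ' : (σ →₀ ℤ) →+ Γ'} {x : HahnSeries Γ K}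
    {y : HahnSeries Γ' K} (h : SameCoeff ρ ρ' x y) (m : σ →₀ ℤ) (r : K) :
    SameCoeff ρ ρ' (HahnSeries.single (ρ m) r * x) (HahnSeries.single (ρ' m) r * y) := by
  intro k
  rw [HahnSeries.coeff_single_mul, HahnSeries.coeff_single_mul, ← map_sub, ← map_sub, h]

theorem SameCoeff.expandLaurent_mul {ρ : (σ →₀ ℤ) →+ Γ} {ρ' : (σ →₀ ℤ) →+ Γ'} {x : HahnSeries Γ K}
    {y : HahnSeries Γ' K} (h : SameCoeff ρ ρ' x y) (f : Laurent K σ) :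
    SameCoeff ρ ρ' (expandLaurent K ρ f * x) (expandLaurent K ρ' f * y) := by
  induction f using AddMonoidAlgebra.induction_linear with
  | zero => intro m; simp
  | add f g hf hg => intro m; simp only [map_add, add_mul, HahnSeries.coeff_add, hf m, hg m]
  | single m r => simpa only [expandLaurent_single] using h.single_mul m r

/-- The support of a series is well-ordered, so the coefficients along a decreasing arithmetic
progression vanish eventually. -/
theorem exists_coeff_sub_nsmul_eq_zero {x : HahnSeries Γ K} {g : Γ} (hg : 0 < g) (b : Γ) :
    ∃ n : ℕ, ∀ k ≥ n, x.coeff (b - k • g) = 0 := by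
  by_cases hS : ∃ k : ℕ, x.coeff (b - k • g) ≠ 0
  · set T : Set Γ := {y | ∃ k : ℕ, y = b - k • g ∧ x.coeff (b - k • g) ≠ 0} with hT
    have hTwf : T.IsWF := x.isWF_support.mono (by rintro y ⟨k, rfl, h⟩; exact h)
    have hTne : T.Nonempty := by obtain ⟨k, hk⟩ := hS; exact ⟨_, k, rfl, hk⟩
    obtain ⟨k₀, hk₀, -⟩ := hTwf.min_mem hTne
    refine ⟨k₀ + 1, fun k hk => ?_⟩
    by_contra hne
    have := hTwf.min_le hTne ⟨k, rfl, hne⟩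
    rw [hk₀, sub_le_sub_iff_left] at this
    exact absurd this (not_le.mpr (nsmul_lt_nsmul_left hg hk))
  · push Not at hS
    exact ⟨0, fun k _ => hS k⟩

/-- Expansions with the same coefficients keep this property under division by `1 - c z^m` if the
monomial `z^m` is small in both expansions: both quotients are given by the geometric series. -/
theorem SameCoeff.of_mul_one_sub {ρ : (σ →₀ ℤ) →+ Γ} {ρ' : (σ →₀ ℤ) →+ Γ'} {x : HahnSeries Γ K}
    {y : HahnSeries Γ' K} {m : σ →₀ ℤ} (hm : 0 < ρ m) (hm' : 0 < ρ' m) {c : K}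
    (h : SameCoeff ρ ρ' ((1 - HahnSeries.single (ρ m) c) * x)
      ((1 - HahnSeries.single (ρ' m) c) * y)) : SameCoeff ρ ρ' x y := by
  have hstep : ∀ k, x.coeff (ρ k) - y.coeff (ρ' k) =
      c * (x.coeff (ρ (k - m)) - y.coeff (ρ' (k - m))) := by
    intro k
    have := h k
    rw [sub_mul, sub_mul, one_mul, one_mul, HahnSeries.coeff_sub, HahnSeries.coeff_sub,
      HahnSeries.coeff_single_mul, HahnSeries.coeff_single_mul, ← map_sub, ← map_sub] at this
    linear_combination this
  have hiter : ∀ (n : ℕ) k, x.coeff (ρ k) - y.coeff (ρ' k) =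
      c ^ n * (x.coeff (ρ (k - n • m)) - y.coeff (ρ' (k - n • m))) := by
    intro n
    induction n with
    | zero => intro k; simp
    | succ n ih =>
      intro k
      rw [ih, hstep, succ_nsmul, sub_sub, pow_succ, mul_assoc]
  intro k
  obtain ⟨n, hn⟩ := exists_coeff_sub_nsmul_eq_zero (x := x) hm (ρ k)
  obtain ⟨n', hn'⟩ := exists_coeff_sub_nsmul_eq_zero (x := y) hm' (ρ' k)
  have := hiter (max n n') k
  rw [map_sub, map_sub, map_nsmul, map_nsmul, hn _ (le_max_left _ _), hn' _ (le_max_right _ _)]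
    at this
  simpa [sub_eq_zero] using this

end Expand

/-! ### Constant terms of expansions -/

section ConstantTerm

variable {K : Type*} [Field K] {σ τ : Type*}

/-- The exponent of `z^m` when `z_v` is regarded as the variable `t_{h(v)}`: variables of smaller
height are infinitely small compared to variables of larger height. -/
def heightHom (h : σ ↪ ℕ) : (σ →₀ ℤ) →+ Lex (ℕ → ℤ) where
  toFun m := toLex fun j => m.mapDomain h j
  map_zero' := by simp; rfl
  map_add' m m' := by
    rw [Finsupp.mapDomain_add]; rfl

theorem heightHom_injective (h : σ ↪ ℕ) : Function.Injective (heightHom h) := by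
  intro m m' hm
  apply Finsupp.mapDomain_injective h.injective
  ext j
  exact congrFun (toLex.injective hm) j

theorem heightHom_mapDomain (a : σ ↪ τ) (h : τ ↪ ℕ) (m : σ →₀ ℤ) :
    heightHom (a.trans h) m = heightHom h (m.mapDomain a) := by
  simp only [heightHom, AddMonoidHom.coe_mk, ZeroHom.coe_mk, ← Finsupp.mapDomain_comp]
  rfl

theorem heightHom_pos (h : σ ↪ ℕ) {u v : σ} (huv : h u < h v) :
    0 < heightHom h (Finsupp.single u 1 - Finsupp.single v 1) := by
  refine ⟨h u, fun j hj => ?_, ?_⟩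
  · simp only [heightHom, map_sub, AddMonoidHom.coe_mk, ZeroHom.coe_mk, Finsupp.mapDomain_single]
    change 0 = Finsupp.single (h u) (1 : ℤ) j - Finsupp.single (h v) (1 : ℤ) j
    rw [Finsupp.single_eq_of_ne hj.ne, Finsupp.single_eq_of_ne (hj.trans huv).ne, sub_zero]
  · simp only [heightHom, map_sub, AddMonoidHom.coe_mk, ZeroHom.coe_mk, Finsupp.mapDomain_single]
    change 0 < Finsupp.single (h u) (1 : ℤ) (h u) - Finsupp.single (h v) (1 : ℤ) (h u)
    rw [Finsupp.single_eq_same, Finsupp.single_eq_of_ne huv.ne, sub_zero]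
    exact one_pos

/-- The constant term of the expansion of a rational function in the region given by heights. -/
def constTerm (h : σ ↪ ℕ) : Rational K σ →ₗ[K] K where
  toFun f := (expand K (heightHom_injective h) f).coeff 0
  map_add' f g := by rw [map_add, HahnSeries.coeff_add]
  map_smul' c f := by rw [map_smul, HahnSeries.coeff_smul]; rfl

theorem expand_heightHom_renameRational (a : σ ↪ τ) (h : τ ↪ ℕ) (f : Rational K σ) :
    expand K (heightHom_injective h) (renameRational K a f) =
      expand K (heightHom_injective (a.trans h)) f :=
  expand_renameRational a _ _ (heightHom_mapDomain a h) f

theorem constTerm_renameRational (a : σ ↪ τ) (h : τ ↪ ℕ) (f : Rational K σ) :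
    constTerm h (renameRational K a f) = constTerm (a.trans h) f :=
  congrArg (fun x => HahnSeries.coeff x 0) (expand_heightHom_renameRational a h f)

/-- The exponents of the monomials in the variables `z_{a(v)}`. -/
def heightRange (a : σ ↪ τ) (h : τ ↪ ℕ) : AddSubgroup (Lex (ℕ → ℤ)) :=
  (heightHom (a.trans h)).range

theorem expand_rename_mem (a : σ ↪ τ) (h : τ ↪ ℕ) (f : Rational K σ) :
    expand K (heightHom_injective h) (renameRational K a f) ∈
      supportSubfield K (heightRange a h) := by
  rw [expand_heightHom_renameRational]
  exact expand_mem_supportSubfield _ _ fun m => ⟨m, rfl⟩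

theorem heightHom_mem_heightRange {a : σ ↪ τ} {h : τ ↪ ℕ} {m : τ →₀ ℤ} :
    heightHom h m ∈ heightRange a h ↔ ∃ k : σ →₀ ℤ, k.mapDomain a = m := by
  constructor
  · rintro ⟨k, hk⟩
    exact ⟨k, heightHom_injective h (by rw [← hk, heightHom_mapDomain])⟩
  · rintro ⟨k, rfl⟩
    exact ⟨k, heightHom_mapDomain a h k⟩

/-- Functions of two disjoint sets of variables: the constant term is multiplicative. -/
theorem constTerm_mul {σ' : Type*} {a : σ ↪ τ} {b : σ' ↪ τ}
    (hab : Disjoint (Set.range a) (Set.range b)) (h : τ ↪ ℕ) (f : Rational K σ)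
    (g : Rational K σ') :
    constTerm h (renameRational K a f * renameRational K b g) =
      constTerm (a.trans h) f * constTerm (b.trans h) g := by
  rw [← constTerm_renameRational, ← constTerm_renameRational]
  change (expand K (heightHom_injective h) _).coeff 0 = _
  rw [map_mul]
  refine coeff_zero_mul_of_disjoint ?_ (expand_rename_mem a h f) (expand_rename_mem b h g)
  rintro _ ⟨m, rfl⟩ ⟨m', hm⟩
  rw [heightHom_mapDomain, heightHom_mapDomain] at hm
  have hm := heightHom_injective h hm
  have : m.mapDomain a = 0 := by
    ext t
    by_cases ht : t ∈ Set.range a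
    · rw [← hm, Finsupp.mapDomain_of_notMem_range _ _ (Set.disjoint_left.mp hab ht)]
      rfl
    · rw [Finsupp.mapDomain_of_notMem_range _ _ ht]
      rfl
  rw [heightHom_mapDomain, this, map_zero]

/-- Taking the constant term of `z^{-e} y F`, with `F` a rational function of the variables
`z_{a(v)}`, first extracts a coefficient of `y` with respect to the other variables. -/
theorem constTerm_single_mul (a : σ ↪ τ) (h : τ ↪ ℕ) (e : τ →₀ ℤ) (y : Laurent K τ)
    (F : Rational K σ) :
    constTerm h (algebraMap _ _ (AddMonoidAlgebra.single (-e) 1 * y) * renameRational K a F) =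
      constTerm (a.trans h) (algebraMap _ _ (coeffAlong a e y) * F) := by
  classical
  induction y using AddMonoidAlgebra.induction_linear with
  | zero => simp
  | add f g hf hg => simp only [mul_add, map_add, add_mul, hf, hg]
  | single k r =>
    rw [AddMonoidAlgebra.single_mul_single, one_mul]
    by_cases hk : ∃ m : σ →₀ ℤ, m.mapDomain a = -e + k
    · obtain ⟨m, hm⟩ := hk
      have : coeffAlong a e (AddMonoidAlgebra.single k r) = AddMonoidAlgebra.single m r := by
        ext p
        rw [coeffAlong_coeff, AddMonoidAlgebra.coeff_single, AddMonoidAlgebra.coeff_single,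
          Finsupp.single_apply, Finsupp.single_apply]
        refine if_congr ?_ rfl rfl
        constructor
        · intro hp
          apply Finsupp.mapDomain_injective a.injective
          rw [hm, hp]; abel
        · rintro rfl
          rw [hm]; abel
      rw [this, ← hm, ← rename_single, ← renameRational_algebraMap, ← map_mul,
        constTerm_renameRational]
    · have : coeffAlong a e (AddMonoidAlgebra.single k r) = 0 := by
        ext p
        rw [coeffAlong_coeff, AddMonoidAlgebra.coeff_single, Finsupp.single_apply, if_neg]
        · rfl
        · intro hp
          exact hk ⟨p, by rw [hp]; abel⟩
      rw [this, map_zero, zero_mul, map_zero]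
      change (expand K (heightHom_injective h) _).coeff 0 = _
      rw [map_mul, expand_algebraMap, expandLaurent_single]
      exact coeff_zero_single_mul_of_notMem (expand_rename_mem a h F)
        (fun hmem => hk (heightHom_mem_heightRange.mp hmem)) r

end ConstantTerm

/-! ### The functions `ζ_{ij}` in several variables -/

section Zeta

variable {K : Type*} [Field K] {I : Type*} {σ τ : Type*}

/-- The functions `ζ̃_{ij}` are products of a monomial and of factors `1 - q x`. -/
def IsFactored (ζt : I → I → K[T;T⁻¹]) : Prop :=
  ∀ i j, ∃ (α : Kˣ) (s : ℤ) (N : ℕ) (q : Fin N → Kˣ),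
    ζt i j = LaurentPolynomial.C (α : K) * LaurentPolynomial.T s *
      ∏ e, (1 - LaurentPolynomial.T 1 * LaurentPolynomial.C (q e : K))

variable (ζt : I → I → K[T;T⁻¹])

/-- The numerator `ζ̃_{ij}(z_u/z_v)` of `ζ_{ij}(z_u/z_v)`, where `i`, `j` are the colours of `u`,
`v`. -/
def zetaNum (c : σ → I) (u v : σ) : Laurent K σ :=
  LaurentPolynomial.eval₂ (algebraMap K (Laurent K σ)) (laurentVar K u / laurentVar K v)
    (ζt (c u) (c v))

theorem map_eval₂ {F F' : Type*} [CommRing F] [CommRing F'] [Algebra K F] [Algebra K F']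
    (φ : F →ₐ[K] F') (x : Fˣ) (p : K[T;T⁻¹]) :
    φ (LaurentPolynomial.eval₂ (algebraMap K F) x p) =
      LaurentPolynomial.eval₂ (algebraMap K F') (Units.map (φ : F →* F') x) p := by
  induction p using LaurentPolynomial.induction_on' with
  | add p q hp hq => simp [hp, hq]
  | C_mul_T n r =>
    rw [LaurentPolynomial.eval₂_C_mul_T, LaurentPolynomial.eval₂_C_mul_T, map_mul,
      AlgHom.commutes, ← map_zpow]
    rfl

theorem rename_zetaNum (a : σ → τ) (c : τ → I) (u v : σ) :
    rename K a (zetaNum ζt (c ∘ a) u v) = zetaNum ζt c (a u) (a v) := by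
  rw [zetaNum, map_eval₂, zetaNum, map_div]
  have h : ∀ w, Units.map (rename K a : Laurent K σ →* Laurent K τ) (laurentVar K w) =
      laurentVar K (a w) := fun w => Units.ext (rename_laurentVar a w)
  rw [h, h]
  rfl

theorem zetaNum_eq {ζt : I → I → K[T;T⁻¹]} (hζ : IsFactored ζt) (c : σ → I) (u v : σ) :
    ∃ (α : Kˣ) (s : ℤ) (N : ℕ) (q : Fin N → Kˣ), zetaNum ζt c u v =
      AddMonoidAlgebra.single (s • (Finsupp.single u 1 - Finsupp.single v 1)) (α : K) *
        ∏ e, (1 - AddMonoidAlgebra.single (Finsupp.single u 1 - Finsupp.single v 1) (q e : K)) := by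
  obtain ⟨α, s, N, q, h⟩ := hζ (c u) (c v)
  refine ⟨α, s, N, q, ?_⟩
  have hz : ∀ s : ℤ, (((laurentVar K u / laurentVar K v) ^ s : (Laurent K σ)ˣ) : Laurent K σ) =
      AddMonoidAlgebra.single (s • (Finsupp.single u 1 - Finsupp.single v 1)) (1 : K) := by
    intro s
    rw [laurentVar, laurentVar, ← map_div, ← map_zpow, ← ofAdd_sub, ← ofAdd_zsmul]
    rfl
  have hC : ∀ r : K, algebraMap K (Laurent K σ) r = AddMonoidAlgebra.single 0 r := fun r => rfl
  rw [zetaNum, h]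
  simp only [map_mul, map_prod, map_sub, map_one, LaurentPolynomial.eval₂_C,
    LaurentPolynomial.eval₂_T, hz, hC, AddMonoidAlgebra.single_mul_single, zero_add, add_zero,
    mul_one, one_mul, one_smul]

theorem one_sub_single_ne_zero {m : σ →₀ ℤ} (hm : m ≠ 0) (r : K) :
    (1 - AddMonoidAlgebra.single m r : Laurent K σ) ≠ 0 := by
  intro h
  have := congrArg (fun f => AddMonoidAlgebra.coeff f 0) h
  rw [AddMonoidAlgebra.one_def] at this
  simp [hm] at this

theorem single_sub_single_ne_zero {u v : σ} (h : u ≠ v) :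
    (Finsupp.single u 1 - Finsupp.single v 1 : σ →₀ ℤ) ≠ 0 := by
  intro h0
  have := DFunLike.congr_fun h0 u
  simp [h.symm] at this

theorem zetaNum_ne_zero {ζt : I → I → K[T;T⁻¹]} (hζ : IsFactored ζt) (c : σ → I) {u v : σ}
    (h : u ≠ v) : zetaNum ζt c u v ≠ 0 := by
  obtain ⟨α, s, N, q, heq⟩ := zetaNum_eq hζ c u v
  rw [heq]
  refine mul_ne_zero (by simp) (Finset.prod_ne_zero_iff.mpr fun e _ =>
    one_sub_single_ne_zero (single_sub_single_ne_zero h) _)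

variable [DecidableEq I]

variable (K) in
/-- The denominator of `ζ_{ij}(z_u/z_v)`, where `i`, `j` are the colours of `u`, `v`. -/
def zetaDen (c : σ → I) (u v : σ) : Laurent K σ :=
  if c u = c v then 1 - AddMonoidAlgebra.single (Finsupp.single u 1 - Finsupp.single v 1) 1 else 1

theorem rename_zetaDen (a : σ → τ) (c : τ → I) (u v : σ) :
    rename K a (zetaDen K (c ∘ a) u v) = zetaDen K c (a u) (a v) := by
  rw [zetaDen, zetaDen, apply_ite (rename K a), map_sub, map_one, rename_single]
  have h : (Finsupp.single u 1 - Finsupp.single v 1 : σ →₀ ℤ).mapDomain a =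
      Finsupp.single (a u) 1 - Finsupp.single (a v) 1 := by
    rw [← Finsupp.mapDomain.addMonoidHom_apply, map_sub]
    simp
  rw [h]
  rfl

theorem zetaDen_ne_zero (c : σ → I) {u v : σ} (h : u ≠ v) : zetaDen K c u v ≠ 0 := by
  rw [zetaDen]
  split_ifs
  · exact one_sub_single_ne_zero (single_sub_single_ne_zero h) _
  · exact one_ne_zero

/-- The inverse of `ζ_{ij}(z_u/z_v)`, where `i`, `j` are the colours of `u`, `v`. -/
def invZeta (c : σ → I) (u v : σ) : Rational K σ :=
  algebraMap _ _ (zetaDen K c u v) / algebraMap _ _ (zetaNum ζt c u v)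

theorem renameRational_invZeta (a : σ ↪ τ) (c : τ → I) (u v : σ) :
    renameRational K a (invZeta ζt (c ∘ a) u v) = invZeta ζt c (a u) (a v) := by
  rw [invZeta, map_div₀, renameRational_algebraMap, renameRational_algebraMap, rename_zetaDen,
    rename_zetaNum, invZeta]

variable [Fintype σ] [Fintype τ]

/-- The product of `1/ζ(z_u/z_v)` over all pairs for which `z_u/z_v` is small with respect to the
heights. -/
def kernelFun (c : σ → I) (h : σ ↪ ℕ) : Rational K σ :=
  ∏ u, ∏ v, if h u < h v then invZeta ζt c u v else 1

omit [Fintype τ] in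
theorem renameRational_kernelFun (a : σ ↪ τ) (c : τ → I) (h : τ ↪ ℕ) :
    renameRational K a (kernelFun ζt (c ∘ a) (a.trans h)) =
      ∏ u, ∏ v, if h (a u) < h (a v) then invZeta ζt c (a u) (a v) else 1 := by
  simp only [kernelFun, map_prod, apply_ite (renameRational K a), renameRational_invZeta, map_one]
  rfl

/-! ### The ideal of relations -/

/-- The map `φ ↦ ∑_h φ_h ∏ 1/ζ(z_u/z_v)`, the product being over the pairs with `z_u/z_v` small
with respect to `h`. -/
def relMap (c : σ → I) : ((σ ↪ ℕ) →₀ Laurent K σ) →ₗ[K] Rational K σ :=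
  Finsupp.lsum K fun h =>
    (LinearMap.mulRight K (kernelFun ζt c h)).comp
      (IsScalarTower.toAlgHom K (Laurent K σ) (Rational K σ)).toLinearMap

theorem relMap_single (c : σ → I) (h : σ ↪ ℕ) (f : Laurent K σ) :
    relMap ζt c (Finsupp.single h f) = algebraMap _ _ f * kernelFun ζt c h := by
  simp only [relMap, Finsupp.lsum_single, LinearMap.comp_apply, LinearMap.mulRight_apply]
  rfl

/-- The map sending `R` and `φ` to the sum over `h` of the constant terms, with respect to `h`, of
`R φ_h ∏ 1/ζ(z_u/z_v)`. -/
def pairMap (c : σ → I) : Laurent K σ →ₗ[K] ((σ ↪ ℕ) →₀ Laurent K σ) →ₗ[K] K where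
  toFun R := Finsupp.lsum K fun h =>
    (constTerm h).comp ((LinearMap.mulRight K (algebraMap _ _ R * kernelFun ζt c h)).comp
      (IsScalarTower.toAlgHom K (Laurent K σ) (Rational K σ)).toLinearMap)
  map_add' R R' := by
    refine Finsupp.lhom_ext fun h f => ?_
    simp only [map_add, add_mul, LinearMap.add_apply, Finsupp.lsum_single, LinearMap.comp_apply,
      LinearMap.mulRight_apply, mul_add]
  map_smul' r R := by
    refine Finsupp.lhom_ext fun h f => ?_
    have : algebraMap (Laurent K σ) (Rational K σ) (r • R) = r • algebraMap _ _ R :=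
      map_smul (IsScalarTower.toAlgHom K (Laurent K σ) (Rational K σ)) r R
    simp only [LinearMap.smul_apply, Finsupp.lsum_single, LinearMap.comp_apply,
      LinearMap.mulRight_apply, this, smul_mul_assoc, mul_smul_comm, map_smul, RingHom.id_apply]

theorem pairMap_single (c : σ → I) (R : Laurent K σ) (h : σ ↪ ℕ) (f : Laurent K σ) :
    pairMap ζt c R (Finsupp.single h f) =
      constTerm h (algebraMap _ _ f * (algebraMap _ _ R * kernelFun ζt c h)) := by
  simp only [pairMap, LinearMap.coe_mk, AddHom.coe_mk, Finsupp.lsum_single, LinearMap.comp_apply,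
      LinearMap.mulRight_apply]
  rfl

theorem exists_linearMap_single {ι κ V W : Type*} [AddCommGroup V] [Module K V] [AddCommGroup W]
    [Module K W] (e : ι → κ) (T : ι → V →ₗ[K] W) :
    ∃ M : (ι →₀ V) →ₗ[K] (κ →₀ W), ∀ i v, M (Finsupp.single i v) = Finsupp.single (e i) (T i v) :=
  ⟨Finsupp.lsum K fun i => (Finsupp.lsingle (e i)).comp (T i), fun i v => by
    simp only [Finsupp.lsum_single, LinearMap.comp_apply, Finsupp.lsingle_apply]⟩

/-- The condition defining the relation ideal is stable under multiplication because relations can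
be multiplied by Laurent polynomials. -/
theorem pairMap_smul_eq_zero {c : σ → I} (g : Laurent K σ) {R : Laurent K σ}
    (hR : ∀ φ, relMap ζt c φ = 0 → pairMap ζt c R φ = 0) {φ : (σ ↪ ℕ) →₀ Laurent K σ}
    (hφ : relMap ζt c φ = 0) : pairMap ζt c (g * R) φ = 0 := by
  obtain ⟨M, hM⟩ := exists_linearMap_single (K := K) (id : (σ ↪ ℕ) → (σ ↪ ℕ))
    (fun _ => LinearMap.mulLeft K g)
  have h1 : ∀ φ, relMap ζt c (M φ) = algebraMap _ _ g * relMap ζt c φ := by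
    intro φ
    induction φ using Finsupp.induction_linear with
    | zero => simp only [map_zero, mul_zero]
    | add x y hx hy => simp only [map_add, mul_add, hx, hy]
    | single h f =>
      rw [hM, relMap_single, relMap_single, LinearMap.mulLeft_apply,
        map_mul (algebraMap (Laurent K σ) (Rational K σ)), mul_assoc, id]
  have h2 : ∀ φ, pairMap ζt c R (M φ) = pairMap ζt c (g * R) φ := by
    intro φ
    induction φ using Finsupp.induction_linear with
    | zero => simp only [map_zero]
    | add x y hx hy => simp only [map_add, hx, hy]
    | single h f =>
      rw [hM, pairMap_single, pairMap_single, LinearMap.mulLeft_apply, id,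
        map_mul (algebraMap (Laurent K σ) (Rational K σ)) g f,
        map_mul (algebraMap (Laurent K σ) (Rational K σ)) g R]
      refine congrArg _ ?_
      ring
  rw [← h2]
  exact hR _ (by rw [h1, hφ, mul_zero])

/-- The ideal of all `R` that pair to zero with all relations among the functions `kernelFun`. Its
symmetric elements form the shuffle algebra. -/
def relIdeal (c : σ → I) : Ideal (Laurent K σ) where
  carrier := {R | ∀ φ, relMap ζt c φ = 0 → pairMap ζt c R φ = 0}
  add_mem' := fun hR hR' φ hφ => by rw [map_add, LinearMap.add_apply, hR φ hφ, hR' φ hφ, add_zero]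
  zero_mem' := fun φ _ => by rw [map_zero, LinearMap.zero_apply]
  smul_mem' := fun g _ hR _ hφ => pairMap_smul_eq_zero ζt g hR hφ

theorem mem_relIdeal {c : σ → I} {R : Laurent K σ} :
    R ∈ relIdeal ζt c ↔ ∀ φ, relMap ζt c φ = 0 → pairMap ζt c R φ = 0 := Iff.rfl

end Zeta

/-! ### Restriction of the relation ideal to a subset of the variables -/

section Restriction

variable {K : Type*} [Field K] {I : Type*} {σ τ : Type*}
variable {ζt : I → I → K[T;T⁻¹]}

theorem zetaNum_ne_zero' (hζ : IsFactored ζt) (c : σ → I) {u v : σ} (h : u ≠ v) :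
    algebraMap (Laurent K σ) (Rational K σ) (zetaNum ζt c u v) ≠ 0 := by
  rw [Ne, FaithfulSMul.algebraMap_eq_zero_iff]
  exact zetaNum_ne_zero hζ c h

theorem zetaNum_mul_invZeta [DecidableEq I] (hζ : IsFactored ζt) (c : σ → I) {u v : σ} (h : u ≠ v) :
    algebraMap _ _ (zetaNum ζt c u v) * invZeta ζt c u v =
      algebraMap (Laurent K σ) (Rational K σ) (zetaDen K c u v) := by
  rw [invZeta, mul_div_cancel₀]
  exact zetaNum_ne_zero' hζ c h

variable [Fintype σ] [Fintype τ]

/-- Heights of a part of the variables extend to all variables, with the other variables above. -/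
theorem exists_extend_height (a : σ ↪ τ) (h : σ ↪ ℕ) : ∃ g : τ ↪ ℕ, a.trans g = h := by
  obtain ⟨N, hN⟩ : ∃ N, ∀ v, h v < N :=
    ⟨Finset.univ.sup h + 1, fun v => Nat.lt_succ_of_le (Finset.le_sup (Finset.mem_univ v))⟩
  let e := Fintype.equivFin τ
  refine ⟨⟨Function.extend a h fun t => N + e t, ?_⟩, ?_⟩
  · intro s t hst
    by_cases hs : ∃ v, a v = s <;> by_cases ht : ∃ v, a v = t
    · obtain ⟨v, rfl⟩ := hs
      obtain ⟨w, rfl⟩ := ht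
      rw [a.injective.extend_apply, a.injective.extend_apply] at hst
      rw [h.injective hst]
    · obtain ⟨v, rfl⟩ := hs
      rw [a.injective.extend_apply, Function.extend_apply' _ _ _ ht] at hst
      have := hN v
      omega
    · obtain ⟨v, rfl⟩ := ht
      rw [a.injective.extend_apply, Function.extend_apply' _ _ _ hs] at hst
      have := hN v
      omega
    · rw [Function.extend_apply' _ _ _ hs, Function.extend_apply' _ _ _ ht] at hst
      exact e.injective (Fin.ext (Nat.add_left_cancel hst))
  · ext v
    exact a.injective.extend_apply h (fun t => N + e t) v

variable [DecidableEq I]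

variable (K) in
/-- The factors of the denominators of the functions `ζ(z_u/z_v)` in which not both variables belong
to the image of `a`. -/
def outerDen [DecidableEq τ] (a : σ ↪ τ) (c : τ → I) : Laurent K τ :=
  ∏ p ∈ (Finset.univ : Finset (τ × τ)) with
    p.1 ≠ p.2 ∧ ¬ (p.1 ∈ Finset.univ.map a ∧ p.2 ∈ Finset.univ.map a), zetaDen K c p.1 p.2

/-- The outer denominators are non-zero-divisors modulo extended ideals. -/
theorem mem_map_of_outerDen_mul_mem [DecidableEq τ] {a : σ ↪ τ} {c : τ → I}
    {J : Ideal (Laurent K σ)} {x : Laurent K τ} (hx : outerDen K a c * x ∈ J.map (rename K a)) : x ∈ J.map (rename K a) := by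
  have key : ∀ s : Finset (τ × τ),
      (∀ p ∈ s, p.1 ≠ p.2 ∧ ¬ (p.1 ∈ Finset.univ.map a ∧ p.2 ∈ Finset.univ.map a)) →
      (∏ p ∈ s, zetaDen K c p.1 p.2) * x ∈ J.map (rename K a) → x ∈ J.map (rename K a) := by
    intro s
    induction s using Finset.induction_on with
    | empty => intro _ h; simpa using h
    | insert p s hp ih =>
      intro hs h
      apply ih (fun q hq => hs q (Finset.mem_insert_of_mem hq))
      rw [Finset.prod_insert hp, mul_assoc, zetaDen] at h
      split_ifs at h with hc
      · obtain ⟨hne, hnot⟩ := hs p (Finset.mem_insert_self _ _)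
        rw [not_and_or] at hnot
        rcases hnot with hn | hn
        · refine mem_map_of_mul_mem (t := p.1) (by simpa using hn) ?_ 1 h
          simp [hne.symm]
        · refine mem_map_of_mul_mem (t := p.2) (by simpa using hn) ?_ 1 h
          simp [hne]
      · rwa [one_mul] at h
  exact key _ (fun p hp => (Finset.mem_filter.mp hp).2) hx

/-- The factors by which `kernelFun` changes when only pairs of variables from the image of `a` are
kept become Laurent polynomials after multiplication by a function independent of the heights. -/
theorem outerDen_mul_kernelFun [DecidableEq τ] (hζ : IsFactored ζt) (a : σ ↪ τ) (c : τ → I)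
    (h : τ ↪ ℕ) : ∃ δ : Laurent K τ,
      algebraMap _ _ (outerDen K a c) * renameRational K a (kernelFun ζt (c ∘ a) (a.trans h)) =
        algebraMap _ _ δ * kernelFun ζt c h := by
  classical
  set P : τ × τ → Prop := fun p => p.1 ∈ Finset.univ.map a ∧ p.2 ∈ Finset.univ.map a with hP
  refine ⟨∏ p ∈ (Finset.univ : Finset (τ × τ)) with p.1 ≠ p.2 ∧ ¬ P p,
    if h p.1 < h p.2 then zetaNum ζt c p.1 p.2 else zetaDen K c p.1 p.2, ?_⟩
  set f : τ × τ → Rational K τ := fun p => if h p.1 < h p.2 then invZeta ζt c p.1 p.2 else 1 with hf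
  have h1 : kernelFun ζt c h = (∏ p with P p, f p) * ∏ p with p.1 ≠ p.2 ∧ ¬ P p, f p := by
    rw [kernelFun, ← Fintype.prod_prod_type' (f := fun u v => f (u, v)),
      ← Finset.prod_filter_mul_prod_filter_not _ P]
    congr 1
    refine (Finset.prod_subset (fun p hp => ?_) (fun p hp hp' => ?_)).symm
    · simp only [Finset.mem_filter, Finset.mem_univ, true_and] at hp ⊢
      exact hp.2
    · simp only [Finset.mem_filter, Finset.mem_univ, true_and, not_and, not_not] at hp hp'
      have : p.1 = p.2 := by
        by_contra hne
        exact hp (hp' hne)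
      simp [hf, this]
  have h2 : renameRational K a (kernelFun ζt (c ∘ a) (a.trans h)) = ∏ p with P p, f p := by
    have : (Finset.univ.filter P) = Finset.univ.map (a.prodMap a) := by
      ext p
      simp [hP, Prod.ext_iff]
    rw [this, Finset.prod_map, Fintype.prod_prod_type, renameRational_kernelFun]
    rfl
  rw [h2, h1, outerDen, map_prod, map_prod, mul_comm, mul_left_comm, ← Finset.prod_mul_distrib]
  congr 1
  refine Finset.prod_congr rfl fun p hp => ?_
  have hne : p.1 ≠ p.2 := (Finset.mem_filter.mp hp).2.1
  simp only [hf]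
  split_ifs
  · exact (zetaNum_mul_invZeta hζ c hne).symm
  · rw [mul_one]

/-- A relation among the functions of fewer variables gives relations among the functions of all
variables. So the coefficients of an element of the relation ideal, with respect to a part of the
variables, belong to the relation ideal of the remaining variables. -/
theorem relIdeal_le_map (hζ : IsFactored ζt) (a : σ ↪ τ) (c : τ → I) :
    relIdeal ζt c ≤ (relIdeal ζt (c ∘ a)).map (rename K a) := by
  classical
  intro x hx
  apply mem_map_of_outerDen_mul_mem (c := c)
  apply mem_map_of_forall_coeffAlong_mem
  intro e
  choose g hg using exists_extend_height a
  choose δ hδ using outerDen_mul_kernelFun hζ a c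
  set d := outerDen K a c
  have hδ' : ∀ h, algebraMap _ _ d * renameRational K a (kernelFun ζt (c ∘ a) h) =
      algebraMap _ _ (δ (g h)) * kernelFun ζt c (g h) := by
    intro h
    have := hδ (g h)
    rwa [hg] at this
  rw [mem_relIdeal]
  intro φ hφ
  -- `M` turns a relation in the variables from `σ` into a relation in all variables; pairing the
  -- latter with `x` extracts the coefficient of `d * x` at `e`.
  obtain ⟨M, hM⟩ := exists_linearMap_single (K := K) g
    (fun h => (LinearMap.mulRight K (AddMonoidAlgebra.single (-e) 1 * δ (g h))).comp
      (rename K a).toLinearMap)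
  have hM' : ∀ h f, M (Finsupp.single h f) =
      Finsupp.single (g h) (rename K a f * (AddMonoidAlgebra.single (-e) 1 * δ (g h))) := hM
  have h1 : ∀ φ, relMap ζt c (M φ) = algebraMap _ _ (AddMonoidAlgebra.single (-e) 1 * d) *
      renameRational K a (relMap ζt (c ∘ a) φ) := by
    intro φ
    induction φ using Finsupp.induction_linear with
    | zero => simp only [map_zero, mul_zero]
    | add x y hx hy => simp only [map_add, mul_add, hx, hy]
    | single h f =>
      rw [hM', relMap_single, relMap_single]
      simp only [map_mul, renameRational_algebraMap]
      linear_combination (-(algebraMap _ (Rational K τ) (rename K a f)) *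
        algebraMap (Laurent K τ) _ (AddMonoidAlgebra.single (-e) 1)) * hδ' h
  have h2 : ∀ φ, pairMap ζt c x (M φ) = pairMap ζt (c ∘ a) (coeffAlong a e (d * x)) φ := by
    intro φ
    induction φ using Finsupp.induction_linear with
    | zero => simp only [map_zero]
    | add x y hx hy => simp only [map_add, hx, hy]
    | single h f =>
      rw [hM', pairMap_single, pairMap_single]
      have h3 := constTerm_single_mul a (g h) e (d * x)
        (algebraMap _ _ f * kernelFun ζt (c ∘ a) h)
      rw [hg] at h3
      refine Eq.trans (congrArg _ ?_) (h3.trans (congrArg _ (mul_left_comm _ _ _)))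
      simp only [map_mul, renameRational_algebraMap]
      linear_combination (-(algebraMap _ (Rational K τ) (rename K a f)) *
        algebraMap (Laurent K τ) _ (AddMonoidAlgebra.single (-e) 1) * algebraMap _ _ x) * hδ' h
  rw [← h2]
  exact hx _ (by rw [h1, hφ, map_zero, mul_zero])

end Restriction

/-! ### Two complementary sets of variables -/

section Splitting

variable {K : Type*} [Field K] {I : Type*} {σ σ' τ : Type*}

/-- The splitting of Laurent polynomials according to two disjoint sets of variables. -/
def splitTensor (a : σ ↪ τ) (b : σ' ↪ τ) : Laurent K τ →ₗ[K] Laurent K σ ⊗[K] Laurent K σ' :=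
  (Finsupp.lsum K fun e : τ →₀ ℤ => LinearMap.toSpanSingleton K _
    (AddMonoidAlgebra.single (e.comapDomain a a.injective.injOn) (1 : K) ⊗ₜ[K]
      AddMonoidAlgebra.single (e.comapDomain b b.injective.injOn) (1 : K))).comp
  (AddMonoidAlgebra.coeffLinearEquiv K).toLinearMap

theorem splitTensor_single (a : σ ↪ τ) (b : σ' ↪ τ) (e : τ →₀ ℤ) (r : K) :
    splitTensor a b (AddMonoidAlgebra.single e r) =
      AddMonoidAlgebra.single (e.comapDomain a a.injective.injOn) r ⊗ₜ[K]
        AddMonoidAlgebra.single (e.comapDomain b b.injective.injOn) (1 : K) := by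
  have h : (AddMonoidAlgebra.coeffLinearEquiv K).toLinearMap
      (AddMonoidAlgebra.single e r : Laurent K τ) = Finsupp.single e r := rfl
  rw [splitTensor, LinearMap.comp_apply, h, Finsupp.lsum_single, LinearMap.toSpanSingleton_apply,
    TensorProduct.smul_tmul', AddMonoidAlgebra.smul_single, smul_eq_mul, mul_one]

theorem comapDomain_mapDomain_add {a : σ ↪ τ} {b : σ' ↪ τ}
    (hab : Disjoint (Set.range a) (Set.range b)) (m : σ →₀ ℤ) (m' : σ' →₀ ℤ) :
    (m.mapDomain a + m'.mapDomain b).comapDomain a a.injective.injOn = m := by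
  ext v
  rw [Finsupp.comapDomain_apply, Finsupp.add_apply, Finsupp.mapDomain_apply a.injective,
    Finsupp.mapDomain_of_notMem_range _ _ (Set.disjoint_left.mp hab ⟨v, rfl⟩), add_zero]

theorem splitTensor_mul {a : σ ↪ τ} {b : σ' ↪ τ} (hab : Disjoint (Set.range a) (Set.range b))
    (f : Laurent K σ) (g : Laurent K σ') :
    splitTensor a b (rename K a f * rename K b g) = f ⊗ₜ[K] g := by
  induction f using AddMonoidAlgebra.induction_linear with
  | zero => simp
  | add f f' hf hf' => simp only [map_add, add_mul, hf, hf', TensorProduct.add_tmul]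
  | single m r =>
    induction g using AddMonoidAlgebra.induction_linear with
    | zero => simp
    | add f f' hf hf' => simp only [map_add, mul_add, hf, hf', TensorProduct.tmul_add]
    | single m' r' =>
      rw [rename_single, rename_single, AddMonoidAlgebra.single_mul_single, splitTensor_single,
        comapDomain_mapDomain_add hab, add_comm (m.mapDomain a), comapDomain_mapDomain_add hab.symm,
        mul_comm r r', ← smul_eq_mul r' r, ← AddMonoidAlgebra.smul_single, TensorProduct.smul_tmul,
        AddMonoidAlgebra.smul_single, smul_eq_mul, mul_one]

/-- Every Laurent polynomial is a sum of products of Laurent polynomials in complementary sets of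
variables. -/
theorem split_induction {a : σ ↪ τ} {b : σ' ↪ τ} (hd : Disjoint (Set.range a) (Set.range b))
    (hab : Set.range a ∪ Set.range b = Set.univ)
    {P : Laurent K τ → Prop} (hmul : ∀ f g, P (rename K a f * rename K b g))
    (hadd : ∀ x y, P x → P y → P (x + y)) (x : Laurent K τ) : P x := by
  induction x using AddMonoidAlgebra.induction_linear with
  | zero => simpa using hmul 0 0
  | add x y hx hy => exact hadd _ _ hx hy
  | single e r =>
    have he : (e.comapDomain a a.injective.injOn).mapDomain a +
        (e.comapDomain b b.injective.injOn).mapDomain b = e := by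
      ext t
      rw [Finsupp.add_apply]
      have ht : t ∈ Set.range a ∪ Set.range b := by rw [hab]; trivial
      rcases ht with ⟨v, rfl⟩ | ⟨v, rfl⟩
      · rw [Finsupp.mapDomain_apply a.injective, Finsupp.comapDomain_apply,
          Finsupp.mapDomain_of_notMem_range _ _ (Set.disjoint_left.mp hd ⟨v, rfl⟩), add_zero]
      · rw [Finsupp.mapDomain_apply b.injective, Finsupp.comapDomain_apply,
          Finsupp.mapDomain_of_notMem_range _ _ (Set.disjoint_right.mp hd ⟨v, rfl⟩), zero_add]
    have := hmul (AddMonoidAlgebra.single (e.comapDomain a a.injective.injOn) r)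
      (AddMonoidAlgebra.single (e.comapDomain b b.injective.injOn) 1)
    rwa [rename_single, rename_single, AddMonoidAlgebra.single_mul_single, he, mul_one] at this

/-- An element of an extended ideal is a sum of products of an element of the ideal and a Laurent
polynomial in the other variables. -/
theorem split_induction_of_mem_map {a : σ ↪ τ} {b : σ' ↪ τ}
    (hd : Disjoint (Set.range a) (Set.range b)) (hab : Set.range a ∪ Set.range b = Set.univ)
    {J : Ideal (Laurent K σ)} {P : Laurent K τ → Prop} (hmul : ∀ f ∈ J, ∀ g, P (rename K a f * rename K b g))
    (hadd : ∀ x y, P x → P y → P (x + y)) {x : Laurent K τ} (hx : x ∈ J.map (rename K a)) :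
    P x := by
  suffices ∀ y, P (y * x) by simpa using this 1
  induction hx using Submodule.span_induction with
  | mem x h =>
    obtain ⟨f, hf, rfl⟩ := h
    refine split_induction hd hab (fun f' g => ?_) fun x y hx hy => by
      rw [add_mul]; exact hadd _ _ hx hy
    have := hmul _ (J.mul_mem_left f' hf) g
    rw [map_mul] at this
    convert this using 1
    ring
  | zero => intro y; simpa using hmul 0 J.zero_mem 0
  | add x y _ _ hx hy => intro z; rw [mul_add]; exact hadd _ _ (hx z) (hy z)
  | smul d x hx ih => intro y; rw [smul_eq_mul, ← mul_assoc]; exact ih _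

/-- The product of bilinear forms on Laurent polynomials in complementary sets of variables. -/
def prodForm (a : σ ↪ τ) (b : σ' ↪ τ) (β : LinearMap.BilinForm K (Laurent K σ))
    (β' : LinearMap.BilinForm K (Laurent K σ')) : LinearMap.BilinForm K (Laurent K τ) :=
  (LinearMap.BilinForm.tmul β β').compl₁₂ (splitTensor a b) (splitTensor a b)

theorem prodForm_mul {a : σ ↪ τ} {b : σ' ↪ τ} (hab : Disjoint (Set.range a) (Set.range b))
    (β : LinearMap.BilinForm K (Laurent K σ)) (β' : LinearMap.BilinForm K (Laurent K σ'))
    (f f₁ : Laurent K σ) (g g₁ : Laurent K σ') :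
    prodForm a b β β' (rename K a f * rename K b g) (rename K a f₁ * rename K b g₁) =
      β f f₁ * β' g g₁ := by
  rw [prodForm, LinearMap.compl₁₂_apply, splitTensor_mul hab, splitTensor_mul hab]
  simp [mul_comm]

/-- In a product of forms the first factor can be replaced by another form that agrees with it on an
ideal and on the multiples of `G`, if the arguments are in the extension of the ideal and multiples
of `G`. -/
theorem prodForm_congr_left {a : σ ↪ τ} {b : σ' ↪ τ} (hab : Disjoint (Set.range a) (Set.range b))
    (hab' : Set.range a ∪ Set.range b = Set.univ) {J : Ideal (Laurent K σ)} {G : Laurent K σ}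
    {β β₁ : LinearMap.BilinForm K (Laurent K σ)}
    (h : ∀ r ∈ J, ∀ f, β r (f * G) = β₁ r (f * G)) (β' : LinearMap.BilinForm K (Laurent K σ'))
    {R : Laurent K τ} (hR : R ∈ J.map (rename K a)) (x : Laurent K τ) :
    prodForm a b β β' R (x * rename K a G) = prodForm a b β₁ β' R (x * rename K a G) := by
  refine split_induction hab hab' (P := fun x => prodForm a b β β' R (x * rename K a G) =
    prodForm a b β₁ β' R (x * rename K a G)) (fun f g => ?_)
    (fun x y hx hy => by rw [add_mul, map_add, map_add, hx, hy]) x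
  refine split_induction_of_mem_map hab hab' (P := fun R => prodForm a b β β' R _ =
    prodForm a b β₁ β' R _) (fun r hr s => ?_)
    (fun x y hx hy => by rw [map_add, map_add, LinearMap.add_apply, LinearMap.add_apply, hx, hy]) hR
  rw [mul_right_comm, ← map_mul, prodForm_mul hab, prodForm_mul hab, h r hr]

theorem prodForm_congr_right {a : σ ↪ τ} {b : σ' ↪ τ} (hab : Disjoint (Set.range a) (Set.range b))
    (hab' : Set.range a ∪ Set.range b = Set.univ) {J : Ideal (Laurent K σ')} {G : Laurent K σ'}
    {β β₁ : LinearMap.BilinForm K (Laurent K σ')}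
    (h : ∀ r ∈ J, ∀ f, β r (f * G) = β₁ r (f * G)) (β' : LinearMap.BilinForm K (Laurent K σ))
    {R : Laurent K τ} (hR : R ∈ J.map (rename K b)) (x : Laurent K τ) :
    prodForm a b β' β R (x * rename K b G) = prodForm a b β' β₁ R (x * rename K b G) := by
  refine split_induction hab hab' (P := fun x => prodForm a b β' β R (x * rename K b G) =
    prodForm a b β' β₁ R (x * rename K b G)) (fun f g => ?_)
    (fun x y hx hy => by rw [add_mul, map_add, map_add, hx, hy]) x
  refine split_induction_of_mem_map (b := a) hab.symm (by rwa [Set.union_comm])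
    (P := fun R => prodForm a b β' β R _ = prodForm a b β' β₁ R _) (fun r hr s => ?_)
    (fun x y hx hy => by rw [map_add, map_add, LinearMap.add_apply, LinearMap.add_apply, hx, hy]) hR
  rw [mul_assoc, ← map_mul, mul_comm (rename K b r), prodForm_mul hab, prodForm_mul hab, h r hr]

/-! ### Products of elements of relation ideals -/

variable {ζt : I → I → K[T;T⁻¹]} [Fintype σ] [Fintype σ'] [Fintype τ] [DecidableEq I]

theorem prod_eq_of_split {M : Type*} [CommMonoid M] {a : σ ↪ τ} {b : σ' ↪ τ}
    (hab : Disjoint (Set.range a) (Set.range b))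
    (hab' : Set.range a ∪ Set.range b = Set.univ) (f : τ → M) :
    ∏ t, f t = (∏ u, f (a u)) * ∏ v, f (b v) := by
  classical
  have h1 : (Finset.univ : Finset τ) =
      (Finset.univ.map a).disjUnion (Finset.univ.map b) (by
        rw [Finset.disjoint_left]
        intro t ht ht'
        simp only [Finset.mem_map, Finset.mem_univ, true_and] at ht ht'
        exact Set.disjoint_left.mp hab ht ht') := by
    ext t
    have : t ∈ Set.range a ∪ Set.range b := by rw [hab']; trivial
    simpa using this
  rw [h1, Finset.prod_disjUnion, Finset.prod_map, Finset.prod_map]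

variable (ζt) in
/-- A common denominator of the functions `kernelFun`. -/
def commonDen [DecidableEq σ] (c : σ → I) : Laurent K σ :=
  ∏ u, ∏ v, if u = v then 1 else zetaNum ζt c u v

variable (ζt) in
/-- The numerator of `kernelFun` with respect to the common denominator. -/
def kernelNum [DecidableEq σ] (c : σ → I) (h : σ ↪ ℕ) : Laurent K σ :=
  ∏ u, ∏ v, if h u < h v then zetaDen K c u v else if u = v then 1 else zetaNum ζt c u v

omit [DecidableEq I] in
theorem commonDen_ne_zero [DecidableEq σ] (hζ : IsFactored ζt) (c : σ → I) :
    algebraMap (Laurent K σ) (Rational K σ) (commonDen ζt c) ≠ 0 := by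
  rw [Ne, FaithfulSMul.algebraMap_eq_zero_iff, commonDen, Finset.prod_eq_zero_iff]
  rintro ⟨u, -, hu⟩
  rw [Finset.prod_eq_zero_iff] at hu
  obtain ⟨v, -, hv⟩ := hu
  split_ifs at hv with h
  · exact one_ne_zero hv
  · exact zetaNum_ne_zero hζ c h hv

theorem commonDen_mul_kernelFun [DecidableEq σ] (hζ : IsFactored ζt) (c : σ → I) (h : σ ↪ ℕ) :
    algebraMap _ _ (commonDen ζt c) * kernelFun ζt c h = algebraMap _ _ (kernelNum ζt c h) := by
  simp only [commonDen, kernelNum, kernelFun, map_prod, ← Finset.prod_mul_distrib]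
  refine Finset.prod_congr rfl fun u _ => Finset.prod_congr rfl fun v _ => ?_
  by_cases huv : u = v
  · simp [huv]
  · rw [if_neg huv]
    split_ifs
    · exact zetaNum_mul_invZeta hζ c huv
    · rw [mul_one]

variable (ζt) in
/-- The numerators of the functions `ζ(z_u/z_v)` for pairs of variables from two sets. -/
def mixedNum (a : σ ↪ τ) (b : σ' ↪ τ) (c : τ → I) : Laurent K τ :=
  ∏ u, ∏ v, zetaNum ζt c (a u) (b v) * zetaNum ζt c (b v) (a u)

/-- After multiplication by the numerators of the interactions between the two sets of variables,
`kernelFun` becomes the product of the functions of both sets, up to a Laurent polynomial. -/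
theorem mixedNum_mul_kernelFun (hζ : IsFactored ζt) {a : σ ↪ τ} {b : σ' ↪ τ}
    (hab : Disjoint (Set.range a) (Set.range b))
    (hab' : Set.range a ∪ Set.range b = Set.univ) (c : τ → I) (h : τ ↪ ℕ) :
    ∃ γ : Laurent K τ, algebraMap _ _ (mixedNum ζt a b c) * kernelFun ζt c h =
      algebraMap _ _ γ * (renameRational K a (kernelFun ζt (c ∘ a) (a.trans h)) *
        renameRational K b (kernelFun ζt (c ∘ b) (b.trans h))) := by
  refine ⟨∏ u, ∏ v,
    (if h (a u) < h (b v) then zetaDen K c (a u) (b v) else zetaNum ζt c (a u) (b v)) *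
    (if h (b v) < h (a u) then zetaDen K c (b v) (a u) else zetaNum ζt c (b v) (a u)), ?_⟩
  have hne : ∀ u v, a u ≠ b v := fun u v huv =>
    Set.disjoint_left.mp hab ⟨u, rfl⟩ ⟨v, huv.symm⟩
  set f : τ → τ → Rational K τ := fun u v => if h u < h v then invZeta ζt c u v else 1 with hf
  have h1 : kernelFun ζt c h = ((∏ u, ∏ v, f (a u) (a v)) * ∏ u, ∏ v, f (b u) (b v)) *
      ∏ u, ∏ v, f (a u) (b v) * f (b v) (a u) := by
    rw [kernelFun, prod_eq_of_split hab hab']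
    simp only [prod_eq_of_split hab hab', Finset.prod_mul_distrib, hf]
    rw [Finset.prod_comm (f := fun (x : σ') (y : σ) =>
      if h (b x) < h (a y) then invZeta ζt c (b x) (a y) else 1)]
    ring
  rw [h1, renameRational_kernelFun, renameRational_kernelFun, mul_comm _ (_ * _), mul_assoc,
    mul_comm]
  congr 1
  rw [mixedNum]
  simp only [map_prod, ← Finset.prod_mul_distrib]
  refine Finset.prod_congr rfl fun u _ => Finset.prod_congr rfl fun v _ => ?_
  have e1 := zetaNum_mul_invZeta hζ c (hne u v)
  have e2 := zetaNum_mul_invZeta hζ c (hne u v).symm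
  simp only [map_mul, hf]
  split_ifs
  · rw [← e1, ← e2]; ring
  · rw [← e1]; ring
  · rw [← e2]; ring
  · ring

variable (ζt) in
/-- The constant term of `R x` divided by the common denominator, as a bilinear form in `R`, `x`. -/
def constTermForm [DecidableEq σ] (c : σ → I) (h : σ ↪ ℕ) : LinearMap.BilinForm K (Laurent K σ) :=
  (LinearMap.mul K (Laurent K σ)).compr₂ ((constTerm h).comp
    ((LinearMap.mulRight K (algebraMap (Laurent K σ) _ (commonDen ζt c))⁻¹).comp
      (IsScalarTower.toAlgHom K (Laurent K σ) (Rational K σ)).toLinearMap))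

omit [DecidableEq I] in
theorem constTermForm_apply [DecidableEq σ] (c : σ → I) (h : σ ↪ ℕ) (R x : Laurent K σ) :
    constTermForm ζt c h R x =
      constTerm h (algebraMap _ _ (R * x) * (algebraMap _ _ (commonDen ζt c))⁻¹) := rfl

theorem pairMap_single_eq [DecidableEq σ] (hζ : IsFactored ζt) (c : σ → I) (R : Laurent K σ)
    (h : σ ↪ ℕ) (f : Laurent K σ) :
    pairMap ζt c R (Finsupp.single h f) = constTermForm ζt c h R (f * kernelNum ζt c h) := by
  have := commonDen_ne_zero hζ c
  rw [pairMap_single, constTermForm_apply]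
  refine congrArg _ ?_
  rw [map_mul, map_mul, ← commonDen_mul_kernelFun hζ]
  field_simp

variable (ζt) in
/-- The map `relMap` after multiplication by the common denominator. -/
def relNum [DecidableEq σ] (c : σ → I) : ((σ ↪ ℕ) →₀ Laurent K σ) →ₗ[K] Laurent K σ :=
  Finsupp.lsum K fun h => LinearMap.mulRight K (kernelNum ζt c h)

theorem relNum_single [DecidableEq σ] (c : σ → I) (h : σ ↪ ℕ) (f : Laurent K σ) :
    relNum ζt c (Finsupp.single h f) = f * kernelNum ζt c h := by
  simp only [relNum, Finsupp.lsum_single, LinearMap.mulRight_apply]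

theorem algebraMap_relNum [DecidableEq σ] (hζ : IsFactored ζt) (c : σ → I)
    (φ : (σ ↪ ℕ) →₀ Laurent K σ) :
    algebraMap _ _ (relNum ζt c φ) = algebraMap _ _ (commonDen ζt c) * relMap ζt c φ := by
  induction φ using Finsupp.induction_linear with
  | zero => simp only [map_zero, mul_zero]
  | add x y hx hy => simp only [map_add, mul_add, hx, hy]
  | single h f =>
    rw [relNum_single, relMap_single, map_mul, ← commonDen_mul_kernelFun hζ]
    ring

theorem relMap_eq_zero_iff [DecidableEq σ] (hζ : IsFactored ζt) {c : σ → I}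
    {φ : (σ ↪ ℕ) →₀ Laurent K σ} : relMap ζt c φ = 0 ↔ relNum ζt c φ = 0 := by
  rw [← FaithfulSMul.algebraMap_eq_zero_iff (Laurent K σ) (Rational K σ), algebraMap_relNum hζ,
    mul_eq_zero]
  simp [commonDen_ne_zero hζ c]

/-- The functionals by which the elements of the relation ideal act on the single summands are
restrictions of a functional that does not depend on the heights, and this functional can be chosen
to depend linearly on the element of the ideal. -/
theorem exists_form [DecidableEq σ] (hζ : IsFactored ζt) (c : σ → I) :
    ∃ β : LinearMap.BilinForm K (Laurent K σ), ∀ r ∈ relIdeal ζt c, ∀ h f,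
      β r (f * kernelNum ζt c h) = constTermForm ζt c h r (f * kernelNum ζt c h) := by
  -- A linear section of `relNum` chooses, for every numerator, a sum of summands representing it.
  obtain ⟨s, hs⟩ := (relNum ζt c).rangeRestrict.exists_rightInverse_of_surjective
    (LinearMap.range_rangeRestrict _)
  obtain ⟨S, hS⟩ := s.exists_extend
  have hS' : ∀ φ, relNum ζt c (S (relNum ζt c φ)) = relNum ζt c φ := by
    intro φ
    have h1 : S (relNum ζt c φ) = s ((relNum ζt c).rangeRestrict φ) := by
      rw [← hS]; rfl
    rw [h1]
    exact congrArg Subtype.val (DFunLike.congr_fun hs ((relNum ζt c).rangeRestrict φ))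
  refine ⟨(pairMap ζt c).compl₂ S, fun r hr h f => ?_⟩
  rw [← pairMap_single_eq hζ, LinearMap.compl₂_apply, ← relNum_single, ← sub_eq_zero, ← map_sub]
  apply hr
  rw [relMap_eq_zero_iff hζ, map_sub, hS', sub_self]

omit [Fintype τ] [DecidableEq I] in
/-- Constant terms of functions with separated denominators are given by a product of forms. -/
theorem constTerm_eq_prodForm [DecidableEq σ] [DecidableEq σ'] {a : σ ↪ τ} {b : σ' ↪ τ}
    (hab : Disjoint (Set.range a) (Set.range b))
    (hab' : Set.range a ∪ Set.range b = Set.univ) (c : σ → I) (c' : σ' → I) (h : τ ↪ ℕ)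
    (R x : Laurent K τ) :
    constTerm h (algebraMap _ _ (R * x) *
      (renameRational K a (algebraMap _ _ (commonDen ζt c))⁻¹ *
        renameRational K b (algebraMap _ _ (commonDen ζt c'))⁻¹)) =
      prodForm a b (constTermForm ζt c (a.trans h)) (constTermForm ζt c' (b.trans h)) R x := by
  refine split_induction hab hab' (P := fun x => constTerm h (algebraMap _ _ (R * x) * _) =
    prodForm a b _ _ R x) (fun f g => ?_) (fun x y hx hy => by
      rw [mul_add, map_add, add_mul, map_add, map_add, hx, hy]) x
  refine split_induction hab hab' (P := fun R => constTerm h (algebraMap _ _ (R * _) * _) =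
    prodForm a b _ _ R _) (fun r s => ?_) (fun x y hx hy => by
      rw [add_mul, map_add, add_mul, map_add, map_add, LinearMap.add_apply, hx, hy]) R
  rw [prodForm_mul hab, constTermForm_apply, constTermForm_apply, ← constTerm_mul hab]
  refine congrArg _ ?_
  simp only [map_mul, renameRational_algebraMap]
  ring

/-- An element whose coefficients with respect to two complementary sets of variables belong to the
relation ideals of these sets belongs to the relation ideal, after multiplication by the functions
that have zeros where variables from both sets interact: no poles are left there, so that all
constant terms factor. -/
theorem mixedNum_mul_mem (hζ : IsFactored ζt) {a : σ ↪ τ} {b : σ' ↪ τ}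
    (hab : Disjoint (Set.range a) (Set.range b))
    (hab' : Set.range a ∪ Set.range b = Set.univ) (c : τ → I) {R : Laurent K τ}
    (hRa : R ∈ (relIdeal ζt (c ∘ a)).map (rename K a))
    (hRb : R ∈ (relIdeal ζt (c ∘ b)).map (rename K b)) :
    mixedNum ζt a b c * R ∈ relIdeal ζt c := by
  classical
  choose γ hγ using mixedNum_mul_kernelFun hζ hab hab' c
  obtain ⟨β, hβ⟩ := exists_form hζ (c ∘ a)
  obtain ⟨β', hβ'⟩ := exists_form hζ (c ∘ b)
  set D := renameRational K a (algebraMap _ _ (commonDen ζt (c ∘ a))) with hD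
  set D' := renameRational K b (algebraMap _ _ (commonDen ζt (c ∘ b))) with hD'
  have hD0 : D ≠ 0 := (map_ne_zero _).mpr (commonDen_ne_zero hζ _)
  have hD0' : D' ≠ 0 := (map_ne_zero _).mpr (commonDen_ne_zero hζ _)
  set G : (τ ↪ ℕ) → Laurent K τ := fun h => rename K a (kernelNum ζt (c ∘ a) (a.trans h)) with hG
  set G' : (τ ↪ ℕ) → Laurent K τ := fun h => rename K b (kernelNum ζt (c ∘ b) (b.trans h)) with hG'
  have hGD : ∀ h, algebraMap _ _ (G h) =
      D * renameRational K a (kernelFun ζt (c ∘ a) (a.trans h)) := by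
    intro h
    rw [hG, ← renameRational_algebraMap, ← commonDen_mul_kernelFun hζ, map_mul]
  have hGD' : ∀ h, algebraMap _ _ (G' h) =
      D' * renameRational K b (kernelFun ζt (c ∘ b) (b.trans h)) := by
    intro h
    rw [hG', ← renameRational_algebraMap, ← commonDen_mul_kernelFun hζ, map_mul]
  let N : ((τ ↪ ℕ) →₀ Laurent K τ) →ₗ[K] Laurent K τ :=
    Finsupp.lsum K fun h => LinearMap.mulRight K (γ h * G h * G' h)
  have hN : ∀ h f, N (Finsupp.single h f) = f * (γ h * G h * G' h) := fun h f => by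
    simp only [N, Finsupp.lsum_single, LinearMap.mulRight_apply]
  -- `N` factors through the map `relMap`, so it suffices to express the pairing by `N`.
  have hN0 : ∀ φ, algebraMap _ _ (N φ) =
      D * D' * algebraMap _ _ (mixedNum ζt a b c) * relMap ζt c φ := by
    intro φ
    induction φ using Finsupp.induction_linear with
    | zero => simp only [map_zero, mul_zero]
    | add x y hx hy => simp only [map_add, mul_add, hx, hy]
    | single h f =>
      rw [hN, relMap_single, map_mul, map_mul, map_mul, hGD, hGD']
      linear_combination (-(algebraMap _ (Rational K τ) f) * D * D') * hγ h
  have hpair : ∀ φ, pairMap ζt c (mixedNum ζt a b c * R) φ = prodForm a b β β' R (N φ) := by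
    intro φ
    induction φ using Finsupp.induction_linear with
    | zero => simp only [map_zero]
    | add x y hx hy => simp only [map_add, hx, hy]
    | single h f =>
      have e1 : prodForm a b β β' R (f * (γ h * G h * G' h)) =
          prodForm a b (constTermForm ζt (c ∘ a) (a.trans h)) β' R (f * (γ h * G h * G' h)) := by
        have := prodForm_congr_left hab hab' (fun r hr f => hβ r hr (a.trans h) f) β' hRa
          (f * γ h * G' h)
        convert this using 2 <;> ring
      have e2 : prodForm a b (constTermForm ζt (c ∘ a) (a.trans h)) β' R
            (f * (γ h * G h * G' h)) =
          prodForm a b (constTermForm ζt (c ∘ a) (a.trans h))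
            (constTermForm ζt (c ∘ b) (b.trans h)) R (f * (γ h * G h * G' h)) := by
        have := prodForm_congr_right hab hab' (fun r hr f => hβ' r hr (b.trans h) f)
          (constTermForm ζt (c ∘ a) (a.trans h)) hRb (f * γ h * G h)
        convert this using 2 <;> ring
      rw [hN, e1, e2, ← constTerm_eq_prodForm hab hab', pairMap_single, map_inv₀, map_inv₀]
      refine congrArg _ ?_
      simp only [map_mul, hGD, hGD']
      rw [← hD, ← hD']
      have := hγ h
      field_simp
      linear_combination (algebraMap _ (Rational K τ) f) * (algebraMap _ (Rational K τ) R) * this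
  intro φ hφ
  rw [hpair]
  have : N φ = 0 := by
    rw [← FaithfulSMul.algebraMap_eq_zero_iff (Laurent K τ) (Rational K τ), hN0, hφ, mul_zero]
  rw [this, map_zero]

end Splitting

/-! ### Homogeneity -/

section Homogeneity

variable {K : Type*} [Field K] {I : Type*} {σ : Type*}

variable (K σ) in
/-- The grading of the Laurent polynomial ring by the total degree. -/
abbrev degGrading : ℤ → Submodule K (Laurent K σ) :=
  AddMonoidAlgebra.gradeBy K (Finsupp.degree : (σ →₀ ℤ) →+ ℤ)

theorem single_mem_degGrading {m : σ →₀ ℤ} {d : ℤ} (h : m.degree = d) (r : K) :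
    AddMonoidAlgebra.single m r ∈ degGrading K σ d := by
  rw [AddMonoidAlgebra.mem_gradeBy_iff]
  intro k hk
  have := Finsupp.support_single_subset hk
  rw [Finset.mem_singleton] at this
  subst this
  exact h

theorem degree_single_sub_single (u v : σ) :
    (Finsupp.single u 1 - Finsupp.single v 1 : σ →₀ ℤ).degree = 0 := by
  rw [map_sub]; simp

theorem one_sub_mem_degGrading (u v : σ) (r : K) :
    (1 - AddMonoidAlgebra.single (Finsupp.single u 1 - Finsupp.single v 1) r : Laurent K σ) ∈
      degGrading K σ 0 :=
  Submodule.sub_mem _ (SetLike.GradedOne.one_mem)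
    (single_mem_degGrading (degree_single_sub_single u v) r)

theorem prod_mem_degGrading_zero {ι : Type*} (s : Finset ι) {f : ι → Laurent K σ}
    (h : ∀ i ∈ s, f i ∈ degGrading K σ 0) : ∏ i ∈ s, f i ∈ degGrading K σ 0 :=
  Finset.prod_induction f (· ∈ degGrading K σ 0)
    (fun a b ha hb => by simpa using SetLike.mul_mem_graded ha hb) SetLike.GradedOne.one_mem h

variable {ζt : I → I → K[T;T⁻¹]}

theorem zetaNum_mem_degGrading (hζ : IsFactored ζt) (c : σ → I) (u v : σ) :
    zetaNum ζt c u v ∈ degGrading K σ 0 := by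
  obtain ⟨α, s, N, q, h⟩ := zetaNum_eq hζ c u v
  rw [h]
  have h1 : AddMonoidAlgebra.single (s • (Finsupp.single u 1 - Finsupp.single v 1)) (α : K) ∈
      degGrading K σ 0 :=
    single_mem_degGrading (by rw [map_zsmul, degree_single_sub_single, smul_zero]) _
  simpa using SetLike.mul_mem_graded h1
    (prod_mem_degGrading_zero Finset.univ fun e _ => one_sub_mem_degGrading u v (q e : K))

variable [DecidableEq I]

theorem zetaDen_mem_degGrading (c : σ → I) (u v : σ) : zetaDen K c u v ∈ degGrading K σ 0 := by
  rw [zetaDen]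
  split_ifs
  · exact one_sub_mem_degGrading u v 1
  · exact SetLike.GradedOne.one_mem

variable [Fintype σ]

theorem kernelNum_mem_degGrading [DecidableEq σ] (hζ : IsFactored ζt) (c : σ → I) (h : σ ↪ ℕ) :
    kernelNum ζt c h ∈ degGrading K σ 0 := by
  refine prod_mem_degGrading_zero _ fun u _ => prod_mem_degGrading_zero _ fun v _ => ?_
  split_ifs
  · exact zetaDen_mem_degGrading c u v
  · exact SetLike.GradedOne.one_mem
  · exact zetaNum_mem_degGrading hζ c u v

omit [DecidableEq I] in
theorem commonDen_mem_degGrading [DecidableEq σ] (hζ : IsFactored ζt) (c : σ → I) :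
    commonDen ζt c ∈ degGrading K σ 0 := by
  refine prod_mem_degGrading_zero _ fun u _ => prod_mem_degGrading_zero _ fun v _ => ?_
  split_ifs
  · exact SetLike.GradedOne.one_mem
  · exact zetaNum_mem_degGrading hζ c u v

/-- The function `kernelFun` has degree zero. -/
theorem expand_kernelFun_mem (hζ : IsFactored ζt) (c : σ → I) (h : σ ↪ ℕ) :
    expand K (heightHom_injective h) (kernelFun ζt c h) ∈
      supportSubfield K ((Finsupp.degree : (σ →₀ ℤ) →+ ℤ).ker.map (heightHom h)) := by
  classical
  have key : ∀ f ∈ degGrading K σ 0, expand K (heightHom_injective h) (algebraMap _ _ f) ∈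
      supportSubfield K ((Finsupp.degree : (σ →₀ ℤ) →+ ℤ).ker.map (heightHom h)) := by
    intro f hf
    rw [expand_algebraMap]
    refine expandLaurent_mem_supportSubfield f fun m hm => ⟨m, ?_, rfl⟩
    rw [AddMonoidAlgebra.mem_gradeBy_iff] at hf
    exact hf hm
  have : kernelFun ζt c h =
      algebraMap _ _ (kernelNum ζt c h) / algebraMap _ _ (commonDen ζt c) := by
    rw [← commonDen_mul_kernelFun hζ, mul_div_cancel_left₀ _ (commonDen_ne_zero hζ c)]
  rw [this, map_div₀]
  exact div_mem (key _ (kernelNum_mem_degGrading hζ c h)) (key _ (commonDen_mem_degGrading hζ c))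

/-- Only the part of degree zero of `f` contributes to the constant term of `f * kernelFun`. -/
theorem constTerm_mul_kernelFun (hζ : IsFactored ζt) (c : σ → I) (h : σ ↪ ℕ) (f : Laurent K σ) :
    constTerm h (algebraMap _ _ f * kernelFun ζt c h) =
      constTerm h (algebraMap _ _ (GradedAlgebra.proj (degGrading K σ) 0 f) *
        kernelFun ζt c h) := by
  induction f using AddMonoidAlgebra.induction_linear with
  | zero => simp only [map_zero]
  | add f g hf hg => simp only [map_add, add_mul, hf, hg]
  | single m r =>
    rw [GradedAlgebra.proj_apply]
    by_cases hm : m.degree = 0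
    · rw [DirectSum.decompose_of_mem_same _ (single_mem_degGrading hm r)]
    · rw [DirectSum.decompose_of_mem_ne _ (single_mem_degGrading rfl r) hm, map_zero, zero_mul,
        map_zero]
      change (expand K (heightHom_injective h) _).coeff 0 = _
      rw [map_mul, expand_algebraMap, expandLaurent_single]
      refine coeff_zero_single_mul_of_notMem (expand_kernelFun_mem hζ c h) ?_ r
      rintro ⟨k, hk, hkm⟩
      exact hm (heightHom_injective h hkm ▸ hk)

theorem isHomogeneousIdeal_relIdeal (hζ : IsFactored ζt) (c : σ → I) :
    IsHomogeneousIdeal (relIdeal ζt c) := by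
  classical
  intro i R hR φ hφ
  -- Pairing with the component of degree `i` only sees the components of degree `-i` of relations.
  obtain ⟨M, hM⟩ := exists_linearMap_single (K := K) (id : (σ ↪ ℕ) → (σ ↪ ℕ))
    (fun _ => GradedAlgebra.proj (degGrading K σ) (-i))
  have h1 : ∀ φ, relNum ζt c (M φ) = GradedAlgebra.proj (degGrading K σ) (-i) (relNum ζt c φ) := by
    intro φ
    induction φ using Finsupp.induction_linear with
    | zero => simp only [map_zero]
    | add x y hx hy => simp only [map_add, hx, hy]
    | single h f =>
      rw [hM, relNum_single, relNum_single, GradedAlgebra.proj_apply, GradedAlgebra.proj_apply]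
      have := DirectSum.coe_decompose_mul_add_of_right_mem (degGrading K σ) (i := -i) (j := 0)
        (a := f) (kernelNum_mem_degGrading hζ c h)
      rw [add_zero] at this
      exact this.symm
  have h2 : ∀ φ, pairMap ζt c (DirectSum.decompose (degGrading K σ) R i) φ =
      pairMap ζt c R (M φ) := by
    intro φ
    induction φ using Finsupp.induction_linear with
    | zero => simp only [map_zero]
    | add x y hx hy => simp only [map_add, hx, hy]
    | single h f =>
      rw [hM, pairMap_single, pairMap_single, ← mul_assoc, ← mul_assoc, ← map_mul, ← map_mul, id,
        constTerm_mul_kernelFun hζ, constTerm_mul_kernelFun hζ c h (_ * R)]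
      have e1 := DirectSum.coe_decompose_mul_add_of_right_mem (degGrading K σ) (i := -i) (j := i)
        (a := f) (DirectSum.decompose (degGrading K σ) R i).2
      have e2 := DirectSum.coe_decompose_mul_add_of_left_mem (degGrading K σ) (i := -i) (j := i)
        (b := R) (DirectSum.decompose (degGrading K σ) f (-i)).2
      rw [neg_add_cancel] at e1 e2
      rw [GradedAlgebra.proj_apply, GradedAlgebra.proj_apply, GradedAlgebra.proj_apply, e1, e2]
  rw [relMap_eq_zero_iff hζ] at hφ
  refine (h2 φ).trans (hR _ ?_)
  rw [relMap_eq_zero_iff hζ, h1, hφ, map_zero]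

end Homogeneity

/-! ### Prime ideals and lines -/

section Primes

variable {K : Type*} [Field K] {I : Type*} {σ : Type*} {ζt : I → I → K[T;T⁻¹]}

theorem exists_sub_mem_of_zetaNum_mem (hζ : IsFactored ζt) (c : σ → I) {u v : σ}
    {Q : Ideal (Laurent K σ)} [hQ : Q.IsPrime] (h : zetaNum ζt c u v ∈ Q) :
    ∃ q : Kˣ, (laurentVar K v : Laurent K σ) - (q : K) • (laurentVar K u : Laurent K σ) ∈ Q := by
  obtain ⟨α, s, N, q, heq⟩ := zetaNum_eq hζ c u v
  rw [heq] at h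
  rcases hQ.mem_or_mem h with h | h
  · exfalso
    apply hQ.ne_top
    rw [Ideal.eq_top_iff_one]
    have := Q.mul_mem_left (AddMonoidAlgebra.single
      (-(s • (Finsupp.single u 1 - Finsupp.single v 1))) ((α⁻¹ : Kˣ) : K)) h
    rwa [AddMonoidAlgebra.single_mul_single, neg_add_cancel, Units.inv_mul] at this
  · rw [Ideal.IsPrime.prod_mem_iff] at h
    obtain ⟨e, -, he⟩ := h
    refine ⟨q e, ?_⟩
    have := Q.mul_mem_left (laurentVar K v : Laurent K σ) he
    rw [mul_sub, mul_one, laurentVar_val, AddMonoidAlgebra.single_mul_single, one_mul,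
      add_sub_cancel] at this
    rw [laurentVar_val, laurentVar_val, AddMonoidAlgebra.smul_single, smul_eq_mul, mul_one]
    exact this

/-- If for every partition of the variables into two parts a prime ideal contains one of the
functions `ζ̃(z_u/z_v)`, with `u` and `v` in different parts, then it contains the ideal of a
line: the relation that `z_v - q z_u` belongs to the ideal for some `q` is an equivalence relation
with one class. -/
theorem exists_line_of_prime (hζ : IsFactored ζt) (c : σ → I) {Q : Ideal (Laurent K σ)}
    [hQ : Q.IsPrime]
    (h : ∀ X : Set σ, X.Nonempty → Xᶜ.Nonempty →
      ∃ u ∈ X, ∃ v ∉ X, zetaNum ζt c u v ∈ Q ∨ zetaNum ζt c v u ∈ Q) :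
    ∃ p : σ → Kˣ, ∀ v w : σ, (p w : K) • (laurentVar K v : Laurent K σ) -
      (p v : K) • (laurentVar K w : Laurent K σ) ∈ Q := by
  rcases isEmpty_or_nonempty σ with hσ | ⟨⟨u₀⟩⟩
  · exact ⟨fun _ => 1, fun v => hσ.elim v⟩
  set X : Set σ := {u | ∃ q : Kˣ,
    (laurentVar K u : Laurent K σ) - (q : K) • (laurentVar K u₀ : Laurent K σ) ∈ Q} with hX
  have htrans : ∀ u v w : σ, ∀ q q' : Kˣ,
      (laurentVar K v : Laurent K σ) - (q : K) • (laurentVar K u : Laurent K σ) ∈ Q →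
      (laurentVar K w : Laurent K σ) - (q' : K) • (laurentVar K v : Laurent K σ) ∈ Q →
      (laurentVar K w : Laurent K σ) - ((q' * q : Kˣ) : K) • (laurentVar K u : Laurent K σ) ∈
        Q := by
    intro u v w q q' h1 h2
    have := Q.add_mem h2 (Q.smul_of_tower_mem (q' : K) h1)
    rwa [smul_sub, smul_smul, ← Units.val_mul, sub_add_sub_cancel] at this
  have hsymm : ∀ u v : σ, ∀ q : Kˣ,
      (laurentVar K v : Laurent K σ) - (q : K) • (laurentVar K u : Laurent K σ) ∈ Q →
      (laurentVar K u : Laurent K σ) - ((q⁻¹ : Kˣ) : K) • (laurentVar K v : Laurent K σ) ∈ Q := by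
    intro u v q h1
    have := Q.smul_of_tower_mem (-((q⁻¹ : Kˣ) : K)) h1
    rwa [smul_sub, smul_smul, neg_mul, Units.inv_mul, neg_smul, neg_smul, one_smul,
      sub_neg_eq_add, neg_add_eq_sub] at this
  have hall : ∀ u, u ∈ X := by
    by_contra! hne
    obtain ⟨v₁, hv₁⟩ := hne
    obtain ⟨u, ⟨q, hu⟩, v, hv, huv⟩ := h X ⟨u₀, 1, by simp⟩ ⟨v₁, hv₁⟩
    apply hv
    rcases huv with huv | huv
    · obtain ⟨q', h'⟩ := exists_sub_mem_of_zetaNum_mem hζ c huv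
      exact ⟨q' * q, htrans _ _ _ _ _ hu h'⟩
    · obtain ⟨q', h'⟩ := exists_sub_mem_of_zetaNum_mem hζ c huv
      exact ⟨q'⁻¹ * q, htrans _ _ _ _ _ hu (hsymm _ _ _ h')⟩
  choose p hp using hall
  refine ⟨p, fun v w => ?_⟩
  have := Q.sub_mem (Q.smul_of_tower_mem (p w : K) (hp v)) (Q.smul_of_tower_mem (p v : K) (hp w))
  rw [smul_sub, smul_sub, smul_smul, smul_smul, mul_comm (p v : K),
    sub_sub_sub_cancel_right] at this
  exact this

/-- In a noetherian ring membership in an ideal can be tested at the prime ideals, and powers of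
ideals contained in these primes with an exponent independent of the element may be added. -/
theorem exists_pow_bound {A : Type*} [CommRing A] [IsNoetherianRing A] (J : Ideal A) :
    ∃ N : ℕ, ∀ x : A, (∀ Q : Ideal A, Q.IsPrime → (∃ g ∉ Q, g * x ∈ J) ∨
      ∃ P ≤ Q, x ∈ J ⊔ P ^ N) → x ∈ J := by
  obtain ⟨s, hs, hprim⟩ := Submodule.isLasker A A J
  have hfg : ∀ Q : Ideal A, ∃ n, Q.radical ^ n ≤ Q := fun Q =>
    Ideal.exists_radical_pow_le_of_fg Q (IsNoetherian.noetherian _)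
  choose n hn using hfg
  refine ⟨s.sup n, fun x hx => ?_⟩
  rw [← hs, Submodule.mem_finsetInf]
  intro (Q : Ideal A) hQs
  have hQ : Q.IsPrimary := hprim hQs
  have hJQ : J ≤ Q := hs ▸ Finset.inf_le (f := id) hQs
  rcases hx Q.radical (Ideal.isPrime_radical hQ) with ⟨g, hg, hgx⟩ | ⟨P, hP, hxP⟩
  · have := (Ideal.isPrimary_iff.mp hQ).2 (x := x) (y := g) (by rw [mul_comm]; exact hJQ hgx)
    exact this.resolve_right hg
  · refine (sup_le hJQ ?_ : J ⊔ P ^ _ ≤ Q) hxP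
    exact (Ideal.pow_right_mono hP _).trans
      ((Ideal.pow_le_pow_right (Finset.le_sup hQs)).trans (hn Q))

instance laurent_isNoetherianRing [Finite σ] : IsNoetherianRing (Laurent K σ) := by
  have : AddMonoid.FG (σ →₀ ℤ) :=
    AddGroup.fg_iff_addMonoid_fg.mp (Module.Finite.iff_addGroup_fg.mp inferInstance)
  have : Algebra.FiniteType K (Laurent K σ) := AddMonoidAlgebra.finiteType_of_fg K _
  exact Algebra.FiniteType.isNoetherianRing K _

end Primes

/-! ### The ideals of lines -/

section Lines

variable {K : Type*} [Field K] {I : Type*} {ζt : I → I → K[T;T⁻¹]}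

/-- The ideal of a line does not depend on the choice of the point. -/
theorem lineIdeal_smul {k : I → ℕ} (t : Kˣ) (p : Var k → Kˣ) :
    lineIdeal (t • p) = lineIdeal p := by
  have key : ∀ (t : Kˣ) (p : Var k → Kˣ), lineIdeal (t • p) ≤ lineIdeal p := by
    intro t p
    refine Ideal.span_le.mpr ?_
    rintro _ ⟨v, w, rfl⟩
    have : ((t • p) w : K) • (laurentVar K v : Laurent K (Var k)) -
        ((t • p) v : K) • (laurentVar K w : Laurent K (Var k)) =
        (t : K) • ((p w : K) • (laurentVar K v : Laurent K (Var k)) -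
        (p v : K) • (laurentVar K w : Laurent K (Var k))) := by
      rw [smul_sub, smul_smul, smul_smul]
      rfl
    rw [this]
    exact Submodule.smul_of_tower_mem _ _ (Ideal.subset_span ⟨v, w, rfl⟩)
  refine le_antisymm (key t p) ?_
  simpa using key t⁻¹ (t • p)

theorem lineIdeal_eq_of_pointClass_eq {k : I → ℕ} {p p' : Var k → Kˣ}
    (h : pointClass p = pointClass p') : lineIdeal p = lineIdeal p' := by
  obtain ⟨t, rfl⟩ := Quotient.exact h
  exact lineIdeal_smul t p'

theorem isHomogeneousIdeal_lineIdeal {k : I → ℕ} (p : Var k → Kˣ) :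
    IsHomogeneousIdeal (lineIdeal p) := by
  refine Ideal.homogeneous_span _ _ ?_
  rintro _ ⟨v, w, rfl⟩
  refine ⟨1, Submodule.sub_mem _ (Submodule.smul_mem _ _ ?_) (Submodule.smul_mem _ _ ?_)⟩ <;>
  exact single_mem_degGrading (by simp) 1

variable [DecidableEq I]

variable (ζt) in
/-- The relation ideal in the variables `z_{ia}`. -/
def relIdealVar (n : I → ℕ) [Fintype (Var n)] : Ideal (Laurent K (Var n)) :=
  relIdeal ζt (Sigma.fst : Var n → I)

variable (ζt) [Fintype I]

/-- The exponent of the power of the ideal of a line that is added to the relation ideal. -/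
def linePow (n : I → ℕ) : ℕ :=
  (exists_pow_bound (relIdealVar ζt n)).choose

/-- The ideals describing the shuffle algebra: the zero locus of the relation ideal, intersected
with a thickening of a line. -/
def pointIdeal (k : I → ℕ) (p : PointClass K k) : Ideal (Laurent K (Var k)) :=
  relIdealVar ζt k ⊔ lineIdeal p.out ^ linePow ζt k

variable {ζt}

theorem isHomogeneousIdeal_pointIdeal (hζ : IsFactored ζt) (k : I → ℕ) (p : PointClass K k) :
    IsHomogeneousIdeal (pointIdeal ζt k p) := by
  refine Ideal.IsHomogeneous.sup (isHomogeneousIdeal_relIdeal hζ _) ?_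
  induction linePow ζt k with
  | zero => rw [pow_zero, Ideal.one_eq_top]; exact Ideal.IsHomogeneous.top _
  | succ n ih => rw [pow_succ]; exact Ideal.IsHomogeneous.mul ih (isHomogeneousIdeal_lineIdeal _)

theorem isSupportedOnLine_pointIdeal (k : I → ℕ) (p : Var k → Kˣ) :
    IsSupportedOnLine p (pointIdeal ζt k (pointClass p)) := by
  rw [IsSupportedOnLine, Module.support_eq_zeroLocus, Ideal.annihilator_quotient]
  intro Q hQ
  have h1 : lineIdeal (pointClass p).out ^ linePow ζt k ≤ Q.asIdeal :=
    le_sup_right.trans hQ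
  have h2 : lineIdeal p = lineIdeal (pointClass p).out :=
    lineIdeal_eq_of_pointClass_eq (Quotient.out_eq (pointClass p)).symm
  rw [PrimeSpectrum.mem_zeroLocus, h2]
  exact Q.isPrime.le_of_pow_le h1

omit [DecidableEq I] [Fintype I] in
/-- Every set of variables is the image of a family of injections. -/
theorem exists_varMap_range (n : I → ℕ) (X : Set (Var n)) :
    ∃ (k : I → ℕ) (C : ∀ i, Fin (k i) ↪ Fin (n i)), Set.range (varMap C) = X := by
  classical
  let s : ∀ i, Finset (Fin (n i)) := fun i => {a | (⟨i, a⟩ : Var n) ∈ X}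
  refine ⟨fun i => (s i).card, fun i => ((s i).orderEmbOfFin rfl).toEmbedding, ?_⟩
  ext ⟨i, a⟩
  constructor
  · rintro ⟨⟨j, b⟩, hb⟩
    rw [← hb]
    have := Finset.orderEmbOfFin_mem (s j) rfl b
    exact (Finset.mem_filter.mp this).2
  · intro ha
    have : a ∈ Set.range ((s i).orderEmbOfFin rfl) := by
      rw [Finset.range_orderEmbOfFin]
      simpa [s] using ha
    obtain ⟨b, rfl⟩ := this
    exact ⟨⟨i, b⟩, rfl⟩

/-- An element lies in the relation ideal if it lies in the induced ideals of all point ideals. By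
induction the element lies in the extensions of the relation ideals of all proper subsets of the
variables, so `mixedNum` multiplies it into the relation ideal for every partition of the variables.
At a prime ideal containing all these multipliers, and hence the ideal of a line, the point ideals
of that line are used. -/
theorem mem_relIdealVar_of_forall (hζ : IsFactored ζt) (n : I → ℕ) (x : Laurent K (Var n))
    (hx : ∀ k ≤ n, ∀ p : PointClass K k, x ∈ inducedIdeal (pointIdeal ζt k p) n) :
    x ∈ relIdealVar ζt n := by
  induction hN : Fintype.card (Var n) using Nat.strong_induction_on generalizing n with
  | _ N ih =>
    have hproper : ∀ (k : I → ℕ) (C : ∀ i, Fin (k i) ↪ Fin (n i)),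
        (Set.range (varMap C))ᶜ.Nonempty →
        x ∈ (relIdealVar ζt k).map (rename K (varMap C)) := by
      intro k C ⟨v, hv⟩
      apply mem_map_of_forall_coeffAlong_mem
      intro e
      -- The coefficients of `x` have fewer variables and lie in all induced ideals again.
      have hcard : Fintype.card (Var k) < N :=
        hN ▸ Fintype.card_lt_of_injective_of_notMem (varMap C) (varMap C).injective hv
      refine ih _ hcard k _ (fun k' hk' p => ?_) rfl
      refine Ideal.mem_iInf.mpr fun D => ?_
      apply coeffAlong_mem_of_mem_map
      have hle : k' ≤ n := fun i => by
        simpa using Fintype.card_le_of_embedding ((D i).trans (C i))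
      have := Ideal.mem_iInf.mp (hx k' hle p) fun i => (D i).trans (C i)
      have h2 : ((rename K (varMap C)).toRingHom).comp (rename K (varMap D)).toRingHom =
          (rename K (varMap fun i => (D i).trans (C i))).toRingHom :=
        congrArg AlgHom.toRingHom (rename_comp (K := K) (varMap D) (varMap C))
      have h3 : ((pointIdeal ζt k' p).map (rename K (varMap D)).toRingHom).map
          (rename K (varMap C)).toRingHom = (pointIdeal ζt k' p).map
          (rename K (varMap fun i => (D i).trans (C i))).toRingHom := by
        rw [Ideal.map_map, h2]
      exact h3.ge this
    refine (exists_pow_bound (relIdealVar ζt n)).choose_spec x fun Q hQ => ?_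
    by_cases hQX : ∀ X : Set (Var n), X.Nonempty → Xᶜ.Nonempty →
      ∃ u ∈ X, ∃ v ∉ X, zetaNum ζt Sigma.fst u v ∈ Q ∨ zetaNum ζt Sigma.fst v u ∈ Q
    · right
      obtain ⟨p, hp⟩ := exists_line_of_prime hζ Sigma.fst hQX
      have hpQ : lineIdeal p ≤ Q := by
        refine Ideal.span_le.mpr ?_
        rintro _ ⟨v, w, rfl⟩
        exact hp v w
      rw [lineIdeal_eq_of_pointClass_eq (Quotient.out_eq (pointClass p)).symm] at hpQ
      refine ⟨_, hpQ, ?_⟩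
      have := Ideal.mem_iInf.mp (hx n le_rfl (pointClass p)) fun i => Function.Embedding.refl _
      have hid : rename K (varMap fun i => Function.Embedding.refl (Fin (n i))) =
          AlgHom.id K (Laurent K (Var n)) := AlgHom.ext rename_id
      rw [hid] at this
      have h4 := Ideal.map_id (pointIdeal ζt n (pointClass p))
      exact h4.le this
    · left
      push Not at hQX
      obtain ⟨X, hX, hXc, hnot⟩ := hQX
      obtain ⟨k, C, hC⟩ := exists_varMap_range n X
      obtain ⟨l, D, hD⟩ := exists_varMap_range n Xᶜ
      have hab : Disjoint (Set.range (varMap C)) (Set.range (varMap D)) := by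
        rw [hC, hD]; exact disjoint_compl_right
      have hab' : Set.range (varMap C) ∪ Set.range (varMap D) = Set.univ := by
        rw [hC, hD, Set.union_compl_self]
      refine ⟨mixedNum ζt (varMap C) (varMap D) Sigma.fst, ?_,
        mixedNum_mul_mem hζ hab hab' Sigma.fst (hproper k C (hC ▸ hXc))
          (hproper l D (by rw [hD, compl_compl]; exact hX))⟩
      intro hmem
      rw [mixedNum, Ideal.IsPrime.prod_mem_iff] at hmem
      obtain ⟨u, -, hmem⟩ := hmem
      rw [Ideal.IsPrime.prod_mem_iff] at hmem
      obtain ⟨v, -, hmem⟩ := hmem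
      have hu : varMap C u ∈ X := hC ▸ ⟨u, rfl⟩
      have hv : varMap D v ∉ X := by
        have : varMap D v ∈ Xᶜ := hD ▸ ⟨v, rfl⟩
        exact this
      have := hnot _ hu _ hv
      rcases hQ.mem_or_mem hmem with h | h
      · exact this.1 h
      · exact this.2 h

/-- The relation ideal is the intersection of the induced ideals. -/
theorem relIdealVar_restrictScalars (hζ : IsFactored ζt) (n : I → ℕ) :
    (relIdealVar ζt n).restrictScalars K =
      ⨅ k : I → ℕ, ⨅ _ : k ≤ n, ⨅ p : PointClass K k,
        (inducedIdeal (pointIdeal ζt k p) n).restrictScalars K := by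
  ext x
  simp only [Submodule.mem_iInf, Submodule.restrictScalars_mem]
  constructor
  · intro hx k _ p
    refine Ideal.mem_iInf.mpr fun C => ?_
    have h1 := relIdeal_le_map hζ (varMap C) (Sigma.fst : Var n → I) hx
    exact Ideal.map_mono (le_sup_left : relIdealVar ζt k ≤ pointIdeal ζt k p) h1
  · exact mem_relIdealVar_of_forall hζ n x

end Lines

/-! ### Words and their images in the shuffle algebra -/

section Words

variable {K : Type*} [Field K] {I : Type*} [DecidableEq I]

theorem relabel_varLeft (x : I × ℤ) (w : List (I × ℤ)) (u : Var (Pi.single x.1 1 : I → ℕ)) :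
    relabel (x :: w) (varLeft (Pi.single x.1 1) (wordDeg w) u) = (0 : Fin (w.length + 1)) := by
  obtain ⟨j, b⟩ := u
  exact Fin.addCases_left (motive := fun _ => Fin (w.length + 1)) b

theorem relabel_varRight (x : I × ℤ) (w : List (I × ℤ)) (v : Var (wordDeg w)) :
    relabel (x :: w) (varRight (Pi.single x.1 1) (wordDeg w) v) = (relabel w v).succ := by
  obtain ⟨j, b⟩ := v
  exact Fin.addCases_right (motive := fun _ => Fin (w.length + 1)) b

omit [DecidableEq I] in
theorem var_left_or_right (m n : I → ℕ) (v : Var (m + n)) :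
    v ∈ Set.range (varLeft m n) ∪ Set.range (varRight m n) := by
  obtain ⟨j, b⟩ := v
  refine Fin.addCases (m := m j) (n := n j)
    (motive := fun b => (⟨j, b⟩ : Var (m + n)) ∈ _) (fun a => ?_) (fun a => ?_) b
  · exact Or.inl ⟨⟨j, a⟩, rfl⟩
  · exact Or.inr ⟨⟨j, a⟩, rfl⟩

omit [DecidableEq I] in
theorem range_varLeft_union (m n : I → ℕ) :
    Set.range (varLeft m n) ∪ Set.range (varRight m n) = Set.univ :=
  Set.eq_univ_of_forall (var_left_or_right m n)

omit [DecidableEq I] in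
theorem disjoint_varLeft_varRight (m n : I → ℕ) :
    Disjoint (Set.range (varLeft m n)) (Set.range (varRight m n)) := by
  rw [Set.disjoint_left]
  rintro _ ⟨⟨j, a⟩, rfl⟩ ⟨⟨j', b⟩, h⟩
  have h1 : j' = j := congrArg Sigma.fst h
  subst h1
  have h2 := eq_of_heq (Sigma.mk.inj h).2
  have h3 := congrArg Fin.val h2
  change m j' + (b : ℕ) = (a : ℕ) at h3
  have := a.isLt
  omega

theorem relabel_color (w : List (I × ℤ)) (v : Var (wordDeg w)) :
    (w.get (relabel w v)).1 = v.1 := by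
  induction w with
  | nil => exact (Nat.not_lt_zero _ v.2.isLt).elim
  | cons x w ih =>
    rcases var_left_or_right _ _ v with ⟨u, rfl⟩ | ⟨u, rfl⟩
    · rw [relabel_varLeft]
      obtain ⟨j, b⟩ := u
      have : j = x.1 := by
        by_contra h
        have h1 := b.isLt
        have h2 : (Pi.single x.1 1 : I → ℕ) j = 0 := Pi.single_eq_of_ne h _
        omega
      exact this.symm
    · rw [relabel_varRight]
      exact ih u

theorem subsingleton_var_single (i : I) : Subsingleton (Var (Pi.single i 1 : I → ℕ)) := by
  constructor
  have key : ∀ u : Var (Pi.single i 1 : I → ℕ), u = ⟨i, ⟨0, by simp⟩⟩ := by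
    rintro ⟨j, b⟩
    have : j = i := by
      by_contra h
      have h1 := b.isLt
      have h2 : (Pi.single i 1 : I → ℕ) j = 0 := Pi.single_eq_of_ne h _
      omega
    subst this
    congr 1
    apply Fin.ext
    have h1 := b.isLt
    have h2 : (Pi.single j 1 : I → ℕ) j = 1 := Pi.single_eq_same _ _
    change (b : ℕ) = 0
    omega
  intro u v
  rw [key u, key v]

theorem relabel_bijective (w : List (I × ℤ)) : Function.Bijective (relabel w) := by
  induction w with
  | nil =>
    exact ⟨fun v => (Nat.not_lt_zero _ v.2.isLt).elim, fun a => a.elim0⟩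
  | cons x w ih =>
    constructor
    · intro u v huv
      rcases var_left_or_right _ _ u with ⟨u, rfl⟩ | ⟨u, rfl⟩ <;>
      rcases var_left_or_right _ _ v with ⟨v, rfl⟩ | ⟨v, rfl⟩
      · rw [(subsingleton_var_single x.1).elim u v]
      · rw [relabel_varLeft, relabel_varRight] at huv
        exact (Fin.succ_ne_zero _ huv.symm).elim
      · rw [relabel_varLeft, relabel_varRight] at huv
        exact (Fin.succ_ne_zero _ huv).elim
      · rw [relabel_varRight, relabel_varRight] at huv
        rw [ih.1 (Fin.succ_injective _ huv)]
    · intro a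
      refine Fin.cases ?_ (fun a => ?_) a
      · exact ⟨_, relabel_varLeft x w ⟨x.1, ⟨0, by simp⟩⟩⟩
      · obtain ⟨v, rfl⟩ := ih.2 a
        exact ⟨_, relabel_varRight x w v⟩

variable (ζt : I → I → K[T;T⁻¹]) [Fintype I]

/-- The monomial of a word. -/
def wordMonomial (K : Type*) [Field K] (w : List (I × ℤ)) : Rational K (Var (wordDeg w)) :=
  ∏ v, ((rationalVar K v ^ (w.get (relabel w v)).2 : (Rational K (Var (wordDeg w)))ˣ) :
    Rational K (Var (wordDeg w)))

/-- The product of the functions `ζ` over the pairs of letters of a word. -/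
def wordCross (ε : Half) (w : List (I × ℤ)) : Rational K (Var (wordDeg w)) :=
  ∏ u : Var (wordDeg w), ∏ v : Var (wordDeg w),
    if relabel w u < relabel w v then
      cross ζt ε u.1 v.1 (rationalVar K u) (rationalVar K v) else 1

/-- The rational function whose symmetrization is the image of a word in the shuffle algebra. -/
def wordFun (ε : Half) (w : List (I × ℤ)) : Rational K (Var (wordDeg w)) :=
  wordMonomial K w * wordCross ζt ε w

/-! ### Symmetrization -/

omit [DecidableEq I] in
theorem renameRational_unit_rationalVar {σ τ : Type*} (a : σ ↪ τ) (v : σ) :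
    Units.map (renameRational K a : Rational K σ →* Rational K τ) (rationalVar K v) =
      rationalVar K (a v) :=
  Units.ext (renameRational_rationalVar a v)

omit [DecidableEq I] in
theorem renameRational_zpow {σ τ : Type*} (a : σ ↪ τ) (v : σ) (d : ℤ) :
    renameRational K a ((rationalVar K v ^ d : (Rational K σ)ˣ) : Rational K σ) =
      ((rationalVar K (a v) ^ d : (Rational K τ)ˣ) : Rational K τ) := by
  rw [← renameRational_unit_rationalVar, ← map_zpow]
  rfl

omit [Fintype I] in
theorem map_cross {F F' : Type*} [Field F] [Field F'] [Algebra K F] [Algebra K F']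
    (φ : F →ₐ[K] F') (ε : Half) (i j : I) (x y : Fˣ) :
    φ (cross ζt ε i j x y) =
      cross ζt ε i j (Units.map (φ : F →* F') x) (Units.map (φ : F →* F') y) := by
  have key : ∀ (i j : I) (x : Fˣ), φ (zetaEval ζt i j x) =
      zetaEval ζt i j (Units.map (φ : F →* F') x) := by
    intro i j x
    rw [zetaEval, zetaEval, map_div₀, map_eval₂, apply_ite φ, map_sub, map_one]
    rfl
  cases ε <;> simp only [cross, key, map_div]

/-- Symmetrization is invariant under relabeling: it sums over all bijections of the variables
preserving the colours. -/
theorem symmetrize_renameRational {m n : I → ℕ} (e : ∀ i, Fin (m i) ≃ Fin (n i))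
    (f : Rational K (Var m)) :
    symmetrize (renameRational K (varMap fun i => (e i).toEmbedding) f) =
      ∑ e' : ∀ i, Fin (m i) ≃ Fin (n i),
        renameRational K (varMap fun i => (e' i).toEmbedding) f := by
  rw [symmetrize]
  refine Fintype.sum_equiv
    (Equiv.piCongrRight fun i => Equiv.equivCongr (e i).symm (Equiv.refl _)) _ _ fun s => ?_
  rw [renameRational_renameRational]
  rfl

theorem symmetrize_perm {n : I → ℕ} (s : ∀ i, Equiv.Perm (Fin (n i))) (f : Rational K (Var n)) :
    symmetrize (renameRational K (varMap fun i => (s i).toEmbedding) f) = symmetrize f :=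
  symmetrize_renameRational s f

/-- The extension of permutations of the last variables of each colour to all variables. -/
def extendPerm (m : I → ℕ) {n : I → ℕ} (t : ∀ i, Equiv.Perm (Fin (n i))) (i : I) :
    Equiv.Perm (Fin ((m + n) i)) :=
  (finSumFinEquiv.symm.trans (Equiv.sumCongr (Equiv.refl (Fin (m i))) (t i))).trans finSumFinEquiv

omit [DecidableEq I] [Fintype I] in
theorem extendPerm_varLeft (m : I → ℕ) {n : I → ℕ} (t : ∀ i, Equiv.Perm (Fin (n i))) :
    (varLeft m n).trans (varMap fun i => (extendPerm m t i).toEmbedding) = varLeft m n := by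
  ext1 ⟨i, a⟩
  refine congrArg (Sigma.mk i) ?_
  change finSumFinEquiv (Equiv.sumCongr _ _ (finSumFinEquiv.symm (Fin.castAdd (n i) a))) = _
  rw [finSumFinEquiv_symm_apply_castAdd]
  rfl

omit [DecidableEq I] [Fintype I] in
theorem extendPerm_varRight (m : I → ℕ) {n : I → ℕ} (t : ∀ i, Equiv.Perm (Fin (n i))) :
    (varRight m n).trans (varMap fun i => (extendPerm m t i).toEmbedding) =
      (varMap fun i => (t i).toEmbedding).trans (varRight m n) := by
  ext1 ⟨i, a⟩
  refine congrArg (Sigma.mk i) ?_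
  change finSumFinEquiv (Equiv.sumCongr _ _ (finSumFinEquiv.symm (Fin.natAdd (m i) a))) = _
  rw [finSumFinEquiv_symm_apply_natAdd]
  rfl

theorem card_perm (n : I → ℕ) :
    Fintype.card (∀ i, Equiv.Perm (Fin (n i))) = ∏ i, (n i).factorial := by
  rw [Fintype.card_pi]
  exact Finset.prod_congr rfl fun i _ => by rw [Fintype.card_perm, Fintype.card_fin]

/-- In the shuffle product with a symmetrization the inner symmetrization is absorbed by the outer
one. -/
theorem shuffleMul_symmetrize [CharZero K] (ε : Half) {m n : I → ℕ} (f : Rational K (Var m))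
    (g : Rational K (Var n)) :
    shuffleMul ζt ε f (symmetrize g) =
      symmetrize (renameRational K (varLeft m n) f * renameRational K (varRight m n) g /
          ((∏ i, (m i).factorial : ℕ) : Rational K (Var (m + n))) *
        ∏ u : Var m, ∏ v : Var n,
          cross ζt ε u.1 v.1 (rationalVar K (varLeft m n u)) (rationalVar K (varRight m n v))) := by
  set X := ∏ u : Var m, ∏ v : Var n,
    cross ζt ε u.1 v.1 (rationalVar K (varLeft m n u)) (rationalVar K (varRight m n v)) with hX
  have hXinv : ∀ t : ∀ i, Equiv.Perm (Fin (n i)),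
      renameRational K (varMap fun i => (extendPerm m t i).toEmbedding) X = X := by
    intro t
    rw [hX]
    simp only [map_prod, map_cross, renameRational_unit_rationalVar]
    refine Finset.prod_congr rfl fun u _ => ?_
    refine Fintype.prod_equiv (Equiv.sigmaCongrRight t) _ _ fun v => ?_
    have h1 := DFunLike.congr_fun (extendPerm_varLeft m t) u
    have h2 := DFunLike.congr_fun (extendPerm_varRight m t) v
    rw [Function.Embedding.trans_apply] at h1 h2
    rw [h1, h2]
    rfl
  have hchar : CharZero (Rational K (Var (m + n))) :=
    charZero_of_injective_algebraMap (algebraMap K (Rational K (Var (m + n)))).injective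
  have hsmul : ∀ (r : ℕ) (f : Rational K (Var (m + n))),
      symmetrize (f / (r : Rational K (Var (m + n)))) =
        symmetrize f / (r : Rational K (Var (m + n))) := by
    intro r f
    simp only [symmetrize, map_div₀, map_natCast, Finset.sum_div]
  have hterm : ∀ t : ∀ i, Equiv.Perm (Fin (n i)),
      symmetrize (renameRational K (varLeft m n) f * renameRational K (varRight m n)
        (renameRational K (varMap fun i => (t i).toEmbedding) g) * X) =
      symmetrize (renameRational K (varLeft m n) f * renameRational K (varRight m n) g * X) := by
    intro t
    rw [← symmetrize_perm (extendPerm m t)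
      (renameRational K (varLeft m n) f * renameRational K (varRight m n) g * X)]
    rw [map_mul, map_mul, hXinv, renameRational_renameRational, renameRational_renameRational,
      renameRational_renameRational, extendPerm_varLeft, extendPerm_varRight]
  have hsum : symmetrize (renameRational K (varLeft m n) f *
      renameRational K (varRight m n) (symmetrize g) * X) =
      ((∏ i, (n i).factorial : ℕ) : Rational K (Var (m + n))) *
      symmetrize (renameRational K (varLeft m n) f * renameRational K (varRight m n) g * X) := by
    have h1 : symmetrize (renameRational K (varLeft m n) f *
        renameRational K (varRight m n) (symmetrize g) * X) =
        ∑ t : ∀ i, Equiv.Perm (Fin (n i)), symmetrize (renameRational K (varLeft m n) f *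
          renameRational K (varRight m n)
            (renameRational K (varMap fun i => (t i).toEmbedding) g) * X) := by
      simp only [symmetrize, map_sum, Finset.mul_sum, Finset.sum_mul]
      rw [Finset.sum_comm]
    rw [h1, Finset.sum_congr rfl fun t _ => hterm t, Finset.sum_const, nsmul_eq_mul,
      Finset.card_univ, card_perm]
  have hn : ((∏ i, (n i).factorial : ℕ) : Rational K (Var (m + n))) ≠ 0 := by
    rw [Nat.cast_ne_zero]
    exact Finset.prod_ne_zero_iff.mpr fun i _ => Nat.factorial_ne_zero _
  rw [shuffleMul, div_mul_eq_mul_div, div_mul_eq_mul_div, hsmul, hsmul, hsum, Nat.cast_mul,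
    mul_comm ((∏ i, (m i).factorial : ℕ) : Rational K (Var (m + n))), mul_div_mul_left _ _ hn]

/-- The factorials in the iterated shuffle product cancel against the inner symmetrizations. -/
theorem upsilonWord_eq_symmetrize [CharZero K] (ε : Half) (w : List (I × ℤ)) :
    upsilonWord ζt ε w = symmetrize (wordFun ζt ε w) := by
  induction w with
  | nil =>
    have hv : IsEmpty (Var (wordDeg ([] : List (I × ℤ)))) :=
      ⟨fun v => Nat.not_lt_zero _ v.2.isLt⟩
    have hu : ∀ i, Subsingleton (Equiv.Perm (Fin (wordDeg ([] : List (I × ℤ)) i))) := fun i =>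
      inferInstanceAs (Subsingleton (Equiv.Perm (Fin 0)))
    rw [upsilonWord, wordFun, wordMonomial, wordCross, symmetrize, Fintype.prod_empty,
      Fintype.prod_empty, mul_one]
    simp only [map_one, Finset.sum_const, Finset.card_univ, card_perm]
    simp [wordDeg]
    exact (one_smul _ _).symm
  | cons x w ih =>
    rw [upsilonWord, ih, shuffleMul_symmetrize]
    have hfac : (∏ i, ((Pi.single x.1 1 : I → ℕ) i).factorial) = 1 := by
      refine Finset.prod_eq_one fun i _ => ?_
      by_cases h : i = x.1
      · subst h; simp
      · rw [Pi.single_eq_of_ne h, Nat.factorial_zero]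
    rw [hfac, Nat.cast_one, div_one]
    refine congrArg symmetrize ?_
    have hab := disjoint_varLeft_varRight (Pi.single x.1 1) (wordDeg w)
    have hab' := range_varLeft_union (Pi.single x.1 1) (wordDeg w)
    have hsub := subsingleton_var_single x.1
    have h1 : wordMonomial K (x :: w) =
        renameRational K (varLeft (Pi.single x.1 1) (wordDeg w))
          ((rationalVar K (⟨x.1, ⟨0, by simp⟩⟩ : Var (Pi.single x.1 1)) ^ x.2 :
            (Rational K (Var (Pi.single x.1 1)))ˣ) : Rational K (Var (Pi.single x.1 1))) *
        renameRational K (varRight (Pi.single x.1 1) (wordDeg w)) (wordMonomial K w) := by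
      refine (prod_eq_of_split hab hab' _).trans (congrArg₂ _ ?_ ?_)
      · rw [Fintype.prod_subsingleton _ (⟨x.1, ⟨0, by simp⟩⟩ : Var (Pi.single x.1 1)),
          relabel_varLeft]
        exact (renameRational_zpow _ _ _).symm
      · rw [wordMonomial, map_prod]
        refine Finset.prod_congr rfl fun v _ => ?_
        rw [renameRational_zpow, relabel_varRight]
        rfl
    have h2 : wordCross ζt ε (x :: w) =
        (∏ u : Var (Pi.single x.1 1), ∏ v : Var (wordDeg w),
          cross ζt ε u.1 v.1 (rationalVar K (varLeft (Pi.single x.1 1) (wordDeg w) u))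
            (rationalVar K (varRight (Pi.single x.1 1) (wordDeg w) v))) *
        renameRational K (varRight (Pi.single x.1 1) (wordDeg w)) (wordCross ζt ε w) := by
      refine (prod_eq_of_split hab hab' _).trans (congrArg₂ _ ?_ ?_)
      · refine Finset.prod_congr rfl fun u _ => ?_
        refine (prod_eq_of_split hab hab' _).trans ?_
        rw [Finset.prod_eq_one fun v _ => ?_, one_mul]
        · refine Finset.prod_congr rfl fun v _ => ?_
          rw [relabel_varLeft, relabel_varRight, if_pos (Fin.succ_pos _)]
          rfl
        · rw [relabel_varLeft, relabel_varLeft, if_neg (lt_irrefl _)]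
      · rw [wordCross, map_prod]
        refine Finset.prod_congr rfl fun u _ => ?_
        refine (prod_eq_of_split hab hab' _).trans ?_
        rw [Finset.prod_eq_one fun v _ => ?_, one_mul, map_prod]
        · refine Finset.prod_congr rfl fun v _ => ?_
          rw [relabel_varRight, relabel_varRight, apply_ite (renameRational K _), map_one,
            map_cross, renameRational_unit_rationalVar, renameRational_unit_rationalVar]
          exact if_congr Fin.succ_lt_succ_iff rfl rfl
        · rw [relabel_varLeft, relabel_varRight, if_neg (Fin.not_lt_zero _)]
    have h3 : ∀ a b c d : Rational K (Var (Pi.single x.1 1 + wordDeg w)),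
        a * (b * c) * d = (a * b) * (d * c) := fun a b c d => by ring
    rw [wordFun, wordFun, map_mul]
    exact (h3 _ _ _ _).trans (congrArg₂ _ h1 h2).symm

end Words

/-! ### Independence of the ordering in which products are expanded -/

section Comparison

variable {K : Type*} [Field K] {I : Type*} {σ : Type*} {ζt : I → I → K[T;T⁻¹]}
  {Γ Γ' : Type*} [AddCommGroup Γ] [LinearOrder Γ] [IsOrderedAddMonoid Γ]
  [AddCommGroup Γ'] [LinearOrder Γ'] [IsOrderedAddMonoid Γ']

theorem SameCoeff.of_prod_one_sub {ι : Type*} {ρ : (σ →₀ ℤ) →+ Γ} {ρ' : (σ →₀ ℤ) →+ Γ'}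
    {x : HahnSeries Γ K} {y : HahnSeries Γ' K} {m : σ →₀ ℤ} (hm : 0 < ρ m) (hm' : 0 < ρ' m)
    (q : ι → K) (t : Finset ι)
    (h : SameCoeff ρ ρ' ((∏ e ∈ t, (1 - HahnSeries.single (ρ m) (q e))) * x)
      ((∏ e ∈ t, (1 - HahnSeries.single (ρ' m) (q e))) * y)) : SameCoeff ρ ρ' x y := by
  classical
  induction t using Finset.induction_on with
  | empty => simpa using h
  | insert a t ha ih =>
    rw [Finset.prod_insert ha, Finset.prod_insert ha, mul_assoc, mul_assoc] at h
    exact ih (SameCoeff.of_mul_one_sub hm hm' h)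

theorem expand_mul_eq {ρ : (σ →₀ ℤ) →+ Γ} (hρ : Function.Injective ρ) {a b : Laurent K σ}
    {f g : Rational K σ} (h : algebraMap _ _ a * f = algebraMap _ _ b * g) :
    expandLaurent K ρ a * expand K hρ f = expandLaurent K ρ b * expand K hρ g := by
  rw [← expand_algebraMap hρ, ← expand_algebraMap hρ, ← map_mul, ← map_mul, h]

theorem SameCoeff.expand_mul_invZeta [DecidableEq I] (hζ : IsFactored ζt) (c : σ → I) {u v : σ}
    (huv : u ≠ v) {ρ : (σ →₀ ℤ) →+ Γ} {ρ' : (σ →₀ ℤ) →+ Γ'} (hρ : Function.Injective ρ)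
    (hρ' : Function.Injective ρ') (hpos : 0 < ρ (Finsupp.single u 1 - Finsupp.single v 1))
    (hpos' : 0 < ρ' (Finsupp.single u 1 - Finsupp.single v 1)) {g : Rational K σ}
    (hg : SameCoeff ρ ρ' (expand K hρ g) (expand K hρ' g)) :
    SameCoeff ρ ρ' (expand K hρ (g * invZeta ζt c u v)) (expand K hρ' (g * invZeta ζt c u v)) := by
  obtain ⟨α, s, N, q, heq⟩ := zetaNum_eq hζ c u v
  set m : σ →₀ ℤ := Finsupp.single u 1 - Finsupp.single v 1 with hm
  have h1 : algebraMap (Laurent K σ) (Rational K σ)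
      (∏ e, (1 - AddMonoidAlgebra.single m (q e : K))) * (g * invZeta ζt c u v) =
      algebraMap _ _ (AddMonoidAlgebra.single (-(s • m)) ((α⁻¹ : Kˣ) : K) * zetaDen K c u v) *
        g := by
    have h2 : (∏ e, (1 - AddMonoidAlgebra.single m (q e : K)) : Laurent K σ) =
        AddMonoidAlgebra.single (-(s • m)) ((α⁻¹ : Kˣ) : K) * zetaNum ζt c u v := by
      rw [heq, ← mul_assoc, AddMonoidAlgebra.single_mul_single, neg_add_cancel, Units.inv_mul,
        ← AddMonoidAlgebra.one_def, one_mul]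
    rw [h2, map_mul, map_mul, ← zetaNum_mul_invZeta hζ c huv]
    ring
  refine SameCoeff.of_prod_one_sub hpos hpos' (fun e => (q e : K)) Finset.univ ?_
  have h3 := expand_mul_eq hρ h1
  have h4 := expand_mul_eq hρ' h1
  simp only [map_prod, map_sub, map_one, expandLaurent_single] at h3 h4
  rw [h3, h4]
  simpa only [map_mul, expandLaurent_single, mul_assoc] using
    hg.expandLaurent_mul (AddMonoidAlgebra.single (-(s • m)) ((α⁻¹ : Kˣ) : K) * zetaDen K c u v)

/-- The coefficients of the expansion of `f ∏ 1/ζ(z_u/z_v)` depend only on which of the ratios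
`z_u/z_v` are small. -/
theorem sameCoeff_expand_kernelFun [DecidableEq I] [Fintype σ] (hζ : IsFactored ζt) (c : σ → I)
    (h : σ ↪ ℕ) {ρ : (σ →₀ ℤ) →+ Γ} {ρ' : (σ →₀ ℤ) →+ Γ'} (hρ : Function.Injective ρ)
    (hρ' : Function.Injective ρ')
    (hpos : ∀ u v, h u < h v → 0 < ρ (Finsupp.single u 1 - Finsupp.single v 1))
    (hpos' : ∀ u v, h u < h v → 0 < ρ' (Finsupp.single u 1 - Finsupp.single v 1))
    (f : Laurent K σ) :
    SameCoeff ρ ρ' (expand K hρ (algebraMap _ _ f * kernelFun ζt c h))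
      (expand K hρ' (algebraMap _ _ f * kernelFun ζt c h)) := by
  set Q : Rational K σ → Prop := fun x => ∀ g,
    SameCoeff ρ ρ' (expand K hρ g) (expand K hρ' g) →
      SameCoeff ρ ρ' (expand K hρ (g * x)) (expand K hρ' (g * x)) with hQ
  have hmul : ∀ x y, Q x → Q y → Q (x * y) := by
    intro x y hx hy g hg
    rw [← mul_assoc]
    exact hy _ (hx g hg)
  have hone : Q 1 := fun g hg => by rwa [mul_one]
  have hker : Q (kernelFun ζt c h) := by
    refine Finset.prod_induction _ Q hmul hone fun u _ => ?_
    refine Finset.prod_induction _ Q hmul hone fun v _ => ?_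
    split_ifs with huv
    · exact fun g hg => SameCoeff.expand_mul_invZeta hζ c (by rintro rfl; exact lt_irrefl _ huv)
        hρ hρ' (hpos u v huv) (hpos' u v huv) hg
    · exact hone
  refine hker _ ?_
  intro m
  rw [expand_algebraMap, expand_algebraMap, coeff_expandLaurent hρ, coeff_expandLaurent hρ']

end Comparison

/-! ### The pairing of a word as a constant term -/

section WordPairing

variable {K : Type*} [Field K] {I : Type*} [DecidableEq I] [Fintype I]

/-- The position `a` comes before `b` in the sense that `z_a/z_b` is small in the region of
expansion of the pairing with words of the `η` half. -/
def Half.Before (η : Half) {ℓ : ℕ} (a b : Fin ℓ) : Prop :=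
  match η with
  | .plus => b < a
  | .minus => a < b

/-- The heights `h` expand functions of the variables of the word `w` in the region prescribed for
the pairing with words of the `η` half. -/
def IsCompatible (η : Half) (w : List (I × ℤ)) (h : Var (wordDeg w) ↪ ℕ) : Prop :=
  ∀ u v, h u < h v ↔ η.Before (relabel w u) (relabel w v)

/-- The embedding of exponent vectors underlying `expansionVar`. -/
def wordHom (η : Half) (w : List (I × ℤ)) :
    (Var (wordDeg w) →₀ ℤ) →+ Lex (Fin w.length → ℤ) where
  toFun m := toLex fun a => (match η with | .plus => -1 | .minus => 1) * m.mapDomain (relabel w) a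
  map_zero' := congrArg toLex (funext fun a => by simp)
  map_add' m m' := by
    refine congrArg toLex (funext fun a => ?_)
    rw [Finsupp.mapDomain_add]
    exact mul_add _ _ _

omit [Fintype I] in
theorem wordHom_injective (η : Half) (w : List (I × ℤ)) : Function.Injective (wordHom η w) := by
  intro m m' h
  refine Finsupp.mapDomain_injective (relabel_bijective w).1 (Finsupp.ext fun a => ?_)
  have h1 := congrFun (toLex.injective h) a
  cases η
  · exact mul_left_cancel₀ (by decide) h1
  · exact mul_left_cancel₀ (by decide) h1

omit [Fintype I] in
theorem wordHom_single (η : Half) (w : List (I × ℤ)) (v : Var (wordDeg w)) :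
    wordHom η w (Finsupp.single v 1) =
      toLex (Pi.single (relabel w v) (match η with | .plus => -1 | .minus => 1)) := by
  refine congrArg toLex (funext fun a => ?_)
  rw [Finsupp.mapDomain_single, Finsupp.single_apply, Pi.single_apply]
  by_cases h : relabel w v = a
  · rw [if_pos h, if_pos h.symm, mul_one]
  · rw [if_neg h, if_neg (Ne.symm h), mul_zero]

omit [Fintype I] in
theorem expand_wordHom_rationalVar (η : Half) (w : List (I × ℤ)) (v : Var (wordDeg w)) :
    Units.map (expand K (wordHom_injective η w) : Rational K (Var (wordDeg w)) →* _)
      (rationalVar K v) = expansionVar K η (relabel w v) := by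
  refine Units.ext ?_
  refine (expand_rationalVar (wordHom_injective η w) v).trans ?_
  rw [wordHom_single]
  rfl

omit [Fintype I] in
theorem wordHom_pos (η : Half) (w : List (I × ℤ)) {u v : Var (wordDeg w)}
    (h : η.Before (relabel w u) (relabel w v)) :
    0 < wordHom η w (Finsupp.single u 1 - Finsupp.single v 1) := by
  rw [map_sub, wordHom_single, wordHom_single]
  cases η
  · refine ⟨relabel w v, fun j hj => ?_, ?_⟩
    · change (0 : ℤ) = (Pi.single (relabel w u) (-1) : Fin w.length → ℤ) j -
        (Pi.single (relabel w v) (-1) : Fin w.length → ℤ) j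
      rw [Pi.single_eq_of_ne hj.ne, Pi.single_eq_of_ne (hj.trans h).ne, sub_zero]
    · change (0 : ℤ) < (Pi.single (relabel w u) (-1) : Fin w.length → ℤ) (relabel w v) -
        (Pi.single (relabel w v) (-1) : Fin w.length → ℤ) (relabel w v)
      rw [Pi.single_eq_same, Pi.single_eq_of_ne (ne_of_lt h)]
      decide
  · refine ⟨relabel w u, fun j hj => ?_, ?_⟩
    · change (0 : ℤ) = (Pi.single (relabel w u) 1 : Fin w.length → ℤ) j -
        (Pi.single (relabel w v) 1 : Fin w.length → ℤ) j
      rw [Pi.single_eq_of_ne hj.ne, Pi.single_eq_of_ne (hj.trans h).ne, sub_zero]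
    · change (0 : ℤ) < (Pi.single (relabel w u) 1 : Fin w.length → ℤ) (relabel w u) -
        (Pi.single (relabel w v) 1 : Fin w.length → ℤ) (relabel w u)
      rw [Pi.single_eq_same, Pi.single_eq_of_ne (ne_of_lt h)]
      decide

variable (ζt : I → I → K[T;T⁻¹])

theorem expand_wordCross (η ε : Half) (w : List (I × ℤ)) :
    expand K (wordHom_injective η w) (wordCross ζt ε w) =
      ∏ a : Fin w.length, ∏ b ∈ Finset.Ioi a,
        cross ζt ε (w.get a).1 (w.get b).1 (expansionVar K η a) (expansionVar K η b) := by
  rw [wordCross, map_prod]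
  refine Fintype.prod_bijective (relabel w) (relabel_bijective w) _ _ fun u => ?_
  rw [map_prod, ← Finset.filter_lt_eq_Ioi, Finset.prod_filter]
  refine Fintype.prod_bijective (relabel w) (relabel_bijective w) _ _ fun v => ?_
  rw [apply_ite (expand K _), map_one, map_cross, expand_wordHom_rationalVar,
    expand_wordHom_rationalVar, relabel_color, relabel_color]

theorem expand_wordMonomial (η : Half) (w : List (I × ℤ)) :
    expand K (wordHom_injective η w) (wordMonomial K w) =
      ((∏ a : Fin w.length, expansionVar K η a ^ (w.get a).2 : (Expansion K w.length)ˣ) :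
          Expansion K w.length) := by
  rw [wordMonomial, map_prod, Units.coe_prod]
  refine Fintype.prod_bijective (relabel w) (relabel_bijective w) _ _ fun v => ?_
  rw [← expand_wordHom_rationalVar, ← map_zpow]
  rfl

omit [Fintype I] in
theorem expand_wordHom_algebraMap (η : Half) (w : List (I × ℤ)) (f : Laurent K (Var (wordDeg w))) :
    expand K (wordHom_injective η w) (algebraMap _ _ f) =
      evalAt K (fun v => expansionVar K η (relabel w v)) f := by
  have : (expand K (wordHom_injective η w)).comp
      (IsScalarTower.toAlgHom K (Laurent K (Var (wordDeg w))) (Rational K (Var (wordDeg w)))) =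
      evalAt K (fun v => expansionVar K η (relabel w v)) := by
    refine laurent_algHom_ext fun v => ?_
    rw [evalAt_laurentVar, ← expand_wordHom_rationalVar]
    rfl
  exact DFunLike.congr_fun this f

theorem pairWord_eq_coeff (η : Half) (w : List (I × ℤ)) (S : symLaurent K (wordDeg w)) :
    pairWord ζt η w S = (expand K (wordHom_injective η w)
      (wordMonomial K w * algebraMap _ _ (S : Laurent K (Var (wordDeg w))) /
        wordCross ζt η.opp w)).coeff 0 := by
  rw [map_div₀, map_mul, expand_wordMonomial, expand_wordHom_algebraMap, expand_wordCross]
  rfl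

/-- The exponent vector of the monomial of a word. -/
def wordExp (w : List (I × ℤ)) : Var (wordDeg w) →₀ ℤ :=
  Finsupp.equivFunOnFinite.symm fun v => (w.get (relabel w v)).2

theorem wordMonomial_eq (w : List (I × ℤ)) :
    wordMonomial K w = algebraMap _ _ (AddMonoidAlgebra.single (wordExp w) (1 : K)) := by
  rw [single_eq_prod_laurentVar, Finsupp.prod_fintype _ _ fun v => zpow_zero _, Units.coe_prod,
    map_prod, wordMonomial]
  refine Finset.prod_congr rfl fun v _ => ?_
  rw [rationalVar, ← map_zpow]
  rfl

omit [Fintype I] in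
theorem zetaEval_rationalVar {n : I → ℕ} (u v : Var n) :
    zetaEval ζt u.1 v.1 (rationalVar K u / rationalVar K v) =
      (invZeta ζt (Sigma.fst : Var n → I) u v)⁻¹ := by
  have h1 : (rationalVar K u / rationalVar K v : (Rational K (Var n))ˣ) =
      Units.map (IsScalarTower.toAlgHom K (Laurent K (Var n)) (Rational K (Var n)) :
        Laurent K (Var n) →* Rational K (Var n)) (laurentVar K u / laurentVar K v) :=
    (map_div _ _ _).symm
  have h2 : ((rationalVar K u / rationalVar K v : (Rational K (Var n))ˣ) : Rational K (Var n)) =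
      algebraMap (Laurent K (Var n)) _
        (AddMonoidAlgebra.single (Finsupp.single u 1 - Finsupp.single v 1) (1 : K)) := by
    rw [h1, laurentVar, laurentVar, ← map_div, ← ofAdd_sub]
    rfl
  rw [zetaEval, h2, h1, ← map_eval₂, invZeta, inv_div, zetaDen,
    apply_ite (algebraMap (Laurent K (Var n)) (Rational K (Var n))), map_sub, map_one]
  rfl

omit [Fintype I] in
theorem invZeta_ne_zero {σ : Type*} {ζt : I → I → K[T;T⁻¹]} (hζ : IsFactored ζt) (c : σ → I)
    {u v : σ} (h : u ≠ v) : invZeta ζt c u v ≠ 0 := by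
  refine div_ne_zero ?_ (zetaNum_ne_zero' hζ c h)
  rw [Ne, FaithfulSMul.algebraMap_eq_zero_iff]
  exact zetaDen_ne_zero c h

/-- The denominator of the pairing of a word with heights in the order of the letters. -/
theorem wordCross_opp {η : Half} {w : List (I × ℤ)} {h : Var (wordDeg w) ↪ ℕ}
    (hh : IsCompatible η w h) :
    wordCross ζt η.opp w = (kernelFun ζt (Sigma.fst : Var (wordDeg w) → I) h)⁻¹ := by
  have key : wordCross ζt η.opp w = ∏ u : Var (wordDeg w), ∏ v : Var (wordDeg w),
      if h u < h v then (invZeta ζt (Sigma.fst : Var (wordDeg w) → I) u v)⁻¹ else 1 := by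
    cases η
    · rw [Finset.prod_comm]
      refine Finset.prod_congr rfl fun u _ => Finset.prod_congr rfl fun v _ => ?_
      refine if_congr (hh v u).symm ?_ rfl
      exact zetaEval_rationalVar ζt v u
    · refine Finset.prod_congr rfl fun u _ => Finset.prod_congr rfl fun v _ => ?_
      refine if_congr (hh u v).symm ?_ rfl
      exact zetaEval_rationalVar ζt u v
  simp only [key, kernelFun, ← Finset.prod_inv_distrib, apply_ite (fun x : Rational K _ => x⁻¹),
    inv_one]

/-- The product of the functions `ζ(z_u/z_v)` over all pairs of different variables. -/
def totalZeta (n : I → ℕ) : Rational K (Var n) :=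
  ∏ u : Var n, ∏ v : Var n, if u = v then 1 else (invZeta ζt (Sigma.fst : Var n → I) u v)⁻¹

/-- The two signs of the pairs of letters complement each other to all pairs of variables. -/
theorem wordCross_eq {ζt : I → I → K[T;T⁻¹]} (hζ : IsFactored ζt) {η : Half} {w : List (I × ℤ)}
    {h : Var (wordDeg w) ↪ ℕ} (hh : IsCompatible η w h) :
    wordCross ζt η w =
      totalZeta ζt (wordDeg w) * kernelFun ζt (Sigma.fst : Var (wordDeg w) → I) h := by
  have key : wordCross ζt η w = ∏ u : Var (wordDeg w), ∏ v : Var (wordDeg w),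
      if h v < h u then (invZeta ζt (Sigma.fst : Var (wordDeg w) → I) u v)⁻¹ else 1 := by
    cases η
    · refine Finset.prod_congr rfl fun u _ => Finset.prod_congr rfl fun v _ => ?_
      refine if_congr (hh v u).symm ?_ rfl
      exact zetaEval_rationalVar ζt u v
    · rw [Finset.prod_comm]
      refine Finset.prod_congr rfl fun u _ => Finset.prod_congr rfl fun v _ => ?_
      refine if_congr (hh u v).symm ?_ rfl
      exact zetaEval_rationalVar ζt v u
  rw [key, totalZeta, kernelFun, ← Finset.prod_mul_distrib]
  refine Finset.prod_congr rfl fun u _ => ?_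
  rw [← Finset.prod_mul_distrib]
  refine Finset.prod_congr rfl fun v _ => ?_
  rcases lt_trichotomy (h u) (h v) with huv | huv | huv
  · have hne : u ≠ v := by rintro rfl; exact lt_irrefl _ huv
    rw [if_neg huv.not_gt, if_neg hne, if_pos huv, inv_mul_cancel₀ (invZeta_ne_zero hζ _ hne)]
  · rw [if_neg huv.not_gt, if_neg huv.not_lt, if_pos (h.injective huv), one_mul]
  · have hne : u ≠ v := by rintro rfl; exact lt_irrefl _ huv
    rw [if_pos huv, if_neg hne, if_neg huv.not_gt, mul_one]

/-- The function of a word is, up to a factor common to all words, a single summand of the map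
`relMap`. -/
theorem wordFun_eq {ζt : I → I → K[T;T⁻¹]} (hζ : IsFactored ζt) {η : Half} {w : List (I × ℤ)}
    {h : Var (wordDeg w) ↪ ℕ} (hh : IsCompatible η w h) :
    wordFun ζt η w = totalZeta ζt (wordDeg w) *
      relMap ζt Sigma.fst (Finsupp.single h (AddMonoidAlgebra.single (wordExp w) 1)) := by
  rw [relMap_single, ← wordMonomial_eq, mul_left_comm, ← wordCross_eq hζ hh]
  rfl

/-- The expansion in the region of the pairing can be replaced by the expansion in the region of any
heights in the order of the letters. -/
theorem pairWord_eq {ζt : I → I → K[T;T⁻¹]} (hζ : IsFactored ζt) {η : Half} {w : List (I × ℤ)}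
    {h : Var (wordDeg w) ↪ ℕ} (hh : IsCompatible η w h) (S : symLaurent K (wordDeg w)) :
    pairWord ζt η w S =
      pairMap ζt Sigma.fst S (Finsupp.single h (AddMonoidAlgebra.single (wordExp w) 1)) := by
  rw [pairMap_single, ← mul_assoc, ← wordMonomial_eq, pairWord_eq_coeff, wordCross_opp ζt hh,
    div_inv_eq_mul, wordMonomial_eq, ← map_mul]
  have := sameCoeff_expand_kernelFun hζ (Sigma.fst : Var (wordDeg w) → I) h
    (wordHom_injective η w) (heightHom_injective h)
    (fun u v huv => wordHom_pos η w ((hh u v).mp huv)) (fun u v huv => heightHom_pos h huv)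
    (AddMonoidAlgebra.single (wordExp w) 1 * (S : Laurent K (Var (wordDeg w)))) 0
  rw [map_zero, map_zero] at this
  exact this

end WordPairing

/-! ### The shuffle algebra and the ideal of relations -/

section Degree

variable {K : Type*} [Field K] {I : Type*}

section Transport

variable [DecidableEq I] [Fintype I] (ζt : I → I → K[T;T⁻¹]) {m n : I → ℕ}
  (e : ∀ i, Fin (m i) ≃ Fin (n i))

theorem renameRational_kernelFun_varMap (h : Var n ↪ ℕ) :
    renameRational K (varMap fun i => (e i).toEmbedding) (kernelFun ζt Sigma.fst
      ((varMap fun i => (e i).toEmbedding).trans h)) = kernelFun ζt Sigma.fst h := by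
  refine (renameRational_kernelFun ζt _ Sigma.fst h).trans ?_
  exact Fintype.prod_equiv (Equiv.sigmaCongrRight e) _ _ fun u =>
    Fintype.prod_equiv (Equiv.sigmaCongrRight e) _ _ fun v => rfl

theorem renameRational_totalZeta :
    renameRational K (varMap fun i => (e i).toEmbedding) (totalZeta ζt m) = totalZeta ζt n := by
  rw [totalZeta, map_prod]
  refine Fintype.prod_equiv (Equiv.sigmaCongrRight e) _ _ fun u => ?_
  rw [map_prod]
  refine Fintype.prod_equiv (Equiv.sigmaCongrRight e) _ _ fun v => ?_
  rw [apply_ite (renameRational K _), map_one, map_inv₀]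
  exact if_congr (Equiv.sigmaCongrRight e).apply_eq_iff_eq.symm rfl
    (congrArg _ (renameRational_invZeta ζt _ Sigma.fst u v))

omit [DecidableEq I] [Fintype I] in
include e in
theorem eq_of_equiv_fin : m = n := funext fun i => Fin.equiv_iff_eq.mp ⟨e i⟩

end Transport

/-- A bijection of variables that preserves the colours is a family of bijections. -/
theorem exists_varMap_eq {m n : I → ℕ} (b : Var m ≃ Var n) (hb : ∀ v, (b v).1 = v.1) :
    ∃ e : ∀ i, Fin (m i) ≃ Fin (n i), ∀ v, varMap (fun i => (e i).toEmbedding) v = b v := by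
  have h1 : ∀ (i : I) (a : Fin (m i)), ∃ a' : Fin (n i), b ⟨i, a⟩ = ⟨i, a'⟩ := by
    intro i a
    have h2 := hb ⟨i, a⟩
    revert h2
    generalize b ⟨i, a⟩ = x
    rintro rfl
    exact ⟨x.2, rfl⟩
  choose f hf using h1
  have hbij : ∀ i, Function.Bijective (f i) := by
    intro i
    constructor
    · intro a a' haa
      have : b ⟨i, a⟩ = b ⟨i, a'⟩ := by rw [hf, hf, haa]
      exact eq_of_heq (Sigma.mk.inj (b.injective this)).2
    · intro a'
      obtain ⟨⟨j, a⟩, hv⟩ := b.surjective ⟨i, a'⟩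
      have hj : i = j := by
        have := hb ⟨j, a⟩
        rw [hv] at this
        exact this
      subst hj
      rw [hf] at hv
      exact ⟨a, eq_of_heq (Sigma.mk.inj hv).2⟩
  exact ⟨fun i => Equiv.ofBijective (f i) (hbij i), fun ⟨i, a⟩ => (hf i a).symm⟩

variable [DecidableEq I] [Fintype I]

/-- The variables can be enumerated in the order prescribed by heights. -/
theorem exists_enumeration {σ : Type*} [Fintype σ] (η : Half) (h : σ ↪ ℕ) :
    ∃ (N : ℕ) (g : Fin N ≃ σ), ∀ a b, h (g a) < h (g b) ↔ η.Before a b := by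
  have hmin : ∃ (N : ℕ) (g : Fin N ≃ σ), ∀ a b, h (g a) < h (g b) ↔ a < b := by
    have hmem : ∀ x, h x ∈ Finset.univ.map h := fun x =>
      Finset.mem_map_of_mem h (Finset.mem_univ x)
    have hbij : Function.Bijective
        (fun x : σ => (⟨h x, hmem x⟩ : (Finset.univ.map h : Finset ℕ))) := by
      refine ⟨fun x y hxy => h.injective (congrArg Subtype.val hxy), ?_⟩
      rintro ⟨y, hy⟩
      obtain ⟨x, -, rfl⟩ := Finset.mem_map.mp hy
      exact ⟨x, rfl⟩
    refine ⟨_, ((Finset.univ.map h).orderIsoOfFin rfl).toEquiv.trans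
      (Equiv.ofBijective _ hbij).symm, fun a b => ?_⟩
    have key : ∀ c, h (((Finset.univ.map h).orderIsoOfFin rfl).toEquiv.trans
        (Equiv.ofBijective _ hbij).symm c) = ((Finset.univ.map h).orderIsoOfFin rfl c : ℕ) :=
      fun c => congrArg Subtype.val ((Equiv.ofBijective _ hbij).apply_symm_apply
        ((Finset.univ.map h).orderIsoOfFin rfl c))
    rw [key, key]
    exact ((Finset.univ.map h).orderIsoOfFin rfl).lt_iff_lt
  obtain ⟨N, g, hg⟩ := hmin
  cases η
  · exact ⟨N, Fin.revPerm.trans g, fun a b => (hg _ _).trans Fin.rev_lt_rev⟩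
  · exact ⟨N, g, hg⟩

/-- Every monomial and every order of the variables come from a word. -/
theorem exists_word (η : Half) {n : I → ℕ} (h : Var n ↪ ℕ) (m : Var n →₀ ℤ) :
    ∃ (w : List (I × ℤ)) (e : ∀ i, Fin (wordDeg w i) ≃ Fin (n i)),
      (wordExp w).mapDomain (varMap fun i => (e i).toEmbedding) = m ∧
      IsCompatible η w ((varMap fun i => (e i).toEmbedding).trans h) := by
  obtain ⟨N, g, hg⟩ := exists_enumeration η h
  set w : List (I × ℤ) := List.ofFn fun a => ((g a).1, m (g a)) with hw
  have hlen : w.length = N := List.length_ofFn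
  have hget : ∀ a, w.get a = ((g (Fin.cast hlen a)).1, m (g (Fin.cast hlen a))) := fun a =>
    List.get_ofFn _ _
  obtain ⟨e, he⟩ := exists_varMap_eq
    (((Equiv.ofBijective _ (relabel_bijective w)).trans (finCongr hlen)).trans g) (by
      intro v
      have h1 := relabel_color w v
      rw [hget] at h1
      exact h1)
  have he' : ∀ v, varMap (fun i => (e i).toEmbedding) v = g (Fin.cast hlen (relabel w v)) := he
  refine ⟨w, e, ?_, ?_⟩
  · ext v
    obtain ⟨v, rfl⟩ := (Equiv.sigmaCongrRight e).surjective v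
    have h1 : (Equiv.sigmaCongrRight e) v = varMap (fun i => (e i).toEmbedding) v := rfl
    rw [h1, Finsupp.mapDomain_apply (varMap fun i => (e i).toEmbedding).injective, he']
    change (w.get (relabel w v)).2 = _
    rw [hget]
  · intro u v
    rw [Function.Embedding.trans_apply, Function.Embedding.trans_apply, he', he', hg]
    cases η <;> rfl

omit [Fintype I] in
theorem exists_isCompatible (η : Half) (w : List (I × ℤ)) {n : I → ℕ}
    (e : ∀ i, Fin (wordDeg w i) ≃ Fin (n i)) :
    ∃ h : Var n ↪ ℕ, IsCompatible η w ((varMap fun i => (e i).toEmbedding).trans h) := by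
  have key : ∃ h : Fin w.length ↪ ℕ, ∀ a b, h a < h b ↔ η.Before a b := by
    cases η
    · exact ⟨Fin.revPerm.toEmbedding.trans Fin.valEmbedding, fun a b => Fin.rev_lt_rev⟩
    · exact ⟨Fin.valEmbedding, fun a b => Iff.rfl⟩
  obtain ⟨h, hh⟩ := key
  refine ⟨((Equiv.sigmaCongrRight e).symm.toEmbedding.trans
    (Equiv.ofBijective _ (relabel_bijective w)).toEmbedding).trans h, fun u v => ?_⟩
  have h1 : ∀ v, ((varMap fun i => (e i).toEmbedding).trans
      (((Equiv.sigmaCongrRight e).symm.toEmbedding.trans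
        (Equiv.ofBijective _ (relabel_bijective w)).toEmbedding).trans h)) v =
      h (relabel w v) := fun v =>
    congrArg (fun x => h (relabel w x)) ((Equiv.sigmaCongrRight e).symm_apply_apply v)
  rw [h1, h1, hh]

variable {ζt : I → I → K[T;T⁻¹]}

/-- The function of a word in terms of the variables `z_{ia}`. -/
theorem renameRational_wordFun (hζ : IsFactored ζt) {η : Half} {w : List (I × ℤ)} {n : I → ℕ}
    {e : ∀ i, Fin (wordDeg w i) ≃ Fin (n i)} {h : Var n ↪ ℕ}
    (hh : IsCompatible η w ((varMap fun i => (e i).toEmbedding).trans h)) :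
    renameRational K (varMap fun i => (e i).toEmbedding) (wordFun ζt η w) =
      totalZeta ζt n * relMap ζt Sigma.fst (Finsupp.single h (AddMonoidAlgebra.single
        ((wordExp w).mapDomain (varMap fun i => (e i).toEmbedding)) 1)) := by
  rw [wordFun_eq hζ hh, map_mul, renameRational_totalZeta, relMap_single, relMap_single, map_mul,
    renameRational_kernelFun_varMap, renameRational_algebraMap, rename_single]

theorem pairing_word (hζ : IsFactored ζt) {η : Half} {w : FreeMonoid (I × ℤ)} {n : I → ℕ}
    {e : ∀ i, Fin (wordDeg w.toList i) ≃ Fin (n i)} {h : Var n ↪ ℕ}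
    (hh : IsCompatible η w.toList ((varMap fun i => (e i).toEmbedding).trans h))
    (S : symLaurent K n) :
    pairing ζt η (FreeAlgebra.basisFreeMonoid K (I × ℤ) w) (DirectSum.lof K (I → ℕ) _ n S) =
      pairMap ζt Sigma.fst S (Finsupp.single h (AddMonoidAlgebra.single
        ((wordExp w.toList).mapDomain (varMap fun i => (e i).toEmbedding)) 1)) := by
  obtain rfl : wordDeg w.toList = n := eq_of_equiv_fin e
  rw [pairing, Module.Basis.constr_basis, LinearMap.comp_apply, DirectSum.component.lof_self,
    pairWord_eq hζ hh, pairMap_single, pairMap_single, ← constTerm_renameRational]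
  refine congrArg (constTerm h) ?_
  have h1 := S.2 e
  rw [map_mul, map_mul, renameRational_kernelFun_varMap, renameRational_algebraMap,
    renameRational_algebraMap, rename_single, h1]

theorem pairing_word_of_ne {η : Half} {w : FreeMonoid (I × ℤ)} {n : I → ℕ}
    (hn : wordDeg w.toList ≠ n) (S : symLaurent K n) :
    pairing ζt η (FreeAlgebra.basisFreeMonoid K (I × ℤ) w) (DirectSum.lof K (I → ℕ) _ n S) =
      0 := by
  rw [pairing, Module.Basis.constr_basis, LinearMap.comp_apply, DirectSum.component.of, dif_neg,
    map_zero]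
  exact hn.symm

theorem upsilon_word [CharZero K] (η : Half) (w : FreeMonoid (I × ℤ)) :
    upsilon ζt η (FreeAlgebra.basisFreeMonoid K (I × ℤ) w) =
      DirectSum.lof K (I → ℕ) (fun n => Rational K (Var n)) (wordDeg w.toList)
        (symmetrize (wordFun ζt η w.toList)) := by
  rw [upsilon, Module.Basis.constr_basis, upsilonWord_eq_symmetrize]

theorem component_lof_symmetrize {m : I → ℕ} (n : I → ℕ) (f : Rational K (Var m)) :
    DirectSum.component K (I → ℕ) (fun n => Rational K (Var n)) n
        (DirectSum.lof K (I → ℕ) (fun n => Rational K (Var n)) m (symmetrize f)) =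
      ∑ e : ∀ i, Fin (m i) ≃ Fin (n i), renameRational K (varMap fun i => (e i).toEmbedding) f := by
  by_cases hmn : m = n
  · subst hmn
    rw [DirectSum.component.lof_self]
    rfl
  · have : IsEmpty (∀ i, Fin (m i) ≃ Fin (n i)) := ⟨fun e => hmn (eq_of_equiv_fin e)⟩
    rw [DirectSum.component.of, dif_neg hmn, Finset.univ_eq_empty, Finset.sum_empty]

theorem lof_symmetrize {m n : I → ℕ} (e : ∀ i, Fin (m i) ≃ Fin (n i)) (f : Rational K (Var m)) :
    DirectSum.lof K (I → ℕ) (fun n => Rational K (Var n)) m (symmetrize f) =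
      DirectSum.lof K (I → ℕ) (fun n => Rational K (Var n)) n
        (symmetrize (renameRational K (varMap fun i => (e i).toEmbedding) f)) := by
  obtain rfl : m = n := eq_of_equiv_fin e
  rw [symmetrize_perm]

theorem mem_shuffleDegree {ε : Half} {n : I → ℕ} {S : Laurent K (Var n)} :
    S ∈ shuffleDegree ζt ε n ↔ ∃ hS : S ∈ symLaurent K n, ∀ x, upsilon ζt ε.opp x = 0 →
      pairing ζt ε.opp x (DirectSum.lof K (I → ℕ) (fun n => symLaurent K n) n ⟨S, hS⟩) = 0 := by
  simp only [shuffleDegree, shuffleAlgebra, Submodule.mem_map, Submodule.mem_comap,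
    Submodule.mem_iInf, LinearMap.mem_ker, Submodule.subtype_apply]
  constructor
  · rintro ⟨⟨S, hS⟩, h, rfl⟩
    exact ⟨hS, h⟩
  · rintro ⟨hS, h⟩
    exact ⟨⟨S, hS⟩, h, rfl⟩

theorem totalZeta_ne_zero (hζ : IsFactored ζt) (n : I → ℕ) : totalZeta ζt n ≠ 0 := by
  refine Finset.prod_ne_zero_iff.mpr fun u _ => Finset.prod_ne_zero_iff.mpr fun v _ => ?_
  split_ifs with h
  · exact one_ne_zero
  · exact inv_ne_zero (invZeta_ne_zero hζ _ h)

/-- An element of the kernel of `upsilon` gives a relation among the functions `kernelFun`, by taking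
the sum over all identifications of the variables of its words with the variables `z_{ia}`; for
symmetric elements all of these contribute equally to the pairing. -/
theorem mem_shuffleDegree_of_mem_relIdealVar [CharZero K] (hζ : IsFactored ζt) (ε : Half)
    {n : I → ℕ} {S : Laurent K (Var n)} (hS : S ∈ symLaurent K n) (h : S ∈ relIdealVar ζt n) :
    S ∈ shuffleDegree ζt ε n := by
  refine mem_shuffleDegree.mpr ⟨hS, fun x hx => ?_⟩
  choose hgt hhgt using fun (w : FreeMonoid (I × ℤ)) =>
    exists_isCompatible ε.opp w.toList (n := n)
  -- the relation among the functions `kernelFun` given by an element of the free algebra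
  obtain ⟨Φ, hΦ⟩ : ∃ Φ : FreeAlgebra K (I × ℤ) →ₗ[K] ((Var n ↪ ℕ) →₀ Laurent K (Var n)),
      ∀ w, Φ (FreeAlgebra.basisFreeMonoid K (I × ℤ) w) =
        ∑ e : ∀ i, Fin (wordDeg w.toList i) ≃ Fin (n i), Finsupp.single (hgt w e)
          (AddMonoidAlgebra.single
            ((wordExp w.toList).mapDomain (varMap fun i => (e i).toEmbedding)) 1) :=
    ⟨(FreeAlgebra.basisFreeMonoid K (I × ℤ)).constr K _, fun w => Module.Basis.constr_basis _ _ _ _⟩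
  have h1 : (DirectSum.component K (I → ℕ) (fun n => Rational K (Var n)) n).comp
      (upsilon ζt ε.opp) =
      (LinearMap.mulLeft K (totalZeta ζt n)).comp ((relMap ζt Sigma.fst).comp Φ) := by
    refine (FreeAlgebra.basisFreeMonoid K (I × ℤ)).ext fun w => ?_
    rw [LinearMap.comp_apply, LinearMap.comp_apply, LinearMap.comp_apply, upsilon_word,
      component_lof_symmetrize, hΦ, map_sum, map_sum]
    refine Finset.sum_congr rfl fun e _ => ?_
    rw [renameRational_wordFun hζ (hhgt w e), LinearMap.mulLeft_apply]
  have h2 : (pairMap ζt Sigma.fst S).comp Φ = ((∏ i, (n i).factorial : ℕ) : K) •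
      (pairing ζt ε.opp).flip
        (DirectSum.lof K (I → ℕ) (fun n => symLaurent K n) n ⟨S, hS⟩) := by
    refine (FreeAlgebra.basisFreeMonoid K (I × ℤ)).ext fun w => ?_
    rw [LinearMap.comp_apply, hΦ, map_sum, LinearMap.smul_apply, LinearMap.flip_apply]
    by_cases hmn : wordDeg w.toList = n
    · rw [Finset.sum_congr rfl fun e _ => (pairing_word hζ (hhgt w e) ⟨S, hS⟩).symm,
        Finset.sum_const, Finset.card_univ, Nat.cast_smul_eq_nsmul, ← card_perm]
      subst hmn
      rfl
    · have : IsEmpty (∀ i, Fin (wordDeg w.toList i) ≃ Fin (n i)) :=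
        ⟨fun e => hmn (eq_of_equiv_fin e)⟩
      rw [pairing_word_of_ne hmn, smul_zero, Finset.univ_eq_empty, Finset.sum_empty]
  have h3 : relMap ζt Sigma.fst (Φ x) = 0 := by
    have := DFunLike.congr_fun h1 x
    rw [LinearMap.comp_apply, hx, map_zero] at this
    exact (mul_eq_zero.mp this.symm).resolve_left (totalZeta_ne_zero hζ n)
  have h4 := DFunLike.congr_fun h2 x
  rw [LinearMap.comp_apply, (mem_relIdeal ζt).mp h _ h3, LinearMap.smul_apply,
    LinearMap.flip_apply] at h4
  refine (smul_eq_zero.mp h4.symm).resolve_left ?_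
  exact Nat.cast_ne_zero.mpr (Finset.prod_ne_zero_iff.mpr fun i _ => Nat.factorial_ne_zero _)

theorem linearMap_ext_single {ι M V : Type*} [AddCommGroup V] [Module K V]
    {L L' : (ι →₀ AddMonoidAlgebra K M) →ₗ[K] V}
    (h : ∀ i m, L (Finsupp.single i (AddMonoidAlgebra.single m 1)) =
      L' (Finsupp.single i (AddMonoidAlgebra.single m 1))) : L = L' := by
  refine Finsupp.lhom_ext fun i f => ?_
  induction f using AddMonoidAlgebra.induction_linear with
  | zero => simp only [Finsupp.single_zero, map_zero]
  | add f g hf hg => simp only [Finsupp.single_add, map_add, hf, hg]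
  | single m r =>
    have : Finsupp.single i (AddMonoidAlgebra.single m r) =
        r • Finsupp.single i (AddMonoidAlgebra.single m (1 : K)) := by
      rw [Finsupp.smul_single, AddMonoidAlgebra.smul_single, smul_eq_mul, mul_one]
    rw [this, map_smul, map_smul, h]

variable (K) in
/-- Symmetrization as a linear map. -/
def symmetrizeLinear (n : I → ℕ) : Rational K (Var n) →ₗ[K] Rational K (Var n) :=
  ∑ s : ∀ i, Equiv.Perm (Fin (n i)),
    (renameRational K (varMap fun i => (s i).toEmbedding)).toLinearMap

theorem symmetrizeLinear_apply (n : I → ℕ) (f : Rational K (Var n)) :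
    symmetrizeLinear K n f = symmetrize f := by
  rw [symmetrizeLinear, LinearMap.sum_apply]
  rfl

/-- A relation among the functions `kernelFun` is realized by an element of the free algebra, and
this element is in the kernel of `upsilon` because its image is the symmetrization of the relation. -/
theorem mem_relIdealVar_of_mem_shuffleDegree [CharZero K] (hζ : IsFactored ζt) {ε : Half}
    {n : I → ℕ} {S : Laurent K (Var n)} (h : S ∈ shuffleDegree ζt ε n) :
    S ∈ relIdealVar ζt n := by
  obtain ⟨hS, h⟩ := mem_shuffleDegree.mp h
  refine (mem_relIdeal ζt).mpr fun φ hφ => ?_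
  choose w e hexp hcompat using fun (h : Var n ↪ ℕ) (m : Var n →₀ ℤ) => exists_word ε.opp h m
  obtain ⟨A, hA⟩ : ∃ A : ((Var n ↪ ℕ) →₀ Laurent K (Var n)) →ₗ[K] FreeAlgebra K (I × ℤ),
      ∀ h m r, A (Finsupp.single h (AddMonoidAlgebra.single m r)) =
        r • FreeAlgebra.basisFreeMonoid K (I × ℤ) (FreeMonoid.ofList (w h m)) := by
    refine ⟨Finsupp.lsum K fun h => (Finsupp.lsum K fun m => LinearMap.toSpanSingleton K _
      (FreeAlgebra.basisFreeMonoid K (I × ℤ) (FreeMonoid.ofList (w h m)))).comp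
      (AddMonoidAlgebra.coeffLinearEquiv K).toLinearMap, fun h m r => ?_⟩
    simp
  have h1 : (upsilon ζt ε.opp).comp A =
      (DirectSum.lof K (I → ℕ) (fun n => Rational K (Var n)) n).comp
        ((symmetrizeLinear K n).comp
          ((LinearMap.mulLeft K (totalZeta ζt n)).comp (relMap ζt Sigma.fst))) := by
    refine linearMap_ext_single fun h m => ?_
    rw [LinearMap.comp_apply, hA, one_smul, upsilon_word]
    refine (lof_symmetrize (e h m) (wordFun ζt ε.opp (w h m))).trans ?_
    rw [renameRational_wordFun hζ (hcompat h m), hexp, ← symmetrizeLinear_apply]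
    rfl
  have h2 : ((pairing ζt ε.opp).flip
      (DirectSum.lof K (I → ℕ) (fun n => symLaurent K n) n ⟨S, hS⟩)).comp A =
      pairMap ζt Sigma.fst S := by
    refine linearMap_ext_single fun h m => ?_
    rw [LinearMap.comp_apply, hA, one_smul, LinearMap.flip_apply,
      pairing_word hζ (w := FreeMonoid.ofList (w h m)) (hcompat h m)]
    exact congrArg (fun m => pairMap ζt Sigma.fst S
      (Finsupp.single h (AddMonoidAlgebra.single m 1))) (hexp h m)
  rw [← h2]
  refine h _ ?_
  have h3 := DFunLike.congr_fun h1 φ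
  rw [LinearMap.comp_apply] at h3
  rw [h3]
  simp only [LinearMap.comp_apply, hφ, map_zero]

theorem shuffleDegree_eq [CharZero K] (hζ : IsFactored ζt) (ε : Half) (n : I → ℕ) :
    shuffleDegree ζt ε n = symLaurent K n ⊓ (relIdealVar ζt n).restrictScalars K := by
  refine le_antisymm (fun S hS => ⟨(mem_shuffleDegree.mp hS).1,
    mem_relIdealVar_of_mem_shuffleDegree hζ hS⟩) ?_
  rintro S ⟨hS, h⟩
  exact mem_shuffleDegree_of_mem_relIdealVar hζ ε hS h

end Degree

end

end QuiverShuffle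

open QuiverShuffle in
theorem mainTheorem3 {K : Type*} [Field K] [CharZero K] {I : Type*} [Fintype I] [DecidableEq I]
    (ζt : I → I → K[T;T⁻¹])
    (α : I → I → Kˣ) (s : I → I → ℤ) (N : I → I → ℕ) (q : ∀ i j : I, Fin (N i j) → Kˣ)
    (hζ : ∀ i j : I, ζt i j = LaurentPolynomial.C (α i j : K) * LaurentPolynomial.T (s i j) *
      ∏ e : Fin (N i j), (1 - LaurentPolynomial.T 1 * LaurentPolynomial.C (q i j e : K))) :
    ∃ 𝓘 : ∀ k : I → ℕ, PointClass K k → Ideal (Laurent K (Var k)),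
      (∀ (k : I → ℕ) (p : PointClass K k), IsHomogeneousIdeal (𝓘 k p)) ∧
      (∀ (k : I → ℕ) (p : Var k → Kˣ), IsSupportedOnLine p (𝓘 k (pointClass p))) ∧
      ∀ (ε : Half) (n : I → ℕ),
        shuffleDegree ζt ε n =
          symLaurent K n ⊓
            ⨅ k : I → ℕ, ⨅ _ : k ≤ n, ⨅ p : PointClass K k,
              (inducedIdeal (𝓘 k p) n).restrictScalars K := by
  have hfac : IsFactored ζt := fun i j => ⟨α i j, s i j, N i j, q i j, hζ i j⟩
  refine ⟨pointIdeal ζt, isHomogeneousIdeal_pointIdeal hfac, isSupportedOnLine_pointIdeal,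
    fun ε n => ?_⟩
  rw [shuffleDegree_eq hfac, relIdealVar_restrictScalars hfac]
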